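/- \textbf{Theorem.} Work in the real RAM model: a memory of real numbers and of natural-number indices, with indirect addressing, where exact arithmetic operations and comparisons on reals, elementary index operations and tests, and the rounding operation $(x,p)\mapsto$ "nearest multiple of $2^{-p}$ to $x$" each cost one operation. Call a scaling problem a tuple $(A,r,c,\varepsilon)$ with $A\in\mathbb R_{\ge 0}^{m\times n}$, $r\in\mathbb R_{>0}^m$, $c\in\mathbb R_{>0}^n$, $\sum_i r_i=\sum_j c_j=:s$ and $\varepsilon>0$. The input consists of $m,n$, a list (in any order) of the $\mathrm{nnz}(A)$ nonzero entries of $A$ with their positions, and $r,c,\varepsilon$. There are one deterministic program and a constant $K\in\mathbb N$ such that, for every scaling problem, the program halts and the following hold. (1) It outputs either $x\in\mathbb R_{>0}^m$ and $y\in\mathbb R_{>0}^n$ such that $B=\mathrm{diag}(x)\,A\,\mathrm{diag}(y)$ satisfies $$\sum_{i}\Big(\sum_j B_{ij}-r_i\Big)^2+\sum_{j}\Big(\sum_i B_{ij}-c_j\Big)^2\le\varepsilon^2,$$ or a set $T\subseteq[n]$ with $\sum_{j\in T}c_j>\sum_{i\in N(T)}r_i$, where $N(T)=\{i:\exists j\in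 T,\ A_{ij}>0\}$ (a certificate of infeasibility). (2) The number of iterations is at most $K n^3\max\{0,\log(sn/\varepsilon)\}$ (and hence $0$ when $n=0$). Each iteration takes at most $K\,\mathrm{nnz}(A)\,(1+\lfloor\log_2\mathrm{nnz}(A)\rfloor)^K=\tilde O(\mathrm{nnz}(A))$ operations, where the last iteration includes writing the output. The initialization before the first iteration (the whole run if there is no iteration) takes at most $K M(1+\lfloor\log_2 M\rfloor)^K$ operations, with $M=\mathrm{nnz}(A)+m+n+1$. (3) The current column scaling $y\in\mathbb R^n$ at the start of every iteration is entrywise positive. If every entry of $A$ is a rational number of bit complexity at most $b$, then every entry of the column scalings at the start of the iterations, and of the column scaling that is output, is a rational number of bit complexity at most $K(n+m+b+1)^K\log(2+s/\varepsilon)$. (4) If moreover all entries of $r$ and $c$ and the number $\varepsilon$ are rational numbers of bit complexity at most $b$, then every real number held in memory at any time during the run is rational of bit complexity at most $K(n+m+b+1)^K$. Here the bit complexity of a rational number is the total number of binary digits of the numerator and the denominator of its reduced fraction. -/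

import Mathlib

open Matrix

namespace MatrixScaling

/-! ### The matrix scaling problem -/

/-- `B` is `ε`-approximately `(r, c)`-scaled. -/
def IsApproxScaled {m n : ℕ} (r : Fin m → ℝ) (c : Fin n → ℝ) (ε : ℝ)
    (B : Matrix (Fin m) (Fin n) ℝ) : Prop :=
  ∑ i, (∑ j, B i j - r i) ^ 2 + ∑ j, (∑ i, B i j - c j) ^ 2 ≤ ε ^ 2

/-- The positive diagonal matrices `L = diag x`, `R = diag y` are `ε`-approximate scalings of `A`. -/
def IsApproxScaling {m n : ℕ} (A : Matrix (Fin m) (Fin n) ℝ) (r : Fin m → ℝ) (c : Fin n → ℝ)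
    (ε : ℝ) (x : Fin m → ℝ) (y : Fin n → ℝ) : Prop :=
  (∀ i, 0 < x i) ∧ (∀ j, 0 < y j) ∧
    IsApproxScaled r c ε (Matrix.diagonal x * A * Matrix.diagonal y)

open Classical in
/-- The neighbourhood `N(T)` of a set `T` of columns. -/
noncomputable def neighborhood {m n : ℕ} (A : Matrix (Fin m) (Fin n) ℝ) (T : Finset (Fin n)) :
    Finset (Fin m) :=
  Finset.univ.filter fun i => ∃ j ∈ T, 0 < A i j

/-- `T` certifies infeasibility: `c(T) > r(N(T))`. -/
def IsInfeasibilityCertificate {m n : ℕ} (A : Matrix (Fin m) (Fin n) ℝ) (r : Fin m → ℝ)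
    (c : Fin n → ℝ) (T : Finset (Fin n)) : Prop :=
  ∑ i ∈ neighborhood A T, r i < ∑ j ∈ T, c j

/-- The positions of the nonzero entries of `A`. -/
abbrev Support {m n : ℕ} (A : Matrix (Fin m) (Fin n) ℝ) : Type :=
  {p : Fin m × Fin n // A p.1 p.2 ≠ 0}

/-- The number of nonzero entries of `A`. -/
noncomputable def nnz {m n : ℕ} (A : Matrix (Fin m) (Fin n) ℝ) : ℕ :=
  Nat.card (Support A)

/-- `x` is a rational number whose reduced fraction is written with at most `B` bits. -/
def HasBitComplexity (x : ℝ) (B : ℝ) : Prop :=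
  ∃ q : ℚ, (q : ℝ) = x ∧ ((q.num.natAbs.size + q.den.size : ℕ) : ℝ) ≤ B

/-! ### The machine model: a real RAM with a rounding oracle

A program is a finite piece of syntax that names finitely many arrays of natural numbers (indices
and flags) and finitely many arrays of real numbers. Reals are accessed only through exact
arithmetic, comparison, and rounding to a multiple of `2 ^ (-b)`; the only real constants are
natural numbers, and reals cannot be converted into indices. Each elementary operation and each
test costs one unit. -/

/-- The memory: cell `k` of array `a` is `nat a k`, respectively `real a k`. -/
structure State where
  nat : ℕ → ℕ → ℕ
  real : ℕ → ℕ → ℝ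

/-- An index operand: a literal, or the register `v`, that is cell `0` of the `v`-th index array. -/
inductive Ix where
  | lit (k : ℕ)
  | reg (v : ℕ)

/-- The value of an index operand. -/
def Ix.eval (σ : State) : Ix → ℕ
  | .lit k => k
  | .reg v => σ.nat v 0

/-- A real operand: the cell `arr[idx]`. -/
structure Cell where
  arr : ℕ
  idx : Ix

/-- The value of a real operand. -/
def Cell.eval (σ : State) (p : Cell) : ℝ := σ.real p.arr (p.idx.eval σ)

/-- Writing a value to cell `k` of the index array `a`. -/
def State.setNat (σ : State) (a k x : ℕ) : State where
  nat := Function.update σ.nat a (Function.update (σ.nat a) k x)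
  real := σ.real

/-- Writing a value to a real cell. -/
noncomputable def State.setReal (σ : State) (d : Cell) (x : ℝ) : State where
  nat := σ.nat
  real := Function.update σ.real d.arr (Function.update (σ.real d.arr) (d.idx.eval σ) x)

/-- The real number `x` rounded to the nearest multiple of `2 ^ (-b)`. -/
noncomputable def roundTo (x : ℝ) (b : ℕ) : ℝ := (round (x * 2 ^ b) : ℝ) / 2 ^ b

/-- Elementary operations; `v` and `d` are the destinations. -/
inductive Instr where
  | nset (v : ℕ) (x : Ix)
  | nadd (v : ℕ) (x y : Ix)
  | nsub (v : ℕ) (x y : Ix)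
  | nhalf (v : ℕ) (x : Ix)
  | nload (v : ℕ) (a : ℕ) (i : Ix)
  | nstore (a : ℕ) (i : Ix) (x : Ix)
  | rconst (d : Cell) (k : ℕ)
  | rmove (d p : Cell)
  | radd (d p q : Cell)
  | rsub (d p q : Cell)
  | rmul (d p q : Cell)
  | rdiv (d p q : Cell)
  | rround (d p : Cell) (b : Ix)

/-- Division by zero is the only undefined operation. -/
def Instr.Defined (σ : State) : Instr → Prop
  | .rdiv _ _ q => q.eval σ ≠ 0
  | _ => True

/-- The effect of an elementary operation. -/
noncomputable def Instr.step (σ : State) : Instr → State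
  | .nset v x => σ.setNat v 0 (x.eval σ)
  | .nadd v x y => σ.setNat v 0 (x.eval σ + y.eval σ)
  | .nsub v x y => σ.setNat v 0 (x.eval σ - y.eval σ)
  | .nhalf v x => σ.setNat v 0 (x.eval σ / 2)
  | .nload v a i => σ.setNat v 0 (σ.nat a (i.eval σ))
  | .nstore a i x => σ.setNat a (i.eval σ) (x.eval σ)
  | .rconst d k => σ.setReal d k
  | .rmove d p => σ.setReal d (p.eval σ)
  | .radd d p q => σ.setReal d (p.eval σ + q.eval σ)
  | .rsub d p q => σ.setReal d (p.eval σ - q.eval σ)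
  | .rmul d p q => σ.setReal d (p.eval σ * q.eval σ)
  | .rdiv d p q => σ.setReal d (p.eval σ / q.eval σ)
  | .rround d p b => σ.setReal d (roundTo (p.eval σ) (b.eval σ))

/-- Comparisons. -/
inductive Test where
  | nlt (x y : Ix)
  | nle (x y : Ix)
  | rlt (p q : Cell)
  | rle (p q : Cell)

/-- The meaning of a comparison. -/
def Test.Holds (σ : State) : Test → Prop
  | .nlt x y => x.eval σ < y.eval σ
  | .nle x y => x.eval σ ≤ y.eval σ
  | .rlt p q => p.eval σ < q.eval σ
  | .rle p q => p.eval σ ≤ q.eval σ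

/-- Programs. The command `iteration` changes nothing; it marks the start of an iteration of the
algorithm. -/
inductive Program where
  | skip
  | iteration
  | instr (i : Instr)
  | seq (P Q : Program)
  | ite (b : Test) (P Q : Program)
  | while (b : Test) (P : Program)

/-- A record of one elementary step (or of one iteration mark) with the memory after it. -/
structure Event where
  isMark : Bool
  state : State

/-- `Exec P σ tr σ'`: started in memory `σ`, the program `P` halts in memory `σ'`, and `tr` lists
all elementary steps performed and all iteration marks passed, in order. -/
inductive Exec : Program → State → List Event → State → Prop where
  | skip (σ : State) : Exec .skip σ [] σ
  | iteration (σ : State) : Exec .iteration σ [⟨true, σ⟩] σ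
  | instr (i : Instr) (σ : State) (h : i.Defined σ) :
      Exec (.instr i) σ [⟨false, i.step σ⟩] (i.step σ)
  | seq {P Q : Program} {σ σ₁ σ₂ : State} {t₁ t₂ : List Event}
      (h₁ : Exec P σ t₁ σ₁) (h₂ : Exec Q σ₁ t₂ σ₂) : Exec (.seq P Q) σ (t₁ ++ t₂) σ₂
  | ite_true {b : Test} {P Q : Program} {σ σ' : State} {t : List Event}
      (hb : b.Holds σ) (h : Exec P σ t σ') : Exec (.ite b P Q) σ (⟨false, σ⟩ :: t) σ'
  | ite_false {b : Test} {P Q : Program} {σ σ' : State} {t : List Event}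
      (hb : ¬ b.Holds σ) (h : Exec Q σ t σ') : Exec (.ite b P Q) σ (⟨false, σ⟩ :: t) σ'
  | while_true {b : Test} {P : Program} {σ σ₁ σ₂ : State} {t₁ t₂ : List Event}
      (hb : b.Holds σ) (h₁ : Exec P σ t₁ σ₁) (h₂ : Exec (.while b P) σ₁ t₂ σ₂) :
      Exec (.while b P) σ (⟨false, σ⟩ :: (t₁ ++ t₂)) σ₂
  | while_false {b : Test} {P : Program} {σ : State} (hb : ¬ b.Holds σ) :
      Exec (.while b P) σ [⟨false, σ⟩] σ

/-- The number of iterations of a run. -/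
def iterationCount (tr : List Event) : ℕ := tr.countP Event.isMark

/-- The numbers of elementary steps of the successive phases of a run: the steps before the first
iteration, then those of the first iteration, of the second iteration, and so on; the last phase
runs until the machine halts. -/
def phaseCosts (tr : List Event) : List ℕ := (tr.splitOnP Event.isMark).map List.length

/-! ### Input and output conventions -/

/-- The initial memory. Index arrays: `0`, `1`, `2` hold `m`, `n`, `nnz A` in cell `0`; `3` and `4`
hold the row and the column of the `k`-th nonzero entry of `A` in the enumeration `e`. Real arrays:
`0` holds the nonzero entries of `A`, `1` holds `r`, `2` holds `c`, `3` holds `ε` in cell `0`.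
All other cells are zero. -/
noncomputable def inputState {m n : ℕ} (A : Matrix (Fin m) (Fin n) ℝ) (r : Fin m → ℝ)
    (c : Fin n → ℝ) (ε : ℝ) (e : Fin (nnz A) ≃ Support A) : State where
  nat := fun a k =>
    match a with
    | 0 => if k = 0 then m else 0
    | 1 => if k = 0 then n else 0
    | 2 => if k = 0 then nnz A else 0
    | 3 => if h : k < nnz A then ((e ⟨k, h⟩).1.1 : ℕ) else 0
    | 4 => if h : k < nnz A then ((e ⟨k, h⟩).1.2 : ℕ) else 0
    | _ => 0
  real := fun a k =>
    match a with
    | 0 => if h : k < nnz A then A (e ⟨k, h⟩).1.1 (e ⟨k, h⟩).1.2 else 0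
    | 1 => if h : k < m then r ⟨k, h⟩ else 0
    | 2 => if h : k < n then c ⟨k, h⟩ else 0
    | 3 => if k = 0 then ε else 0
    | _ => 0

/-- The output flag, in index register `5`: `0` for scalings and `1` for a certificate. -/
def State.flag (σ : State) : ℕ := σ.nat 5 0

/-- The output set of columns, given by its indicator vector in index array `6`. -/
def State.columnSet (σ : State) (n : ℕ) : Finset (Fin n) :=
  Finset.univ.filter fun j => σ.nat 6 j = 1

/-- The row scaling, in real array `4`. -/
def State.rowScaling (σ : State) (m : ℕ) : Fin m → ℝ := fun i => σ.real 4 i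

/-- The column scaling, in real array `5`; it is also the array that holds the current column
scaling at the start of each iteration. -/
def State.columnScaling (σ : State) (n : ℕ) : Fin n → ℝ := fun j => σ.real 5 j

end MatrixScaling

open MatrixScaling

/-! The row scaling is always x_i = r_i / (A y)_i, so row sums are exact and only the column scaling
y varies. The column errors d_j sum to 0. The potential is Φ = ∑ d_j², which is at most 2 s² for
every positive y; the aim is Φ ≤ ε².

One step sorts the errors and takes the largest gap G between neighbours. Errors that sum to 0 and
spread over at most n G satisfy Φ ≤ n³ G² (`Inst.Φ_le_of_gap`). Let T be the set of columns below
the gap, and multiply y on T by 1 + β. Mass then flows into every column of T and out of every other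
column. Up to a factor 2, column j moves by g_j(β) = ∑ min(β f_i, 1) W_e, where f_i is the share of
row i in T (`Inst.movement`). This is piecewise linear in β with breakpoints 1 / f_i, so sorting the
breakpoints, a binary search and one interpolation give β with max g_j = G / 4 in nearly linear
time. All errors then move towards the middle of the gap without crossing it, and Φ drops by at
least 3/32 G² (`Inst.Φ_up_le`). If even the largest breakpoint does not reach G / 4, then draining
into T all rows that meet T does not close the gap, and T is a certificate of infeasibility
(`Inst.certificate`).

To keep y short, the ratios of consecutive scalings in sorted order are capped at H = 2^p max a /
min a, and y is rounded to multiples of 2^(-p). A ratio above H makes an entry negligible already,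
so capping perturbs the scaled matrix by at most s n² / 2^p in total (`Inst.sum_abs_B_sub_le`), and
rounding numbers that are at least 1 costs even less. Once 2^p ε² ≥ 128 s² n⁵, capping and rounding
spoil at most Φ / (32 n³), and a step still multiplies Φ by at most 1 - 1/(16 n³) (`Inst.Φ_step`).

The exponent p is found inside the main loop: an iteration raises p by one or performs a step. Both
kinds together are O(n³ log(s n / ε)) in number (`iteration_bound`). Empty rows and columns give
certificates immediately; otherwise m and n are at most nnz(A), so work linear in m + n + nnz(A), up
to logarithms, is nearly linear in nnz(A).

The column scalings are fractions with denominator 2^p and bounded magnitude (`Inst.Value`),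
whatever r and c are. For rational input every other real is controlled by a static stratification
of the real arrays: an operation that writes to a level combines a value of at most that level with
one of a strictly lower level. Sizes within a level therefore grow additively, by a bounded amount
per step, and 16 levels give a polynomial in the length of the run (`Exec.levelBound`). -/

namespace MatrixScaling

/-! ### Static analysis of programs -/

/-- All instructions of the program satisfy `p`. -/
def Program.all (p : Instr → Bool) : Program → Bool
  | .skip => true
  | .iteration => true
  | .instr i => p i
  | .seq P Q => P.all p && Q.all p
  | .ite _ P Q => P.all p && Q.all p
  | .while _ P => P.all p

/-- The program contains no iteration mark. -/
def Program.markFree : Program → Bool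
  | .skip => true
  | .iteration => false
  | .instr _ => true
  | .seq P Q => P.markFree && Q.markFree
  | .ite _ P Q => P.markFree && Q.markFree
  | .while _ P => P.markFree

/-- The index array written by an instruction. -/
def Instr.natDest : Instr → Option ℕ
  | .nset v _ => some v
  | .nadd v _ _ => some v
  | .nsub v _ _ => some v
  | .nhalf v _ => some v
  | .nload v _ _ => some v
  | .nstore a _ _ => some a
  | _ => none

/-- The real array written by an instruction. -/
def Instr.realDest : Instr → Option ℕ
  | .rconst d _ => some d.arr
  | .rmove d _ => some d.arr
  | .radd d _ _ => some d.arr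
  | .rsub d _ _ => some d.arr
  | .rmul d _ _ => some d.arr
  | .rdiv d _ _ => some d.arr
  | .rround d _ _ => some d.arr
  | _ => none

/-- The program never writes to the index array `a`. -/
def Program.natFree (a : ℕ) (P : Program) : Bool := P.all fun i => i.natDest != some a

/-- The program never writes to the real array `a`. -/
def Program.realFree (a : ℕ) (P : Program) : Bool := P.all fun i => i.realDest != some a

/-- The memories agree on all arrays that `P` does not write. -/
def Frame (P : Program) (σ σ' : State) : Prop :=
  (∀ a, P.natFree a = true → σ'.nat a = σ.nat a) ∧
    ∀ a, P.realFree a = true → σ'.real a = σ.real a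

theorem Instr.step_nat (i : Instr) (σ : State) (a : ℕ) (h : i.natDest ≠ some a) :
    (i.step σ).nat a = σ.nat a := by
  cases i <;>
    simp_all [Instr.step, State.setNat, State.setReal, Instr.natDest, Function.update_of_ne,
      Ne.symm]

theorem Instr.step_real (i : Instr) (σ : State) (a : ℕ) (h : i.realDest ≠ some a) :
    (i.step σ).real a = σ.real a := by
  cases i <;>
    simp_all [Instr.step, State.setNat, State.setReal, Instr.realDest]
  all_goals exact Function.update_of_ne (Ne.symm h) _ _

theorem Exec.natFree {P : Program} {σ σ' : State} {tr : List Event} (h : Exec P σ tr σ') (a : ℕ)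
    (hf : P.natFree a = true) : σ'.nat a = σ.nat a := by
  induction h with
  | skip | iteration => rfl
  | instr i σ h => exact i.step_nat σ a (by simpa [Program.natFree, Program.all] using hf)
  | seq h₁ h₂ ih₁ ih₂ =>
    simp only [Program.natFree, Program.all, Bool.and_eq_true] at hf
    rw [ih₂ hf.2, ih₁ hf.1]
  | ite_true hb h ih =>
    simp only [Program.natFree, Program.all, Bool.and_eq_true] at hf
    exact ih hf.1
  | ite_false hb h ih =>
    simp only [Program.natFree, Program.all, Bool.and_eq_true] at hf
    exact ih hf.2
  | while_true hb h₁ h₂ ih₁ ih₂ => rw [ih₂ hf, ih₁ hf]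
  | while_false => rfl

/-- The claim covers every event and not only the final memory, because positivity and bit bounds
are required of all intermediate memories. -/
theorem Exec.realFree_trace {P : Program} {σ σ' : State} {tr : List Event} (h : Exec P σ tr σ')
    (a : ℕ) (hf : P.realFree a = true) :
    σ'.real a = σ.real a ∧ ∀ v ∈ tr, v.state.real a = σ.real a := by
  induction h with
  | skip => simp
  | iteration => simp
  | instr i σ h =>
    have := i.step_real σ a (by simpa [Program.realFree, Program.all] using hf)
    simp [this]
  | seq h₁ h₂ ih₁ ih₂ =>
    simp only [Program.realFree, Program.all, Bool.and_eq_true] at hf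
    obtain ⟨e₁, f₁⟩ := ih₁ hf.1
    obtain ⟨e₂, f₂⟩ := ih₂ hf.2
    refine ⟨e₂.trans e₁, fun v hv => ?_⟩
    rcases List.mem_append.1 hv with hv | hv
    · exact f₁ v hv
    · exact (f₂ v hv).trans e₁
  | ite_true hb h ih =>
    simp only [Program.realFree, Program.all, Bool.and_eq_true] at hf
    obtain ⟨e, f⟩ := ih hf.1
    exact ⟨e, by simpa using f⟩
  | ite_false hb h ih =>
    simp only [Program.realFree, Program.all, Bool.and_eq_true] at hf
    obtain ⟨e, f⟩ := ih hf.2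
    exact ⟨e, by simpa using f⟩
  | while_true hb h₁ h₂ ih₁ ih₂ =>
    obtain ⟨e₁, f₁⟩ := ih₁ hf
    obtain ⟨e₂, f₂⟩ := ih₂ hf
    refine ⟨e₂.trans e₁, fun v hv => ?_⟩
    rcases List.mem_cons.1 hv with rfl | hv
    · rfl
    rcases List.mem_append.1 hv with hv | hv
    · exact f₁ v hv
    · exact (f₂ v hv).trans e₁
  | while_false => simp

theorem Exec.frame {P : Program} {σ σ' : State} {tr : List Event} (h : Exec P σ tr σ') :
    Frame P σ σ' :=
  ⟨fun a ha => h.natFree a ha, fun a ha => (h.realFree_trace a ha).1⟩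

theorem Exec.markFree {P : Program} {σ σ' : State} {tr : List Event} (h : Exec P σ tr σ')
    (hf : P.markFree = true) : ∀ v ∈ tr, v.isMark = false := by
  induction h with
  | skip => simp
  | iteration => simp [Program.markFree] at hf
  | instr i σ h => simp
  | seq h₁ h₂ ih₁ ih₂ =>
    simp only [Program.markFree, Bool.and_eq_true] at hf
    intro v hv
    rcases List.mem_append.1 hv with hv | hv
    exacts [ih₁ hf.1 v hv, ih₂ hf.2 v hv]
  | ite_true hb h ih =>
    simp only [Program.markFree, Bool.and_eq_true] at hf
    simpa using ih hf.1
  | ite_false hb h ih =>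
    simp only [Program.markFree, Bool.and_eq_true] at hf
    simpa using ih hf.2
  | while_true hb h₁ h₂ ih₁ ih₂ =>
    intro v hv
    rcases List.mem_cons.1 hv with rfl | hv
    · rfl
    rcases List.mem_append.1 hv with hv | hv
    exacts [ih₁ hf v hv, ih₂ hf v hv]
  | while_false => simp

/-! ### Total correctness with costs -/

/-- From `σ` the program halts after at most `N` steps in a memory satisfying `Q`, and all
memories on the way satisfy `J`. -/
def RunsJ (J : State → Prop) (P : Program) (σ : State) (N : ℕ) (Q : State → Prop) : Prop :=
  ∃ tr σ', Exec P σ tr σ' ∧ (∀ v ∈ tr, J v.state) ∧ tr.length ≤ N ∧ Q σ'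

/-- From `σ` the program halts after at most `N` steps in a memory satisfying `Q`. -/
def Runs (P : Program) (σ : State) (N : ℕ) (Q : State → Prop) : Prop :=
  RunsJ (fun _ => True) P σ N Q

section rules

variable {J : State → Prop} {P P' : Program} {σ : State} {N N' M : ℕ} {Q Q' : State → Prop}

/-- The frame is passed to the new postcondition, so `Q` need not mention arrays that the program
leaves alone. -/
theorem RunsJ.mono (h : RunsJ J P σ N Q) (hN : N ≤ N') (hQ : ∀ σ', Frame P σ σ' → Q σ' → Q' σ') :
    RunsJ J P σ N' Q' := by
  obtain ⟨tr, σ', he, hJ, hl, hq⟩ := h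
  exact ⟨tr, σ', he, hJ, hl.trans hN, hQ _ he.frame hq⟩

theorem RunsJ.skip (h : Q σ) : RunsJ J .skip σ 0 Q := ⟨[], σ, .skip σ, by simp, by simp, h⟩

theorem RunsJ.instr {i : Instr} (hd : i.Defined σ) (hJ : J (i.step σ)) (h : Q (i.step σ)) :
    RunsJ J (.instr i) σ 1 Q := ⟨_, _, .instr i σ hd, by simpa using hJ, by simp, h⟩

theorem RunsJ.seq (h : RunsJ J P σ N fun σ₁ => Frame P σ σ₁ → RunsJ J P' σ₁ M Q) :
    RunsJ J (.seq P P') σ (N + M) Q := by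
  obtain ⟨t₁, σ₁, e₁, j₁, l₁, t₂, σ₂, e₂, j₂, l₂, hq⟩ := h.mono le_rfl (fun σ' hF h => h hF)
  refine ⟨_, _, .seq e₁ e₂, fun v hv => ?_, by simp; omega, hq⟩
  rcases List.mem_append.1 hv with hv | hv
  exacts [j₁ v hv, j₂ v hv]

theorem RunsJ.ite {b : Test} (hJ : J σ) (h₁ : b.Holds σ → RunsJ J P σ N Q)
    (h₂ : ¬ b.Holds σ → RunsJ J P' σ N Q) : RunsJ J (.ite b P P') σ (N + 1) Q := by
  by_cases hb : b.Holds σ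
  · obtain ⟨t, σ', e, j, l, hq⟩ := h₁ hb
    exact ⟨_, _, .ite_true hb e, by simpa using ⟨hJ, j⟩, by simpa using l, hq⟩
  · obtain ⟨t, σ', e, j, l, hq⟩ := h₂ hb
    exact ⟨_, _, .ite_false hb e, by simpa using ⟨hJ, j⟩, by simpa using l, hq⟩

/-- Termination comes from the round counter: the invariant together with the guard must force `k <
T`. Each round pays one extra unit for its test, and the last, failing test accounts for the final
`+ 1`. -/
theorem RunsJ.whileLoop {b : Test} {c T : ℕ} (I : ℕ → State → Prop) (hJ : ∀ k σ, I k σ → J σ)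
    (hs : ∀ k σ₁, Frame P σ σ₁ → I k σ₁ → b.Holds σ₁ → k < T ∧ RunsJ J P σ₁ c (I (k + 1)))
    (h0 : I 0 σ) :
    RunsJ J (.while b P) σ (T * (c + 1) + 1) fun σ' => ∃ k ≤ T, I k σ' ∧ ¬ b.Holds σ' := by
  suffices H : ∀ (d k : ℕ) (σ₁ : State), Frame P σ σ₁ → I k σ₁ → k + d = T →
      RunsJ J (.while b P) σ₁ (d * (c + 1) + 1) fun σ' => ∃ k ≤ T, I k σ' ∧ ¬ b.Holds σ' by
    exact H T 0 σ ⟨fun _ _ => rfl, fun _ _ => rfl⟩ h0 (by simp)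
  intro d
  induction d with
  | zero =>
    intro k σ₁ hF hI hk
    by_cases hb : b.Holds σ₁
    · have := (hs k σ₁ hF hI hb).1
      omega
    · exact ⟨_, _, .while_false hb, by simpa using hJ k σ₁ hI, by simp, k, by omega, hI, hb⟩
  | succ d ih =>
    intro k σ₁ hF hI hk
    by_cases hb : b.Holds σ₁
    · obtain ⟨t₁, σ₂, e₁, j₁, l₁, hq₁⟩ := (hs k σ₁ hF hI hb).2
      have hF₂ : Frame P σ σ₂ := ⟨fun a ha => (e₁.frame.1 a ha).trans (hF.1 a ha),
        fun a ha => (e₁.frame.2 a ha).trans (hF.2 a ha)⟩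
      obtain ⟨t₂, σ₃, e₂, j₂, l₂, hq₂⟩ := ih (k + 1) σ₂ hF₂ hq₁ (by omega)
      refine ⟨_, _, .while_true hb e₁ e₂, fun v hv => ?_, ?_, hq₂⟩
      · rcases List.mem_cons.1 hv with rfl | hv
        · exact hJ k σ₁ hI
        rcases List.mem_append.1 hv with hv | hv
        exacts [j₁ v hv, j₂ v hv]
      · simp only [List.length_cons, List.length_append]
        have : (d + 1) * (c + 1) = d * (c + 1) + (c + 1) := by ring
        omega
    · exact ⟨_, _, .while_false hb, by simpa using hJ k σ₁ hI, by simp, k, by omega, hI, hb⟩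

theorem Runs.mono (h : Runs P σ N Q) (hN : N ≤ N') (hQ : ∀ σ', Frame P σ σ' → Q σ' → Q' σ') :
    Runs P σ N' Q' := RunsJ.mono h hN hQ

theorem Runs.skip (h : Q σ) : Runs .skip σ 0 Q := RunsJ.skip h

theorem Runs.instr {i : Instr} (hd : i.Defined σ) (h : Q (i.step σ)) : Runs (.instr i) σ 1 Q :=
  RunsJ.instr hd trivial h

theorem Runs.seq (h : Runs P σ N fun σ₁ => Frame P σ σ₁ → Runs P' σ₁ M Q) :
    Runs (.seq P P') σ (N + M) Q := RunsJ.seq h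

theorem Runs.ite {b : Test} (h₁ : b.Holds σ → Runs P σ N Q) (h₂ : ¬ b.Holds σ → Runs P' σ N Q) :
    Runs (.ite b P P') σ (N + 1) Q := RunsJ.ite trivial h₁ h₂

theorem Runs.whileLoop {b : Test} {c T : ℕ} (I : ℕ → State → Prop)
    (hs : ∀ k σ₁, Frame P σ σ₁ → I k σ₁ → b.Holds σ₁ → k < T ∧ Runs P σ₁ c (I (k + 1)))
    (h0 : I 0 σ) :
    Runs (.while b P) σ (T * (c + 1) + 1) fun σ' => ∃ k ≤ T, I k σ' ∧ ¬ b.Holds σ' :=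
  RunsJ.whileLoop I (fun _ _ _ => trivial) hs h0

/-- A run of a program that does not write array `a` keeps any property of that array. -/
theorem Runs.toRunsJ {a : ℕ} (h : Runs P σ N Q) (hf : P.realFree a = true) (G : (ℕ → ℝ) → Prop)
    (hG : G (σ.real a)) : RunsJ (fun τ => G (τ.real a)) P σ N Q := by
  obtain ⟨tr, σ', e, -, l, hq⟩ := h
  exact ⟨tr, σ', e, fun v hv => by simpa only [(e.realFree_trace a hf).2 v hv] using hG, l, hq⟩

end rules

/-- Straight-line programs. -/
def block (l : List Instr) : Program := l.foldr (fun i P => .seq (.instr i) P) .skip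

/-- The weakest precondition of a straight-line program. -/
def wp (Q : State → Prop) : List Instr → State → Prop
  | [], σ => Q σ
  | i :: l, σ => i.Defined σ ∧ wp Q l (i.step σ)

theorem Runs.block {l : List Instr} {σ : State} {Q : State → Prop} (h : wp Q l σ) :
    Runs (block l) σ l.length Q := by
  induction l generalizing σ with
  | nil => exact Runs.skip h
  | cons i l ih =>
    have := Runs.seq (Q := Q) (M := l.length) (P := .instr i) (P' := MatrixScaling.block l)
      (Runs.instr h.1 fun _ => ih h.2)
    simpa [MatrixScaling.block, add_comm] using this

/-- `for i < N do P`, where `N` is the value of the register `Nr`. -/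
def forLoop (i Nr : ℕ) (P : Program) : Program :=
  .seq (.instr (.nset i (.lit 0)))
    (.while (.nlt (.reg i) (.reg Nr)) (.seq P (.instr (.nadd i (.reg i) (.lit 1)))))

section readback

variable (σ : State)

@[simp] theorem State.setNat_real (a k x : ℕ) : (σ.setNat a k x).real = σ.real := rfl
@[simp] theorem State.setReal_nat (d : Cell) (x : ℝ) : (σ.setReal d x).nat = σ.nat := rfl

@[simp] theorem State.setNat_nat_apply (a k x b j : ℕ) :
    (σ.setNat a k x).nat b j = if b = a ∧ j = k then x else σ.nat b j := by
  by_cases hb : b = a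
  · subst hb
    by_cases hj : j = k <;> simp [State.setNat, hj]
  · simp [State.setNat, hb]

@[simp] theorem State.setReal_real_apply (d : Cell) (x : ℝ) (b j : ℕ) :
    (σ.setReal d x).real b j = if b = d.arr ∧ j = d.idx.eval σ then x else σ.real b j := by
  by_cases hb : b = d.arr
  · subst hb
    by_cases hj : j = d.idx.eval σ <;> simp [State.setReal, hj]
  · simp [State.setReal, hb]

@[simp] theorem Ix.eval_lit (k : ℕ) : (Ix.lit k).eval σ = k := rfl
@[simp] theorem Ix.eval_reg (v : ℕ) : (Ix.reg v).eval σ = σ.nat v 0 := rfl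

end readback

/-- The cost `c + 2` of a round includes the test and the increment. The body must establish the
invariant for the memory in which the counter has already advanced, so an invariant that ignores the
counter passes through by simplification. -/
theorem RunsJ.forLoop {J : State → Prop} {i Nr N c : ℕ} {P : Program} {σ : State}
    (I : ℕ → State → Prop) (hN : σ.nat Nr 0 = N) (hi : P.natFree i = true)
    (hNr : P.natFree Nr = true) (hne : Nr ≠ i)
    (hJ : ∀ k σ, I k σ → J σ)
    (hs : ∀ k < N, ∀ σ₁, Frame (forLoop i Nr P) σ σ₁ → σ₁.nat i 0 = k → σ₁.nat Nr 0 = N →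
      I k σ₁ → RunsJ J P σ₁ c fun σ₂ => I (k + 1) (σ₂.setNat i 0 (k + 1)))
    (h0 : I 0 (σ.setNat i 0 0)) :
    RunsJ J (forLoop i Nr P) σ (N * (c + 2) + 2) (I N) := by
  have hloop : RunsJ J (.while (.nlt (.reg i) (.reg Nr))
      (.seq P (.instr (.nadd i (.reg i) (.lit 1))))) (σ.setNat i 0 0) (N * (c + 1 + 1) + 1)
      fun σ' => ∃ k ≤ N, (σ'.nat i 0 = k ∧ σ'.nat Nr 0 = N ∧ k ≤ N ∧ I k σ') ∧
        ¬ (Test.nlt (.reg i) (.reg Nr)).Holds σ' := by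
    refine RunsJ.whileLoop (fun k σ' => σ'.nat i 0 = k ∧ σ'.nat Nr 0 = N ∧ k ≤ N ∧ I k σ')
      (fun k σ' h => hJ k σ' h.2.2.2) ?_ ⟨by simp, by simp [hne, hN], by simp, h0⟩
    rintro k σ₁ hF ⟨h1, h2, h3, h4⟩ hb
    have hk : k < N := by simpa [Test.Holds, h1, h2] using hb
    refine ⟨hk, RunsJ.seq ((hs k hk σ₁ ?_ h1 h2 h4).mono le_rfl fun σ₂ hF₂ hI _ => ?_)⟩
    · refine ⟨fun a ha => ?_, fun a ha => ?_⟩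
      · simp only [MatrixScaling.forLoop, Program.natFree, Program.all, Bool.and_eq_true] at ha
        rw [hF.1 a (by simpa [Program.natFree, Program.all] using ha.2)]
        have : a ≠ i := by
          intro h; subst h; simp [Instr.natDest] at ha
        exact Function.update_of_ne this _ _
      · simp only [MatrixScaling.forLoop, Program.realFree, Program.all, Bool.and_eq_true] at ha
        rw [hF.2 a (by simpa [Program.realFree, Program.all] using ha.2)]
        rfl
    · have e1 : σ₂.nat i 0 = k := by rw [hF₂.1 i hi, h1]
      have e2 : σ₂.nat Nr 0 = N := by rw [hF₂.1 Nr hNr, h2]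
      have hI' : I (k + 1) (Instr.step σ₂ (.nadd i (.reg i) (.lit 1))) := by
        simpa [Instr.step, e1] using hI
      refine RunsJ.instr trivial (hJ _ _ hI') ⟨?_, ?_, ?_, hI'⟩
      · simp [Instr.step, e1]
      · simp [Instr.step, hne, e2]
      · omega
  have h := RunsJ.seq (J := J) (P := .instr (.nset i (.lit 0))) (N := 1) (σ := σ)
    (RunsJ.instr (i := .nset i (.lit 0)) trivial (by simpa [Instr.step] using hJ 0 _ h0)
      (fun _ => hloop))
  refine h.mono (by ring_nf; omega) ?_
  rintro σ' - ⟨k, hk, ⟨h1, h2, h3, h4⟩, h5⟩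
  have : k = N := by
    simp only [Test.Holds, Ix.eval_reg, h1, h2] at h5
    omega
  exact this ▸ h4

theorem Runs.forLoop {i Nr N c : ℕ} {P : Program} {σ : State}
    (I : ℕ → State → Prop) (hN : σ.nat Nr 0 = N) (hi : P.natFree i = true)
    (hNr : P.natFree Nr = true) (hne : Nr ≠ i)
    (hs : ∀ k < N, ∀ σ₁, Frame (forLoop i Nr P) σ σ₁ → σ₁.nat i 0 = k → σ₁.nat Nr 0 = N →
      I k σ₁ → Runs P σ₁ c fun σ₂ => I (k + 1) (σ₂.setNat i 0 (k + 1)))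
    (h0 : I 0 (σ.setNat i 0 0)) :
    Runs (forLoop i Nr P) σ (N * (c + 2) + 2) (I N) :=
  RunsJ.forLoop I hN hi hNr hne (fun _ _ _ => trivial) hs h0

/-! ### The phases of a run -/

theorem phaseCosts_append_mark (t : List Event) (v : Event) (t' : List Event)
    (ht : ∀ w ∈ t, w.isMark = false) (hv : v.isMark = true) :
    phaseCosts (t ++ v :: t') = t.length :: phaseCosts t' := by
  simp [phaseCosts, List.splitOnP_append_cons_of_forall_mem ht v hv]

theorem phaseCosts_of_markFree (t : List Event) (ht : ∀ w ∈ t, w.isMark = false) :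
    phaseCosts t = [t.length] := by
  simp [phaseCosts, List.splitOnP_eq_singleton ht]

theorem iterationCount_of_markFree (t : List Event) (ht : ∀ w ∈ t, w.isMark = false) :
    iterationCount t = 0 := by
  simpa [iterationCount, List.countP_eq_zero] using ht

/-- A run of the main loop: the number of iterations and the costs of the phases. -/
theorem exec_iterations {J : State → Prop} {b : Test} {P : Program} {c T : ℕ} (hP : P.markFree = true)
    (I : ℕ → State → Prop) (hJ : ∀ k σ, I k σ → J σ)
    (hs : ∀ k σ, I k σ → b.Holds σ → k < T ∧ RunsJ J P σ c (I (k + 1))) {σ : State} (h0 : I 0 σ) :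
    ∃ tr σ' k, Exec (.while b (.seq .iteration P)) σ tr σ' ∧ k ≤ T ∧ I k σ' ∧ ¬ b.Holds σ' ∧
      (∀ v ∈ tr, J v.state) ∧ (∀ v ∈ tr, v.isMark = true → ∃ k, I k v.state) ∧
      iterationCount tr = k ∧ tr.length ≤ k * (c + 2) + 1 ∧
      ∀ t : List Event, (∀ v ∈ t, v.isMark = false) → ∃ L : List ℕ,
        phaseCosts (t ++ tr) = (t.length + 1) :: L ∧ ∀ x ∈ L, x ≤ c + 1 := by
  -- The guard that precedes a mark is charged to the phase before it. This explains `t.length + 1`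
  -- for an arbitrary mark-free prefix `t`, and `c + 1` for the later phases.
  suffices H : ∀ (d k : ℕ) (σ : State), I k σ → k + d = T →
      ∃ tr σ' k', Exec (.while b (.seq .iteration P)) σ tr σ' ∧ k + k' ≤ T ∧ I (k + k') σ' ∧
      ¬ b.Holds σ' ∧
      (∀ v ∈ tr, J v.state) ∧ (∀ v ∈ tr, v.isMark = true → ∃ k, I k v.state) ∧
      iterationCount tr = k' ∧ tr.length ≤ k' * (c + 2) + 1 ∧
      ∀ t : List Event, (∀ v ∈ t, v.isMark = false) → ∃ L : List ℕ,
        phaseCosts (t ++ tr) = (t.length + 1) :: L ∧ ∀ x ∈ L, x ≤ c + 1 by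
    obtain ⟨tr, σ', k', h⟩ := H T 0 σ h0 (by simp)
    simp only [zero_add] at h
    exact ⟨tr, σ', k', h⟩
  have hfin : ∀ (k : ℕ) (σ : State), I k σ → k ≤ T → ¬ b.Holds σ →
      ∃ tr σ' k', Exec (.while b (.seq .iteration P)) σ tr σ' ∧ k + k' ≤ T ∧ I (k + k') σ' ∧
      ¬ b.Holds σ' ∧
      (∀ v ∈ tr, J v.state) ∧ (∀ v ∈ tr, v.isMark = true → ∃ k, I k v.state) ∧
      iterationCount tr = k' ∧ tr.length ≤ k' * (c + 2) + 1 ∧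
      ∀ t : List Event, (∀ v ∈ t, v.isMark = false) → ∃ L : List ℕ,
        phaseCosts (t ++ tr) = (t.length + 1) :: L ∧ ∀ x ∈ L, x ≤ c + 1 := by
    intro k σ hI hk hb
    refine ⟨_, _, 0, .while_false hb, by simpa using hk, hI, hb, by simpa using hJ k σ hI,
      by simp, by simp [iterationCount], by simp, fun t ht => ⟨[], ?_, by simp⟩⟩
    rw [phaseCosts_of_markFree _ (by simpa [or_imp, forall_and] using ht)]
    simp
  intro d
  induction d with
  | zero =>
    intro k σ hI hk
    refine hfin k σ hI (by omega) fun hb => ?_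
    have := (hs k σ hI hb).1
    omega
  | succ d ih =>
    intro k σ hI hk
    by_cases hb : b.Holds σ
    · obtain ⟨t₁, σ₁, e₁, j₁, l₁, hI₁⟩ := (hs k σ hI hb).2
      obtain ⟨t₂, σ₂, k', e₂, hk', hI₂, hb₂, j₂, m₂, c₂, l₂, p₂⟩ := ih (k + 1) σ₁ hI₁ (by omega)
      have hm₁ := e₁.markFree hP
      refine ⟨_, _, k' + 1, .while_true hb (.seq (.iteration σ) e₁) e₂, by omega, ?_, hb₂, ?_, ?_,
        ?_, ?_, fun t ht => ?_⟩
      · rwa [show k + (k' + 1) = k + 1 + k' by ring]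
      · intro v hv
        simp only [List.cons_append, List.nil_append, List.mem_cons, List.mem_append] at hv
        rcases hv with rfl | rfl | hv | hv
        exacts [hJ k σ hI, hJ k σ hI, j₁ v hv, j₂ v hv]
      · intro v hv hmark
        simp only [List.cons_append, List.nil_append, List.mem_cons, List.mem_append] at hv
        rcases hv with rfl | rfl | hv | hv
        · simp at hmark
        · exact ⟨k, hI⟩
        · simp [hm₁ v hv] at hmark
        · exact m₂ v hv hmark
      · have : iterationCount t₁ = 0 := iterationCount_of_markFree _ hm₁
        simp only [iterationCount] at this c₂ ⊢
        simp [this, c₂]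
      · simp only [List.cons_append, List.nil_append, List.length_cons, List.length_append]
        have : (k' + 1) * (c + 2) = k' * (c + 2) + (c + 2) := by ring
        omega
      -- The body of the present iteration plays the role of the prefix for the rest of the run.
      · obtain ⟨L, hL, hL'⟩ := p₂ t₁ hm₁
        refine ⟨(t₁.length + 1) :: L, ?_, ?_⟩
        · rw [← hL]
          have := phaseCosts_append_mark (t ++ [⟨false, σ⟩]) ⟨true, σ⟩ (t₁ ++ t₂)
            (by simpa [or_imp, forall_and] using ht) rfl
          simpa using this
        · intro x hx
          rcases List.mem_cons.1 hx with rfl | hx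
          exacts [by omega, hL' x hx]
    · exact hfin k σ hI (by omega) hb

/-! ### Sizes of rational numbers -/

/-- `x` is a fraction whose numerator and denominator are at most `2 ^ w`. -/
def Sz (x : ℝ) (w : ℕ) : Prop :=
  ∃ (p : ℤ) (d : ℕ), 0 < d ∧ x = p / d ∧ p.natAbs ≤ 2 ^ w ∧ d ≤ 2 ^ w

theorem Sz.mono {x : ℝ} {w w' : ℕ} (h : Sz x w) (hw : w ≤ w') : Sz x w' := by
  obtain ⟨p, d, h1, h2, h3, h4⟩ := h
  have : 2 ^ w ≤ 2 ^ w' := Nat.pow_le_pow_right (by norm_num) hw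
  exact ⟨p, d, h1, h2, h3.trans this, h4.trans this⟩

theorem Sz.zero (w : ℕ) : Sz 0 w := ⟨0, 1, by simp, by simp, by simp, Nat.one_le_two_pow⟩

theorem Sz.natCast {k w : ℕ} (h : k ≤ 2 ^ w) : Sz k w :=
  ⟨k, 1, by simp, by simp, by simpa using h, Nat.one_le_two_pow⟩

theorem Sz.neg {x : ℝ} {w : ℕ} (h : Sz x w) : Sz (-x) w := by
  obtain ⟨p, d, h1, rfl, h3, h4⟩ := h
  exact ⟨-p, d, h1, by push_cast; ring, by simpa using h3, h4⟩

theorem Sz.add {x y : ℝ} {w v : ℕ} (h : Sz x w) (h' : Sz y v) : Sz (x + y) (w + v + 1) := by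
  obtain ⟨p, d, h1, rfl, h3, h4⟩ := h
  obtain ⟨q, e, k1, rfl, k3, k4⟩ := h'
  refine ⟨p * e + q * d, d * e, by positivity, ?_, ?_, ?_⟩
  · have : (d : ℝ) ≠ 0 := by positivity
    have : (e : ℝ) ≠ 0 := by positivity
    push_cast
    field_simp
  · calc (p * e + q * d).natAbs ≤ (p * e).natAbs + (q * d).natAbs := Int.natAbs_add_le _ _
      _ = p.natAbs * e + q.natAbs * d := by simp [Int.natAbs_mul]
      _ ≤ 2 ^ w * 2 ^ v + 2 ^ v * 2 ^ w := by gcongr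
      _ = 2 ^ (w + v + 1) := by ring
  · calc d * e ≤ 2 ^ w * 2 ^ v := by gcongr
      _ ≤ 2 ^ (w + v + 1) := by rw [← pow_add]; exact Nat.pow_le_pow_right (by norm_num) (by omega)

theorem Sz.sub {x y : ℝ} {w v : ℕ} (h : Sz x w) (h' : Sz y v) : Sz (x - y) (w + v + 1) := by
  rw [sub_eq_add_neg]
  exact h.add h'.neg

theorem Sz.mul {x y : ℝ} {w v : ℕ} (h : Sz x w) (h' : Sz y v) : Sz (x * y) (w + v) := by
  obtain ⟨p, d, h1, rfl, h3, h4⟩ := h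
  obtain ⟨q, e, k1, rfl, k3, k4⟩ := h'
  refine ⟨p * q, d * e, by positivity, ?_, ?_, ?_⟩
  · push_cast
    rw [div_mul_div_comm]
  · rw [Int.natAbs_mul, pow_add]
    gcongr
  · rw [pow_add]
    gcongr

theorem Sz.inv {x : ℝ} {w : ℕ} (h : Sz x w) : Sz x⁻¹ w := by
  obtain ⟨p, d, h1, rfl, h3, h4⟩ := h
  rcases eq_or_ne p 0 with rfl | hp
  · simpa using Sz.zero w
  -- Denominators are natural numbers, so the sign of `p` moves to the new numerator.
  refine ⟨p.sign * d, p.natAbs, Int.natAbs_pos.2 hp, ?_, ?_, h3⟩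
  · have hd : (d : ℝ) ≠ 0 := by positivity
    have hp' : (p : ℝ) ≠ 0 := by exact_mod_cast hp
    have h : (p : ℝ) = (p.sign : ℝ) * (p.natAbs : ℝ) := by
      rw [← Int.cast_natCast, ← Int.cast_mul, Int.sign_mul_natAbs]
    have hs : (p.sign : ℝ) * p.sign = 1 := by
      rcases lt_or_gt_of_ne hp with h | h
      · simp [Int.sign_eq_neg_one_of_neg h]
      · simp [Int.sign_eq_one_of_pos h]
    have hn : (p.natAbs : ℝ) ≠ 0 := by simpa using hp
    rw [inv_div, div_eq_div_iff hp' hn, h]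
    push_cast
    linear_combination (-(d : ℝ) * p.natAbs) * hs
  · rw [Int.natAbs_mul, Int.natAbs_sign_of_ne_zero hp]
    simpa using h4

theorem Sz.div {x y : ℝ} {w v : ℕ} (h : Sz x w) (h' : Sz y v) : Sz (x / y) (w + v) := by
  rw [div_eq_mul_inv]
  exact h.mul h'.inv

/-- Reducing a fraction replaces numerator and denominator by divisors, which are still at most `2 ^
w` and need at most `w + 1` bits each. A zero numerator is treated apart, since divisors of 0 are
unbounded. -/
theorem Sz.hasBitComplexity {x : ℝ} {w : ℕ} {B : ℝ} (h : Sz x w) (hB : ((2 * w + 2 : ℕ) : ℝ) ≤ B) :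
    HasBitComplexity x B := by
  obtain ⟨p, d, h1, rfl, h3, h4⟩ := h
  refine ⟨(p : ℚ) / (d : ℤ), by push_cast; rfl, le_trans ?_ hB⟩
  have hd : ((p : ℚ) / (d : ℤ)).den ≤ 2 ^ w := by
    refine (Nat.le_of_dvd h1 ?_).trans h4
    have := Rat.den_dvd p d
    exact_mod_cast (Rat.divInt_eq_div p (d : ℤ)) ▸ this
  have hn : ((p : ℚ) / (d : ℤ)).num.natAbs ≤ 2 ^ w := by
    rcases eq_or_ne p 0 with rfl | hp
    · simp
    refine (Nat.le_of_dvd (Int.natAbs_pos.2 hp) ?_).trans h3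
    have := Rat.num_dvd p (b := d) (by exact_mod_cast h1.ne')
    exact Int.natAbs_dvd_natAbs.2 ((Rat.divInt_eq_div p (d : ℤ)) ▸ this)
  have key : ∀ k : ℕ, k ≤ 2 ^ w → k.size ≤ w + 1 := fun k hk => by
    rw [Nat.size_le, pow_succ]
    have : 0 < 2 ^ w := by positivity
    omega
  have := key _ hd
  have := key _ hn
  exact Nat.cast_le.2 (by omega)

theorem HasBitComplexity.sz {x : ℝ} {b : ℕ} (h : HasBitComplexity x b) : Sz x b := by
  obtain ⟨q, rfl, hq⟩ := h
  have hq : q.num.natAbs.size + q.den.size ≤ b := by exact_mod_cast hq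
  have key : ∀ k : ℕ, k.size ≤ b → k ≤ 2 ^ b := fun k hk =>
    (Nat.lt_size_self k).le.trans (Nat.pow_le_pow_right (by norm_num) hk)
  exact ⟨q.num, q.den, q.den_pos, by exact_mod_cast (Rat.num_div_den q).symm,
    key _ (by omega), key _ (by omega)⟩

/-! ### A static discipline that bounds the sizes of all reals in memory -/

/-- The value written by a binary operation to level `l` comes from two operands of which one is of
a lower level. -/
def levelOk (l l₁ l₂ : ℕ) : Bool := decide (l₁ ≤ l ∧ l₂ < l) || decide (l₁ < l ∧ l₂ ≤ l)

/-- The instruction respects the levels `lev` of the real arrays. Writes to array `5` are free. -/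
def Instr.leveled (lev : ℕ → ℕ) : Instr → Bool
  | .rconst d k => d.arr == 5 || decide (1 ≤ lev d.arr ∧ k ≤ 256)
  | .rmove d p => d.arr == 5 || decide (1 ≤ lev d.arr ∧ lev p.arr ≤ lev d.arr)
  | .radd d p q => d.arr == 5 || levelOk (lev d.arr) (lev p.arr) (lev q.arr)
  | .rsub d p q => d.arr == 5 || levelOk (lev d.arr) (lev p.arr) (lev q.arr)
  | .rmul d p q => d.arr == 5 || levelOk (lev d.arr) (lev p.arr) (lev q.arr)
  | .rdiv d p q => d.arr == 5 || levelOk (lev d.arr) (lev p.arr) (lev q.arr)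
  | .rround d _ _ => d.arr == 5
  | _ => true

/-- The reals in the arrays of level at most `l` have size at most `w`. -/
def LevelBound (lev : ℕ → ℕ) (σ : State) (l w : ℕ) : Prop :=
  ∀ a k, lev a ≤ l → Sz (σ.real a k) w

/-- The increment `2 * c + 9` is chosen to cover all instructions: a binary operation adds at most
`c + 1` for its lower-level operand, and a constant up to 256 has size 8. -/
theorem levelBound_write {lev : ℕ → ℕ} {σ : State} {l c w : ℕ} {d : Cell} {x : ℝ} (hw : LevelBound lev σ (l + 1) w)
    (hl : LevelBound lev (σ.setReal d x) l c)
    (hx : lev d.arr = l + 1 → Sz x (w + (2 * c + 9))) :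
    LevelBound lev (σ.setReal d x) (l + 1) (w + (2 * c + 9)) := by
  intro a k ha
  rcases Nat.lt_or_ge (lev a) (l + 1) with h | h
  · exact (hl a k (by omega)).mono (by omega)
  · rw [State.setReal_real_apply]
    split_ifs with hk
    · exact hx (by rw [← hk.1]; omega)
    · exact (hw a k ha).mono (by omega)

section

variable {lev : ℕ → ℕ} (h5 : lev 5 = 0)
include h5

theorem levelBound_binop {σ : State} {l c w : ℕ} {d p q : Cell} {f : ℝ → ℝ → ℝ}
    (hf : ∀ x y w v, Sz x w → Sz y v → Sz (f x y) (w + v + 1))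
    (hw : LevelBound lev σ (l + 1) w) (hσ : LevelBound lev σ l c)
    (hl : LevelBound lev (σ.setReal d (f (p.eval σ) (q.eval σ))) l c)
    (hi : (d.arr == 5 || levelOk (lev d.arr) (lev p.arr) (lev q.arr)) = true) :
    LevelBound lev (σ.setReal d (f (p.eval σ) (q.eval σ))) (l + 1) (w + (2 * c + 9)) := by
  by_cases hd : d.arr = 5
  · intro a k ha
    rcases Nat.lt_or_ge (lev a) (l + 1) with h | h
    · exact (hl a k (by omega)).mono (by omega)
    · rw [State.setReal_real_apply, if_neg]
      · exact (hw a k ha).mono (by omega)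
      · rintro ⟨rfl, -⟩
        rw [hd, h5] at h
        omega
  · refine levelBound_write hw hl fun hld => ?_
    simp only [hd, beq_iff_eq, Bool.or_eq_true, levelOk, decide_eq_true_eq, false_or, hld] at hi
    rcases hi with ⟨h1, h2⟩ | ⟨h1, h2⟩
    · exact (hf _ _ _ _ (hw p.arr _ h1) (hσ q.arr _ (by omega))).mono (by omega)
    · exact (hf _ _ _ _ (hσ p.arr _ (by omega)) (hw q.arr _ h2)).mono (by omega)

theorem Instr.levelBound_step {i : Instr} {σ : State} {l c w : ℕ} (hi : i.leveled lev = true)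
    (hw : LevelBound lev σ (l + 1) w) (hσ : LevelBound lev σ l c)
    (hl : LevelBound lev (i.step σ) l c) :
    LevelBound lev (i.step σ) (l + 1) (w + (2 * c + 9)) := by
  have htriv : (i.step σ).real = σ.real → LevelBound lev (i.step σ) (l + 1) (w + (2 * c + 9)) :=
    fun h a k ha => by rw [h]; exact (hw a k ha).mono (by omega)
  -- Array `5` has level 0, so a write to it cannot touch level `l + 1`; its contents are covered by
  -- the assumption on the lower levels.
  have hfive : ∀ (d : Cell) x, d.arr = 5 → i.step σ = σ.setReal d x →
      LevelBound lev (i.step σ) (l + 1) (w + (2 * c + 9)) := by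
    intro d x hd he a k ha
    rcases Nat.lt_or_ge (lev a) (l + 1) with h | h
    · exact (hl a k (by omega)).mono (by omega)
    · rw [he, State.setReal_real_apply, if_neg]
      · exact (hw a k ha).mono (by omega)
      · rintro ⟨rfl, -⟩
        rw [hd, h5] at h
        omega
  cases i with
  | nset | nadd | nsub | nhalf | nload | nstore => exact htriv rfl
  | rconst d k =>
    simp only [Instr.leveled, beq_iff_eq, Bool.or_eq_true, decide_eq_true_eq] at hi
    by_cases hd : d.arr = 5
    · exact hfive d _ hd rfl
    · refine levelBound_write hw hl fun _ => ?_
      have : k ≤ 2 ^ 8 := by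
        have := (hi.resolve_left hd).2
        omega
      exact (Sz.natCast this).mono (by omega)
  | rmove d p =>
    simp only [Instr.leveled, beq_iff_eq, Bool.or_eq_true, decide_eq_true_eq] at hi
    by_cases hd : d.arr = 5
    · exact hfive d _ hd rfl
    · exact levelBound_write hw hl fun h =>
        (hw p.arr _ (by have := (hi.resolve_left hd).2; omega)).mono (by omega)
  | radd d p q =>
    exact levelBound_binop h5 (f := fun x y => x + y) (fun x y w v h h' => h.add h') hw hσ hl hi
  | rsub d p q =>
    exact levelBound_binop h5 (f := fun x y => x - y) (fun x y w v h h' => h.sub h') hw hσ hl hi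
  | rmul d p q =>
    exact levelBound_binop h5 (f := fun x y => x * y)
      (fun x y w v h h' => (h.mul h').mono (by omega)) hw hσ hl hi
  | rdiv d p q =>
    exact levelBound_binop h5 (f := fun x y => x / y)
      (fun x y w v h h' => (h.div h').mono (by omega)) hw hσ hl hi
  | rround d p b => exact hfive d _ (by simpa [Instr.leveled] using hi) rfl

/-- While the lower levels stay below `c`, one step enlarges the sizes at level `l + 1` by at most
`2 * c + 9`. The growth is additive in time, although products are accumulated. -/
theorem Exec.levelBound_succ {P : Program} {σ σ' : State} {tr : List Event} (h : Exec P σ tr σ')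
    (hP : P.all (Instr.leveled lev) = true) {l c w : ℕ}
    (hσ : LevelBound lev σ l c) (htr : ∀ v ∈ tr, LevelBound lev v.state l c) (hcw : c ≤ w)
    (hw : LevelBound lev σ (l + 1) w) :
    (LevelBound lev σ' l c ∧ LevelBound lev σ' (l + 1) (w + tr.length * (2 * c + 9))) ∧
      ∀ v ∈ tr, LevelBound lev v.state (l + 1) (w + tr.length * (2 * c + 9)) := by
  have mono : ∀ {σ : State} {w w' : ℕ}, LevelBound lev σ (l + 1) w → w ≤ w' →
      LevelBound lev σ (l + 1) w' := fun h hww a k ha => (h a k ha).mono hww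
  induction h generalizing w with
  | skip σ => exact ⟨⟨hσ, mono hw (by simp)⟩, by simp⟩
  | iteration σ => exact ⟨⟨hσ, mono hw (by simp)⟩, by simpa using mono hw (by simp)⟩
  | instr i σ hd =>
    have hl : LevelBound lev (i.step σ) l c := htr _ (List.mem_singleton.2 rfl)
    have := Instr.levelBound_step h5 (by simpa [Program.all] using hP) hw hσ hl
    simpa using ⟨hl, this⟩
  | @seq P Q σ σ₁ σ₂ t₁ t₂ h₁ h₂ ih₁ ih₂ =>
    simp only [Program.all, Bool.and_eq_true] at hP
    obtain ⟨⟨a1, a2⟩, a3⟩ := ih₁ hP.1 hσ (fun v hv => htr v (List.mem_append_left _ hv)) hcw hw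
    obtain ⟨⟨b1, b2⟩, b3⟩ := ih₂ hP.2 a1 (fun v hv => htr v (List.mem_append_right _ hv))
      (hcw.trans (Nat.le_add_right _ _)) a2
    have e : w + t₁.length * (2 * c + 9) + t₂.length * (2 * c + 9) =
        w + (t₁ ++ t₂).length * (2 * c + 9) := by rw [List.length_append]; ring
    refine ⟨⟨b1, e ▸ b2⟩, fun v hv => ?_⟩
    rcases List.mem_append.1 hv with hv | hv
    · exact mono (a3 v hv) (by rw [List.length_append]; gcongr; omega)
    · exact e ▸ b3 v hv
  | ite_true hb h ih =>
    simp only [Program.all, Bool.and_eq_true] at hP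
    obtain ⟨⟨a1, a2⟩, a3⟩ := ih hP.1 hσ (fun v hv => htr v (List.mem_cons_of_mem _ hv)) hcw hw
    refine ⟨⟨a1, mono a2 (by gcongr; simp)⟩, fun v hv => ?_⟩
    rcases List.mem_cons.1 hv with rfl | hv
    · exact mono hw (by simp)
    · exact mono (a3 v hv) (by gcongr; simp)
  | ite_false hb h ih =>
    simp only [Program.all, Bool.and_eq_true] at hP
    obtain ⟨⟨a1, a2⟩, a3⟩ := ih hP.2 hσ (fun v hv => htr v (List.mem_cons_of_mem _ hv)) hcw hw
    refine ⟨⟨a1, mono a2 (by gcongr; simp)⟩, fun v hv => ?_⟩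
    rcases List.mem_cons.1 hv with rfl | hv
    · exact mono hw (by simp)
    · exact mono (a3 v hv) (by gcongr; simp)
  | @while_true b P σ σ₁ σ₂ t₁ t₂ hb h₁ h₂ ih₁ ih₂ =>
    obtain ⟨⟨a1, a2⟩, a3⟩ := ih₁ hP hσ
      (fun v hv => htr v (List.mem_cons_of_mem _ (List.mem_append_left _ hv))) hcw hw
    obtain ⟨⟨b1, b2⟩, b3⟩ := ih₂ hP a1
      (fun v hv => htr v (List.mem_cons_of_mem _ (List.mem_append_right _ hv)))
      (hcw.trans (Nat.le_add_right _ _)) a2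
    have e : w + t₁.length * (2 * c + 9) + t₂.length * (2 * c + 9) ≤
        w + (⟨false, σ⟩ :: (t₁ ++ t₂) : List Event).length * (2 * c + 9) := by
      rw [List.length_cons, List.length_append]
      have : (t₁.length + t₂.length + 1) * (2 * c + 9) =
        t₁.length * (2 * c + 9) + t₂.length * (2 * c + 9) + (2 * c + 9) := by ring
      omega
    refine ⟨⟨b1, mono b2 e⟩, fun v hv => ?_⟩
    rcases List.mem_cons.1 hv with rfl | hv
    · exact mono hw (by simp)
    rcases List.mem_append.1 hv with hv | hv
    · exact mono (a3 v hv) (by omega)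
    · exact mono (b3 v hv) e
  | while_false => exact ⟨⟨hσ, mono hw (by simp)⟩, by simpa using mono hw (by simp)⟩

/-- Induction on the level: each level costs one factor proportional to the length of the run. Only
level 0 has to be bounded by other means. Without the stratification, repeated squaring could double
the sizes at every step. -/
theorem Exec.levelBound {P : Program} {σ σ' : State} {tr : List Event} (h : Exec P σ tr σ')
    (hP : P.all (Instr.leveled lev) = true) {w : ℕ}
    (hσ : ∀ a k, Sz (σ.real a k) w) (htr : ∀ v ∈ tr, LevelBound lev v.state 0 w) (l : ℕ) :
    ∀ v ∈ tr, LevelBound lev v.state l ((w + 1) * (11 * (tr.length + 1)) ^ l) := by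
  suffices H : w ≤ (w + 1) * (11 * (tr.length + 1)) ^ l ∧
      LevelBound lev σ l ((w + 1) * (11 * (tr.length + 1)) ^ l) ∧
      ∀ v ∈ tr, LevelBound lev v.state l ((w + 1) * (11 * (tr.length + 1)) ^ l) from H.2.2
  induction l with
  | zero =>
    exact ⟨by simp, fun a k _ => (hσ a k).mono (by simp), fun v hv a k ha =>
      (htr v hv a k ha).mono (by simp)⟩
  | succ l ih =>
    obtain ⟨h1, h2, h3⟩ := ih
    set c := (w + 1) * (11 * (tr.length + 1)) ^ l with hc
    have hc1 : 1 ≤ c := Nat.one_le_iff_ne_zero.2 (by positivity)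
    have e : (w + 1) * (11 * (tr.length + 1)) ^ (l + 1) = c * (11 * (tr.length + 1)) := by
      rw [hc]; ring
    have hle : c + tr.length * (2 * c + 9) ≤ c * (11 * (tr.length + 1)) := by nlinarith
    rw [e]
    refine ⟨by omega, fun a k _ => (hσ a k).mono (by omega), fun v hv a k ha => ?_⟩
    exact ((h.levelBound_succ h5 hP h2 h3 le_rfl
      (fun a k _ => (hσ a k).mono h1)).2 v hv a k ha).mono hle

end

/-! ### Sums over the list of entries, the scaled matrix and the potential -/

open Finset

/-- The sum of the values `v e`, `e < E`, with key `i`. -/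
def scat (key : ℕ → ℕ) (v : ℕ → ℝ) (E i : ℕ) : ℝ := ∑ e ∈ range E, if key e = i then v e else 0

section scat

variable {key : ℕ → ℕ} {v w : ℕ → ℝ} {E i m : ℕ}

@[simp] theorem scat_zero : scat key v 0 i = 0 := by simp [scat]

theorem scat_succ : scat key v (E + 1) i = scat key v E i + if key E = i then v E else 0 := by
  simp [scat, sum_range_succ]

theorem scat_congr (h : ∀ e < E, key e = i → v e = w e) : scat key v E i = scat key w E i := by
  refine sum_congr rfl fun e he => ?_
  split_ifs with hk
  exacts [h e (mem_range.1 he) hk, rfl]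

theorem scat_mono (h : ∀ e < E, key e = i → v e ≤ w e) : scat key v E i ≤ scat key w E i := by
  refine sum_le_sum fun e he => ?_
  split_ifs with hk
  exacts [h e (mem_range.1 he) hk, le_rfl]

theorem scat_nonneg (h : ∀ e < E, key e = i → 0 ≤ v e) : 0 ≤ scat key v E i :=
  sum_nonneg fun e he => by
    split_ifs with hk
    exacts [h e (mem_range.1 he) hk, le_rfl]

theorem le_scat (h : ∀ e < E, key e = i → 0 ≤ v e) {e : ℕ} (he : e < E) (hk : key e = i) :
    v e ≤ scat key v E i := by
  have := single_le_sum (f := fun e => if key e = i then v e else 0) (s := range E)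
    (fun e he => by
      split_ifs with hk
      exacts [h e (mem_range.1 he) hk, le_rfl]) (mem_range.2 he)
  simpa [hk, scat] using this

theorem scat_mul (g : ℕ → ℝ) : scat key (fun e => v e * g (key e)) E i = scat key v E i * g i := by
  rw [scat, scat, sum_mul]
  refine sum_congr rfl fun e _ => ?_
  split_ifs with hk <;> simp [hk]

theorem scat_const_mul (k : ℝ) : scat key (fun e => k * v e) E i = k * scat key v E i := by
  rw [scat, scat, mul_sum]
  exact sum_congr rfl fun e _ => by split_ifs <;> simp

theorem scat_add : scat key (fun e => v e + w e) E i = scat key v E i + scat key w E i := by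
  rw [scat, scat, scat, ← sum_add_distrib]
  exact sum_congr rfl fun e _ => by split_ifs <;> simp

theorem scat_sub : scat key (fun e => v e - w e) E i = scat key v E i - scat key w E i := by
  rw [scat, scat, scat, ← sum_sub_distrib]
  exact sum_congr rfl fun e _ => by split_ifs <;> simp

theorem sum_scat (h : ∀ e < E, key e < m) :
    ∑ i ∈ range m, scat key v E i = ∑ e ∈ range E, v e := by
  unfold scat
  rw [sum_comm]
  refine sum_congr rfl fun e he => ?_
  rw [sum_ite_eq, if_pos (mem_range.2 (h e (mem_range.1 he)))]

theorem sum_scat_mul (g : ℕ → ℝ) (h : ∀ e < E, key e < m) :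
    ∑ i ∈ range m, scat key v E i * g i = ∑ e ∈ range E, v e * g (key e) := by
  rw [← sum_scat h]
  exact sum_congr rfl fun i _ => (scat_mul g).symm

end scat

/-- A scaling problem given by the list of its nonzero entries. -/
structure Inst where
  (m n E : ℕ)
  (row col : ℕ → ℕ)
  (a r c : ℕ → ℝ)
  (s : ℝ)
  row_lt : ∀ e < E, row e < m
  col_lt : ∀ e < E, col e < n
  a_pos : ∀ e < E, 0 < a e
  r_pos : ∀ i < m, 0 < r i
  c_pos : ∀ j < n, 0 < c j
  inj : ∀ e < E, ∀ e' < E, row e = row e' → col e = col e' → e = e'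
  row_ne : ∀ i < m, ∃ e < E, row e = i
  sum_r : ∑ i ∈ range m, r i = s
  sum_c : ∑ j ∈ range n, c j = s

namespace Inst

variable (I : Inst) (y : ℕ → ℝ)

/-- The row sums of `A diag(y)`. -/
def D (i : ℕ) : ℝ := scat I.row (fun e => I.a e * y (I.col e)) I.E i
/-- The row scaling that makes the row sums exact. -/
noncomputable def x (i : ℕ) : ℝ := I.r i / I.D y i
/-- The entries of the scaled matrix. -/
noncomputable def B (e : ℕ) : ℝ := I.a e * y (I.col e) * I.x y (I.row e)
/-- The column sums of the scaled matrix. -/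
noncomputable def q (j : ℕ) : ℝ := scat I.col (I.B y) I.E j
/-- The column errors. -/
noncomputable def d (j : ℕ) : ℝ := I.q y j - I.c j
/-- The potential. -/
noncomputable def Φ : ℝ := ∑ j ∈ range I.n, I.d y j * I.d y j

variable {I y} (hy : ∀ j < I.n, 0 < y j)
include hy

theorem D_pos {i : ℕ} (hi : i < I.m) : 0 < I.D y i := by
  obtain ⟨e, he, rfl⟩ := I.row_ne i hi
  refine lt_of_lt_of_le ?_ (le_scat (fun e he _ => ?_) he rfl)
  · exact mul_pos (I.a_pos e he) (hy _ (I.col_lt e he))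
  · exact (mul_pos (I.a_pos e he) (hy _ (I.col_lt e he))).le

theorem x_pos {i : ℕ} (hi : i < I.m) : 0 < I.x y i := div_pos (I.r_pos i hi) (D_pos hy hi)

theorem B_pos {e : ℕ} (he : e < I.E) : 0 < I.B y e :=
  mul_pos (mul_pos (I.a_pos e he) (hy _ (I.col_lt e he))) (x_pos hy (I.row_lt e he))

theorem row_sum {i : ℕ} (hi : i < I.m) : scat I.row (I.B y) I.E i = I.r i := by
  have : scat I.row (I.B y) I.E i = I.D y i * I.x y i := scat_mul (I.x y)
  rw [this, x, mul_div_cancel₀ _ (D_pos hy hi).ne']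

theorem sum_B : ∑ e ∈ range I.E, I.B y e = I.s := by
  rw [← sum_scat I.row_lt, ← I.sum_r]
  exact sum_congr rfl fun i hi => row_sum hy (mem_range.1 hi)

theorem sum_q : ∑ j ∈ range I.n, I.q y j = I.s := by
  rw [← sum_B hy]
  exact sum_scat I.col_lt

theorem sum_d : ∑ j ∈ range I.n, I.d y j = 0 := by
  simp only [d, sum_sub_distrib, sum_q hy, I.sum_c, sub_self]

theorem q_nonneg (j : ℕ) : 0 ≤ I.q y j := scat_nonneg fun _ he _ => (B_pos hy he).le

theorem abs_d_le {j : ℕ} (hj : j < I.n) : |I.d y j| ≤ I.s := by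
  have h1 : I.q y j ≤ I.s := by
    rw [← sum_q hy]
    exact single_le_sum (fun j _ => q_nonneg hy j) (mem_range.2 hj)
  have h2 : I.c j ≤ I.s := by
    rw [← I.sum_c]
    exact single_le_sum (fun j hj => (I.c_pos j (mem_range.1 hj)).le) (mem_range.2 hj)
  have := q_nonneg hy j
  have := I.c_pos j hj
  rw [d, abs_le]
  constructor <;> linarith

theorem s_nonneg : 0 ≤ I.s := by
  rw [← sum_B hy]
  exact sum_nonneg fun e he => (B_pos hy (mem_range.1 he)).le

/-- The cross terms in ∑ (q_j - c_j)² are nonpositive, and the squares of nonnegative numbers with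
sum s add up to at most s². -/
theorem Φ_le : I.Φ y ≤ 2 * I.s ^ 2 := by
  have h : ∀ v : ℕ → ℝ, (∀ j < I.n, 0 ≤ v j) → ∑ j ∈ range I.n, v j ^ 2 ≤
      (∑ j ∈ range I.n, v j) ^ 2 := fun v hv =>
    sum_sq_le_sq_sum_of_nonneg fun j hj => hv j (mem_range.1 hj)
  have h1 := h (I.q y) fun j _ => q_nonneg hy j
  have h2 := h I.c fun j hj => (I.c_pos j hj).le
  rw [sum_q hy] at h1
  rw [I.sum_c] at h2
  have : I.Φ y ≤ ∑ j ∈ range I.n, I.q y j ^ 2 + ∑ j ∈ range I.n, I.c j ^ 2 := by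
    rw [← sum_add_distrib]
    refine sum_le_sum fun j hj => ?_
    have := mul_nonneg (q_nonneg hy j) (I.c_pos j (mem_range.1 hj)).le
    rw [d]
    nlinarith
  linarith

/-- Errors with sum zero vanish when there is at most one column. Hence a run that enters the loop
has at least two columns, which later estimates need. -/
theorem Φ_eq_zero (hn : I.n ≤ 1) : I.Φ y = 0 := by
  have h := sum_d hy
  rcases Nat.le_one_iff_eq_zero_or_eq_one.1 hn with h0 | h1
  · simp [Φ, h0]
  · rw [h1] at h
    simp only [sum_range_one] at h
    simp [Φ, h1, h]

-- Factor the difference of squares: the sum of two errors of a column is at most 2 s in absolute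
-- value, and the differences of the errors are controlled by the changes of the entries.
omit hy in
theorem Φ_sub_le {z : ℕ → ℝ} (hy : ∀ j < I.n, 0 < y j) (hz : ∀ j < I.n, 0 < z j) :
    |I.Φ z - I.Φ y| ≤ 2 * I.s * ∑ e ∈ range I.E, |I.B z e - I.B y e| := by
  have h1 : ∀ j, |I.d z j - I.d y j| ≤ scat I.col (fun e => |I.B z e - I.B y e|) I.E j := by
    intro j
    have : I.d z j - I.d y j = scat I.col (fun e => I.B z e - I.B y e) I.E j := by
      rw [scat_sub, d, d, q, q]
      ring
    rw [this]
    refine (abs_sum_le_sum_abs _ _).trans (le_of_eq (sum_congr rfl fun e _ => ?_))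
    split_ifs <;> simp
  rw [← sum_scat I.col_lt, Φ, Φ, ← sum_sub_distrib, mul_sum]
  refine (abs_sum_le_sum_abs _ _).trans (sum_le_sum fun j hj => ?_)
  have e : I.d z j * I.d z j - I.d y j * I.d y j =
      (I.d z j + I.d y j) * (I.d z j - I.d y j) := by ring
  rw [e, abs_mul]
  have hj := mem_range.1 hj
  have h2 : |I.d z j + I.d y j| ≤ 2 * I.s := by
    have := abs_add_le (I.d z j) (I.d y j)
    have := abs_d_le hy hj
    have := abs_d_le hz hj
    linarith
  exact mul_le_mul h2 (h1 j) (abs_nonneg _) ((abs_nonneg _).trans h2)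

/-! ### Scaling up a set of columns -/

variable (I y) (T : ℕ → Prop) [DecidablePred T] (β : ℝ)

omit hy in
/-- The share of row `i` that lies in the columns `T`. -/
noncomputable def f (i : ℕ) : ℝ :=
  scat I.row (fun e => if T (I.col e) then I.B y e else 0) I.E i / I.r i

omit hy in
/-- The weights of the entries in the estimate of the movement. -/
noncomputable def W (e : ℕ) : ℝ :=
  if T (I.col e) then I.B y e * (1 - I.f y T (I.row e)) / I.f y T (I.row e) else I.B y e

omit hy in
/-- The estimate of the movement of column `j`. -/
noncomputable def g (j : ℕ) : ℝ :=
  scat I.col (fun e => min (β * I.f y T (I.row e)) 1 * I.W y T e) I.E j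

omit hy in
/-- The column scaling after scaling up `T`. -/
noncomputable def up (j : ℕ) : ℝ := if T j then y j * (1 + β) else y j

variable {I y T β}

theorem f_nonneg {i : ℕ} (hi : i < I.m) : 0 ≤ I.f y T i :=
  div_nonneg (scat_nonneg fun e he _ => by
    split_ifs
    exacts [(B_pos hy he).le, le_rfl]) (I.r_pos i hi).le

theorem f_le_one {i : ℕ} (hi : i < I.m) : I.f y T i ≤ 1 := by
  rw [f, div_le_one (I.r_pos i hi), ← row_sum hy hi]
  refine scat_mono fun e he _ => ?_
  split_ifs
  exacts [le_rfl, (B_pos hy he).le]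

theorem f_pos {e : ℕ} (he : e < I.E) (hT : T (I.col e)) : 0 < I.f y T (I.row e) := by
  refine div_pos (lt_of_lt_of_le (B_pos hy he) ?_) (I.r_pos _ (I.row_lt e he))
  have := le_scat (key := I.row) (v := fun e => if T (I.col e) then I.B y e else 0) (E := I.E)
    (i := I.row e) (fun e he _ => by
      split_ifs
      exacts [(B_pos hy he).le, le_rfl]) he rfl
  simpa [hT] using this

theorem W_nonneg {e : ℕ} (he : e < I.E) : 0 ≤ I.W y T e := by
  rw [W]
  split_ifs with hT
  · exact div_nonneg (mul_nonneg (B_pos hy he).le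
      (sub_nonneg.2 (f_le_one hy (I.row_lt e he)))) (f_pos hy he hT).le
  · exact (B_pos hy he).le

omit hy in
theorem scat_T {i : ℕ} (hi : i < I.m) :
    scat I.row (fun e => if T (I.col e) then I.B y e else 0) I.E i = I.f y T i * I.r i := by
  rw [f, div_mul_cancel₀ _ (I.r_pos i hi).ne']

/-- The row factor is constant along a row, so T has the same share of the row in `A diag(y)` as in
the scaled matrix. Only that share is multiplied by 1 + β. -/
theorem D_up {i : ℕ} (hi : i < I.m) : I.D (up y T β) i = I.D y i * (1 + β * I.f y T i) := by
  have hx := (x_pos hy hi).ne'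
  have h1 : scat I.row (fun e => if T (I.col e) then I.B y e else 0) I.E i =
      scat I.row (fun e => if T (I.col e) then I.a e * y (I.col e) else 0) I.E i * I.x y i := by
    rw [← scat_mul]
    refine scat_congr fun e _ _ => ?_
    split_ifs <;> simp [B]
  have h2 : I.f y T i * I.D y i =
      scat I.row (fun e => if T (I.col e) then I.a e * y (I.col e) else 0) I.E i := by
    have h3 := scat_T (y := y) (T := T) hi
    rw [h1] at h3
    have h4 : I.D y i * I.x y i = I.r i := by
      rw [x, mul_div_cancel₀ _ (D_pos hy hi).ne']
    rw [← h4] at h3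
    apply mul_right_cancel₀ hx
    linarith
  have h3 : I.D (up y T β) i = I.D y i +
      β * scat I.row (fun e => if T (I.col e) then I.a e * y (I.col e) else 0) I.E i := by
    rw [D, D, ← scat_const_mul, ← scat_add]
    refine scat_congr fun e _ _ => ?_
    rw [up]
    split_ifs <;> ring
  rw [h3, ← h2]
  ring

/-- An entry in T changes by B β (1 - f) / (1 + β f), an entry outside T by -B β f / (1 + β f). The
weight `W` is made so that both have the common factor β f / (1 + β f). -/
theorem B_up {e : ℕ} (he : e < I.E) (hβ : 0 ≤ β) :
    I.B (up y T β) e - I.B y e = (if T (I.col e) then 1 else -1) *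
      (I.W y T e * (β * I.f y T (I.row e) / (1 + β * I.f y T (I.row e)))) := by
  have hi := I.row_lt e he
  have hD := (D_pos hy hi).ne'
  have hf := f_nonneg (T := T) hy hi
  have h1 : 1 + β * I.f y T (I.row e) ≠ 0 := by positivity
  rw [B, B, W, x, x, D_up hy hi, up, B, x]
  split_ifs with hT
  · have := (f_pos hy he hT).ne'
    field_simp
    ring
  · field_simp
    ring

/-- The true movement of column `j`. -/
theorem movement {j : ℕ} (hβ : 0 ≤ β) : ∃ δ : ℝ, I.g y T β j / 2 ≤ δ ∧ δ ≤ I.g y T β j ∧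
    I.d (up y T β) j = I.d y j + (if T j then 1 else -1) * δ := by
  -- The estimate replaces t / (1 + t), for t = β f, by min(t, 1). These differ by at most a factor
  -- 2, and the latter is piecewise linear in β.
  refine ⟨scat I.col (fun e => I.W y T e *
    (β * I.f y T (I.row e) / (1 + β * I.f y T (I.row e)))) I.E j, ?_, ?_, ?_⟩
  · rw [div_eq_inv_mul, g, ← scat_const_mul]
    refine scat_mono fun e he _ => ?_
    have hw := W_nonneg (T := T) hy he
    have hf := mul_nonneg hβ (f_nonneg (T := T) hy (I.row_lt e he))
    rw [mul_comm (I.W y T e), ← mul_assoc]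
    refine mul_le_mul_of_nonneg_right ?_ hw
    rw [le_div_iff₀ (by positivity)]
    rcases le_total (β * I.f y T (I.row e)) 1 with h | h
    · rw [min_eq_left h]
      nlinarith
    · rw [min_eq_right h]
      nlinarith
  · rw [g]
    refine scat_mono fun e he _ => ?_
    have hw := W_nonneg (T := T) hy he
    have hf := mul_nonneg hβ (f_nonneg (T := T) hy (I.row_lt e he))
    rw [mul_comm (I.W y T e)]
    refine mul_le_mul_of_nonneg_right ?_ hw
    rw [div_le_iff₀ (by positivity)]
    rcases le_total (β * I.f y T (I.row e)) 1 with h | h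
    · rw [min_eq_left h]
      nlinarith
    · rw [min_eq_right h]
      nlinarith
  · have : I.q (up y T β) j - I.q y j = (if T j then 1 else -1) * scat I.col (fun e => I.W y T e *
        (β * I.f y T (I.row e) / (1 + β * I.f y T (I.row e)))) I.E j := by
      rw [q, q, ← scat_sub, ← scat_const_mul]
      exact scat_congr fun e he hk => by rw [B_up hy he hβ, hk]
    rw [d, d, ← this]
    ring

theorem up_pos (hβ : 0 ≤ β) : ∀ j < I.n, 0 < up y T β j := by
  intro j hj
  have := hy j hj
  rw [up]
  split_ifs <;> positivity

/-- Measure the errors from the middle τ of the gap. Each lies at distance at least G/2 and moves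
towards τ by δ ≤ G/4, which changes its square by at most -G δ + δ² ≤ -3/4 G δ. Recentring is free
because the signed movements sum to zero. One column moves by at least G/8, hence the constant 3/32.
-/
theorem Φ_up_le {thr G : ℝ} (hG : 0 ≤ G) (hβ : 0 ≤ β)
    (hT : ∀ j < I.n, T j → I.d y j ≤ thr) (hT' : ∀ j < I.n, ¬ T j → thr + G ≤ I.d y j)
    (hg : ∀ j < I.n, I.g y T β j ≤ G / 4) (hg' : ∃ j < I.n, G / 4 ≤ I.g y T β j) :
    I.Φ (up y T β) ≤ I.Φ y - 3 / 32 * G ^ 2 := by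
  choose δ h1 h2 h3 using fun j => movement (I := I) (y := y) (T := T) (β := β) (j := j) hy hβ
  have hg0 : ∀ j, 0 ≤ I.g y T β j := fun j => scat_nonneg fun e he _ =>
    mul_nonneg (le_min (mul_nonneg hβ (f_nonneg hy (I.row_lt e he))) zero_le_one)
      (W_nonneg hy he)
  have hδ : ∀ j, 0 ≤ δ j := fun j => le_trans (by linarith [hg0 j]) (h1 j)
  have hsum : ∑ j ∈ range I.n, (if T j then 1 else -1) * δ j = 0 := by
    have ha := sum_d hy
    have hb := sum_d (I := I) (up_pos (T := T) hy hβ)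
    simp only [h3, sum_add_distrib, ha, zero_add] at hb
    exact hb
  set τ := thr + G / 2
  have key : ∀ j ∈ range I.n, I.d (up y T β) j * I.d (up y T β) j ≤
      I.d y j * I.d y j + 2 * τ * ((if T j then 1 else -1) * δ j) - 3 / 4 * G * δ j := by
    intro j hj
    have hj := mem_range.1 hj
    have a1 : δ j ≤ G / 4 := (h2 j).trans (hg j hj)
    have a2 : δ j * δ j ≤ δ j * (G / 4) := mul_le_mul_of_nonneg_left a1 (hδ j)
    rw [h3]
    split_ifs with h
    · have a3 : (I.d y j - τ) * δ j ≤ -(G / 2) * δ j :=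
        mul_le_mul_of_nonneg_right (by have := hT j hj h; simp only [τ]; linarith) (hδ j)
      nlinarith
    · have a3 : -(I.d y j - τ) * δ j ≤ -(G / 2) * δ j :=
        mul_le_mul_of_nonneg_right (by have := hT' j hj h; simp only [τ]; linarith) (hδ j)
      nlinarith
  have h4 := sum_le_sum key
  rw [sum_sub_distrib, sum_add_distrib, ← mul_sum, ← mul_sum, hsum] at h4
  obtain ⟨j, hj, hj'⟩ := hg'
  have h5 : G / 8 ≤ ∑ j ∈ range I.n, δ j :=
    le_trans (by have := h1 j; linarith) (single_le_sum (fun j _ => hδ j) (mem_range.2 hj))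
  have h6 := mul_le_mul_of_nonneg_left h5 (show 0 ≤ 3 / 4 * G by positivity)
  rw [Φ, Φ]
  nlinarith

/-- If no scaling of `T` moves any column enough, then `T` certifies infeasibility. -/
theorem certificate {thr G : ℝ} (hG : 0 < G)
    (hT : ∀ j < I.n, T j → I.d y j ≤ thr) (hT' : ∀ j < I.n, ¬ T j → thr + G ≤ I.d y j)
    (hTne : ∃ j < I.n, T j) (hT'ne : ∃ j < I.n, ¬ T j)
    (hβ : ∀ i < I.m, 0 < I.f y T i → 1 ≤ β * I.f y T i)
    (hg : ∀ j < I.n, I.g y T β j < G / 4) :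
    ∑ i ∈ range I.m, (if 0 < I.f y T i then I.r i else 0) <
      ∑ j ∈ range I.n, if T j then I.c j else 0 := by
  -- With β f ≥ 1 wherever f > 0, every minimum is saturated, and the estimate equals the limit of
  -- the true movement for β → ∞.
  have hgf : ∀ j, I.g y T β j = scat I.col
      (fun e => (if 0 < I.f y T (I.row e) then 1 else 0) * I.W y T e) I.E j := fun j => by
    refine scat_congr fun e he _ => ?_
    have hi := I.row_lt e he
    split_ifs with h
    · rw [min_eq_right (hβ _ hi h)]
    · have : I.f y T (I.row e) = 0 := le_antisymm (not_lt.1 h) (f_nonneg hy hi)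
      simp [this]
  have hite : ∀ (P : ℕ → Prop) [DecidablePred P] (v : ℕ → ℝ),
      ∑ j ∈ range I.n, (if P j then scat I.col v I.E j else 0) =
        ∑ e ∈ range I.E, if P (I.col e) then v e else 0 := fun P _ v => by
    have := sum_scat_mul (v := v) (fun j => if P j then 1 else 0) I.col_lt
    simpa using this
  -- the mass that `T` attracts
  have hA : ∑ j ∈ range I.n, (if T j then I.q y j + I.g y T β j else 0) =
      ∑ i ∈ range I.m, if 0 < I.f y T i then I.r i else 0 := by
    have e1 : ∀ j, (if T j then I.q y j + I.g y T β j else 0) = if T j then scat I.col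
        (fun e => I.B y e + (if 0 < I.f y T (I.row e) then 1 else 0) * I.W y T e) I.E j
        else 0 := fun j => by rw [scat_add, hgf, q]
    rw [sum_congr rfl fun j _ => e1 j, hite]
    have e2 : ∀ e ∈ range I.E, (if T (I.col e) then
        I.B y e + (if 0 < I.f y T (I.row e) then 1 else 0) * I.W y T e else 0) =
        (if T (I.col e) then I.B y e else 0) * (I.f y T (I.row e))⁻¹ := fun e he => by
      split_ifs with h1 h2
      · rw [W, if_pos h1]
        field_simp
        ring
      · exact absurd (f_pos hy (mem_range.1 he) h1) h2
      · simp
    rw [sum_congr rfl e2, ← sum_scat_mul (fun i => (I.f y T i)⁻¹) I.row_lt]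
    refine sum_congr rfl fun i hi => ?_
    rw [scat_T (mem_range.1 hi)]
    split_ifs with h
    · field_simp
    · rw [le_antisymm (not_lt.1 h) (f_nonneg hy (mem_range.1 hi))]
      simp
  -- In this limit the rows that meet T give all their mass to T, and only the rows with f = 0 feed
  -- the other columns.
  have hB : 0 ≤ ∑ j ∈ range I.n, (if ¬ T j then I.q y j - I.g y T β j else 0) ∧
      ∑ j ∈ range I.n, (if T j then I.q y j + I.g y T β j else 0) +
      ∑ j ∈ range I.n, (if ¬ T j then I.q y j - I.g y T β j else 0) = I.s := by
    have e1 : ∀ j, (if ¬ T j then I.q y j - I.g y T β j else 0) = if ¬ T j then scat I.col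
        (fun e => I.B y e - (if 0 < I.f y T (I.row e) then 1 else 0) * I.W y T e) I.E j
        else 0 := fun j => by rw [scat_sub, hgf, q]
    rw [sum_congr rfl fun j _ => e1 j, hite]
    have e2 : ∀ e ∈ range I.E, (if ¬ T (I.col e) then
        I.B y e - (if 0 < I.f y T (I.row e) then 1 else 0) * I.W y T e else 0) =
        (I.B y e - (if T (I.col e) then I.B y e else 0)) *
          (if 0 < I.f y T (I.row e) then 0 else 1) := fun e he => by
      by_cases h1 : T (I.col e) <;> by_cases h2 : 0 < I.f y T (I.row e) <;> simp [h1, h2, W]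
    rw [sum_congr rfl e2, ← sum_scat_mul (fun i => if 0 < I.f y T i then 0 else 1) I.row_lt, hA,
      ← I.sum_r, ← sum_add_distrib]
    have e3 : ∀ i ∈ range I.m, scat I.row (fun e => I.B y e - if T (I.col e) then I.B y e else 0)
        I.E i * (if 0 < I.f y T i then 0 else 1) = if 0 < I.f y T i then 0 else I.r i := by
      intro i hi
      have hi := mem_range.1 hi
      rw [scat_sub, row_sum hy hi, scat_T hi]
      split_ifs with h
      · simp
      · rw [le_antisymm (not_lt.1 h) (f_nonneg hy hi)]
        simp
    constructor
    · rw [sum_congr rfl e3]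
      refine sum_nonneg fun i hi => ?_
      split_ifs
      exacts [le_rfl, (I.r_pos i (mem_range.1 hi)).le]
    · refine sum_congr rfl fun i hi => ?_
      rw [e3 i hi]
      split_ifs <;> simp
  rw [← hA]
  set τ := thr + G / 2
  have hc : ∑ j ∈ range I.n, (if T j then I.c j else 0) +
      ∑ j ∈ range I.n, (if ¬ T j then I.c j else 0) = I.s := by
    rw [← I.sum_c, ← sum_add_distrib]
    exact sum_congr rfl fun j _ => by split_ifs <;> simp
  have h1 : ∀ j ∈ range I.n, (if T j then I.q y j + I.g y T β j else 0) ≤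
      (if T j then I.c j else 0) + if T j then τ else 0 := fun j hj => by
    split_ifs with h
    · have a1 := hT j (mem_range.1 hj) h
      have a2 := hg j (mem_range.1 hj)
      rw [d] at a1
      simp only [τ]
      linarith
    · simp
  have h2 : ∀ j ∈ range I.n, (if ¬ T j then I.c j else 0) + (if ¬ T j then τ else 0) ≤
      if ¬ T j then I.q y j - I.g y T β j else 0 := fun j hj => by
    split_ifs with h
    · simp
    · have a1 := hT' j (mem_range.1 hj) h
      have a2 := hg j (mem_range.1 hj)
      rw [d] at a1
      simp only [τ]
      linarith
  obtain ⟨j₁, hj₁, ht₁⟩ := hTne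
  obtain ⟨j₂, hj₂, ht₂⟩ := hT'ne
  have h1' : ∑ j ∈ range I.n, (if T j then I.q y j + I.g y T β j else 0) <
      ∑ j ∈ range I.n, ((if T j then I.c j else 0) + if T j then τ else 0) := by
    refine sum_lt_sum h1 ⟨j₁, mem_range.2 hj₁, ?_⟩
    have a1 := hT j₁ hj₁ ht₁
    have a2 := hg j₁ hj₁
    rw [d] at a1
    simp only [if_pos ht₁, τ]
    linarith
  have h2' : ∑ j ∈ range I.n, ((if ¬ T j then I.c j else 0) + (if ¬ T j then τ else 0)) <
      ∑ j ∈ range I.n, if ¬ T j then I.q y j - I.g y T β j else 0 := by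
    refine sum_lt_sum h2 ⟨j₂, mem_range.2 hj₂, ?_⟩
    have a1 := hT' j₂ hj₂ ht₂
    have a2 := hg j₂ hj₂
    rw [d] at a1
    simp only [if_pos ht₂, τ]
    linarith
  rw [sum_add_distrib] at h1' h2'
  -- In the limit the errors in T stay below τ and the others stay above τ. For τ ≤ 0, the columns
  -- in T receive less than their targets; for τ ≥ 0, the other columns hold more than theirs, and
  -- the balance of the total mass s gives the same conclusion.
  rcases le_total τ 0 with h | h
  · have : ∑ j ∈ range I.n, (if T j then τ else 0) ≤ 0 := sum_nonpos fun j _ => by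
      split_ifs <;> simp [h]
    linarith
  · have : 0 ≤ ∑ j ∈ range I.n, (if ¬ T j then τ else 0) := sum_nonneg fun j _ => by
      split_ifs <;> simp [h]
    linarith [hB.2]

end Inst

/-! ### Stability of the scaled matrix under capping and rounding -/

namespace Inst

variable {I : Inst} {u y z : ℕ → ℝ}

/-- The positions of the entries are distinct, so a row has at most one entry per column. -/
theorem scat_row_const_le {i : ℕ} {k : ℝ} (hk : 0 ≤ k) : scat I.row (fun _ => k) I.E i ≤ I.n * k := by
  have h : ((range I.E).filter fun e => I.row e = i).card ≤ (range I.n).card := by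
    refine card_le_card_of_injOn I.col (fun e he => ?_) fun e he e' he' hc => ?_
    · simp only [coe_filter, mem_range, Set.mem_ofPred_eq] at he
      simpa using I.col_lt e he.1
    · simp only [coe_filter, mem_range, Set.mem_ofPred_eq] at he he'
      exact I.inj e he.1 e' he'.1 (he.2.trans he'.2.symm) hc
  rw [scat, ← sum_filter, sum_const, nsmul_eq_mul]
  rw [card_range] at h
  gcongr

/-- The row sum divided by an entry. -/
theorem B_eq_div (hu : ∀ j < I.n, 0 < u j) {e : ℕ} (he : e < I.E) :
    I.B u e = I.r (I.row e) /
      scat I.row (fun e' => I.a e' / I.a e * (u (I.col e') / u (I.col e))) I.E (I.row e) := by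
  have ha := I.a_pos e he
  have hue := hu _ (I.col_lt e he)
  have : scat I.row (fun e' => I.a e' / I.a e * (u (I.col e') / u (I.col e))) I.E (I.row e) =
      (I.a e * u (I.col e))⁻¹ * I.D u (I.row e) := by
    rw [D, ← scat_const_mul]
    refine scat_congr fun e' _ _ => ?_
    field_simp
  rw [this, B, x]
  have := D_pos hu (I.row_lt e he)
  field_simp

/-- By `B_eq_div` an entry depends only on the ratios of the column scalings within its row. If some
competitor exceeds it by a ratio of at least H for both scalings, both values are at most r / R.
Otherwise each summand of the denominator either is unchanged or lies below 1 / R for both scalings,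
so the denominators differ by at most n / R. -/
theorem abs_B_sub_le {R H : ℝ} (hR : 0 < R) (hu : ∀ j < I.n, 0 < u j) (hz : ∀ j < I.n, 0 < z j)
    (hH : ∀ e < I.E, ∀ e' < I.E, R * (I.a e / I.a e') ≤ H)
    (huz : ∀ j < I.n, ∀ l < I.n, z l / z j = u l / u j ∨ (H ≤ u l / u j ∧ H ≤ z l / z j) ∨
      (H ≤ u j / u l ∧ H ≤ z j / z l)) {e : ℕ} (he : e < I.E) :
    |I.B z e - I.B u e| ≤ I.r (I.row e) * (I.n / R) := by
  have hr := I.r_pos _ (I.row_lt e he)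
  have hn : (1 : ℝ) ≤ I.n := by
    have := I.col_lt e he
    exact_mod_cast (by omega : 1 ≤ I.n)
  have hpos : ∀ w : ℕ → ℝ, (∀ j < I.n, 0 < w j) → ∀ e' < I.E,
      0 < I.a e' / I.a e * (w (I.col e') / w (I.col e)) := fun w hw e' he' =>
    mul_pos (div_pos (I.a_pos e' he') (I.a_pos e he))
      (div_pos (hw _ (I.col_lt e' he')) (hw _ (I.col_lt e he)))
  have hle : ∀ w : ℕ → ℝ, (∀ j < I.n, 0 < w j) → ∀ e' < I.E, I.row e' = I.row e →
      I.a e' / I.a e * (w (I.col e') / w (I.col e)) ≤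
      scat I.row (fun e' => I.a e' / I.a e * (w (I.col e') / w (I.col e))) I.E (I.row e) :=
    fun w hw e' he' hk => le_scat (fun e' he' _ => (hpos w hw e' he').le) he' hk
  -- The summand of `e` itself is 1. Denominators of at least 1 make the quotient Lipschitz in the
  -- denominator.
  have hone : ∀ w : ℕ → ℝ, (∀ j < I.n, 0 < w j) → 1 ≤
      scat I.row (fun e' => I.a e' / I.a e * (w (I.col e') / w (I.col e))) I.E (I.row e) :=
    fun w hw => by
      have := hle w hw e he rfl
      rwa [div_self (I.a_pos e he).ne', div_self (hw _ (I.col_lt e he)).ne', one_mul] at this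
  -- A column ratio of at least H outweighs the worst ratio of entries of A and still leaves the
  -- factor R.
  have hbig : ∀ w : ℕ → ℝ, (∀ j < I.n, 0 < w j) → ∀ e₁ < I.E, ∀ e₂ < I.E,
      H ≤ w (I.col e₁) / w (I.col e₂) → R ≤ I.a e₁ / I.a e₂ * (w (I.col e₁) / w (I.col e₂)) := by
    intro w hw e₁ he₁ e₂ he₂ h
    have h1 := I.a_pos e₁ he₁
    have h2 := I.a_pos e₂ he₂
    calc R = I.a e₁ / I.a e₂ * (R * (I.a e₂ / I.a e₁)) := by field_simp
      _ ≤ I.a e₁ / I.a e₂ * (w (I.col e₁) / w (I.col e₂)) :=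
        mul_le_mul_of_nonneg_left ((hH e₂ he₂ e₁ he₁).trans h) (div_pos h1 h2).le
  by_cases hA : ∃ e' < I.E, I.row e' = I.row e ∧ H ≤ u (I.col e') / u (I.col e) ∧
      H ≤ z (I.col e') / z (I.col e)
  · obtain ⟨e', he', hk, h1, h2⟩ := hA
    have hsmall : ∀ w : ℕ → ℝ, (∀ j < I.n, 0 < w j) → H ≤ w (I.col e') / w (I.col e) →
        I.B w e ≤ I.r (I.row e) * (I.n / R) := fun w hw h => by
      have := (hbig w hw e' he' e he h).trans (hle w hw e' he' hk)
      rw [B_eq_div hw he]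
      calc _ ≤ I.r (I.row e) / R := by gcongr
        _ ≤ I.r (I.row e) * (I.n / R) := by
          rw [div_eq_mul_one_div]
          gcongr
    have a1 := hsmall u hu h1
    have a2 := hsmall z hz h2
    have a3 := B_pos hu he
    have a4 := B_pos hz he
    rw [abs_le]
    constructor <;> linarith
  · have hterm : ∀ e' < I.E, I.row e' = I.row e →
        |I.a e' / I.a e * (z (I.col e') / z (I.col e)) -
          I.a e' / I.a e * (u (I.col e') / u (I.col e))| ≤ 1 / R := by
      intro e' he' hk
      have hsm : ∀ w : ℕ → ℝ, (∀ j < I.n, 0 < w j) → H ≤ w (I.col e) / w (I.col e') →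
          I.a e' / I.a e * (w (I.col e') / w (I.col e)) ≤ 1 / R := fun w hw h => by
        have h1 := hbig w hw e he e' he' h
        have e1 : I.a e' / I.a e * (w (I.col e') / w (I.col e)) =
            1 / (I.a e / I.a e' * (w (I.col e) / w (I.col e'))) := by
          have := I.a_pos e he
          have := I.a_pos e' he'
          have := hw _ (I.col_lt e he)
          have := hw _ (I.col_lt e' he')
          field_simp
        rw [e1]
        exact one_div_le_one_div_of_le hR h1
      rcases huz _ (I.col_lt e he) _ (I.col_lt e' he') with h | ⟨h1, h2⟩ | ⟨h1, h2⟩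
      · rw [h, sub_self, abs_zero]
        positivity
      · exact absurd ⟨e', he', hk, h1, h2⟩ hA
      · have a1 := hsm u hu h1
        have a2 := hsm z hz h2
        have a3 := hpos u hu e' he'
        have a4 := hpos z hz e' he'
        rw [abs_le]
        constructor <;> linarith
    rw [B_eq_div hu he, B_eq_div hz he]
    have su := hone u hu
    have sz := hone z hz
    have hdiff : |scat I.row (fun e' => I.a e' / I.a e * (z (I.col e') / z (I.col e))) I.E (I.row e)
        - scat I.row (fun e' => I.a e' / I.a e * (u (I.col e') / u (I.col e))) I.E (I.row e)| ≤
        I.n * (1 / R) := by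
      rw [← scat_sub]
      refine le_trans (abs_sum_le_sum_abs _ _) (le_trans ?_
        (scat_row_const_le (i := I.row e) (k := 1 / R) (by positivity)))
      refine sum_le_sum fun e' he' => ?_
      split_ifs with hk
      · exact hterm e' (mem_range.1 he') hk
      · simp
    set S := scat I.row (fun e' => I.a e' / I.a e * (z (I.col e') / z (I.col e))) I.E (I.row e)
    set S' := scat I.row (fun e' => I.a e' / I.a e * (u (I.col e') / u (I.col e))) I.E (I.row e)
    have e1 : I.r (I.row e) / S - I.r (I.row e) / S' = I.r (I.row e) * ((S' - S) / (S * S')) := by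
      field_simp
    rw [e1, abs_mul, abs_of_pos hr, abs_div, abs_sub_comm, abs_of_pos (by positivity : 0 < S * S')]
    refine mul_le_mul_of_nonneg_left ?_ hr.le
    calc |S - S'| / (S * S') ≤ |S - S'| := div_le_self (abs_nonneg _) (by nlinarith)
      _ ≤ _ := by rw [div_eq_mul_one_div]; exact hdiff

theorem sum_abs_B_sub_le {R H : ℝ} (hR : 0 < R) (hu : ∀ j < I.n, 0 < u j)
    (hz : ∀ j < I.n, 0 < z j) (hH : ∀ e < I.E, ∀ e' < I.E, R * (I.a e / I.a e') ≤ H)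
    (huz : ∀ j < I.n, ∀ l < I.n, z l / z j = u l / u j ∨ (H ≤ u l / u j ∧ H ≤ z l / z j) ∨
      (H ≤ u j / u l ∧ H ≤ z j / z l)) :
    ∑ e ∈ range I.E, |I.B z e - I.B u e| ≤ I.s * I.n ^ 2 / R := by
  calc ∑ e ∈ range I.E, |I.B z e - I.B u e|
      ≤ ∑ e ∈ range I.E, (I.n / R) * I.r (I.row e) := sum_le_sum fun e he => by
        rw [mul_comm]
        exact abs_B_sub_le hR hu hz hH huz (mem_range.1 he)
    _ = ∑ i ∈ range I.m, scat I.row (fun _ => (I.n : ℝ) / R) I.E i * I.r i :=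
        (sum_scat_mul I.r I.row_lt).symm
    _ ≤ ∑ i ∈ range I.m, (I.n * (I.n / R)) * I.r i := sum_le_sum fun i hi =>
        mul_le_mul_of_nonneg_right (scat_row_const_le (by positivity))
          (I.r_pos i (mem_range.1 hi)).le
    _ = I.s * I.n ^ 2 / R := by
        rw [← mul_sum, I.sum_r]
        ring

/-- A relative change δ of y changes each row sum by a relative amount of at most δ as well. With δ
≤ 1/2 the new row sum is at least half the old one, which yields the factor 4. -/
theorem sum_abs_B_sub_le_of_close {δ : ℝ} (hδ : 0 ≤ δ) (hδ' : δ ≤ 1 / 2) (hz : ∀ j < I.n, 0 < z j)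
    (hy : ∀ j < I.n, 0 < y j) (hyz : ∀ j < I.n, |y j - z j| ≤ δ * z j) :
    ∑ e ∈ range I.E, |I.B y e - I.B z e| ≤ 4 * δ * I.s := by
  have hD : ∀ i < I.m, |I.D y i - I.D z i| ≤ δ * I.D z i := by
    intro i hi
    rw [D, D, ← scat_sub, ← scat_const_mul]
    refine (abs_sum_le_sum_abs _ _).trans (sum_le_sum fun e he => ?_)
    have he := mem_range.1 he
    split_ifs
    · change |I.a e * y (I.col e) - I.a e * z (I.col e)| ≤ δ * (I.a e * z (I.col e))
      rw [← mul_sub, abs_mul, abs_of_pos (I.a_pos e he)]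
      have := mul_le_mul_of_nonneg_left (hyz _ (I.col_lt e he)) (I.a_pos e he).le
      linarith
    · simp
  rw [← sum_B hz, mul_sum]
  refine sum_le_sum fun e he => ?_
  have he := mem_range.1 he
  have hi := I.row_lt e he
  have h1 := abs_le.1 (hD _ hi)
  have h2 := abs_le.1 (hyz _ (I.col_lt e he))
  have p1 := D_pos hz hi
  have p2 := D_pos hy hi
  have p3 := hz _ (I.col_lt e he)
  have p4 := I.a_pos e he
  have p5 := I.r_pos _ hi
  rw [B, B, x, x]
  set D' := I.D y (I.row e)
  set D := I.D z (I.row e)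
  set y' := y (I.col e)
  set z' := z (I.col e)
  have e1 : I.a e * y' * (I.r (I.row e) / D') - I.a e * z' * (I.r (I.row e) / D) =
      (I.a e * I.r (I.row e) / (D * D')) * (y' * D - z' * D') := by
    field_simp
  have e2 : 4 * δ * (I.a e * z' * (I.r (I.row e) / D)) =
      (I.a e * I.r (I.row e) / (D * D')) * (4 * δ * z' * D') := by
    field_simp
  rw [e1, e2, abs_mul, abs_of_pos (by positivity)]
  refine mul_le_mul_of_nonneg_left ?_ (by positivity)
  have h3 : D / 2 ≤ D' := by nlinarith
  have h4 : δ * z' * D ≤ δ * z' * (2 * D') := mul_le_mul_of_nonneg_left (by linarith)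
    (by positivity)
  rw [abs_le]
  constructor
  · nlinarith [mul_le_mul_of_nonneg_right h2.1 p1.le, mul_le_mul_of_nonneg_left h1.2 p3.le]
  · nlinarith [mul_le_mul_of_nonneg_right h2.2 p1.le, mul_le_mul_of_nonneg_left h1.1 p3.le]

/-- The decrease of the potential in one step. -/
theorem Φ_step {ε R H G : ℝ} {p : ℕ} (hR : R = 2 ^ p) (hn : 2 ≤ I.n) (hy : ∀ j < I.n, 0 < y j)
    (hu : ∀ j < I.n, 0 < u j) (hz : ∀ j < I.n, 1 ≤ z j) (hΦ : ε ^ 2 < I.Φ y)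
    (hε : 128 * I.s ^ 2 * I.n ^ 5 ≤ R * ε ^ 2) (hG : I.Φ y ≤ I.n ^ 3 * G ^ 2)
    (hup : I.Φ u ≤ I.Φ y - 3 / 32 * G ^ 2)
    (hH : ∀ e < I.E, ∀ e' < I.E, R * (I.a e / I.a e') ≤ H)
    (huz : ∀ j < I.n, ∀ l < I.n, z l / z j = u l / u j ∨ (H ≤ u l / u j ∧ H ≤ z l / z j) ∨
      (H ≤ u j / u l ∧ H ≤ z j / z l)) :
    I.Φ (fun j => roundTo (z j) p) ≤ I.Φ y * (1 - 1 / (16 * I.n ^ 3)) ∧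
      ∀ j < I.n, 1 ≤ roundTo (z j) p ∧ roundTo (z j) p ≤ z j + 1 := by
  have hR0 : 0 < R := by rw [hR]; positivity
  have hR1 : 1 ≤ R := by rw [hR]; exact one_le_pow₀ (by norm_num)
  have hround : ∀ x, |roundTo x p - x| ≤ 1 / (2 * R) := fun x => by
    have h := abs_sub_round (x * 2 ^ p)
    have e1 : roundTo x p - x = -((x * 2 ^ p - round (x * 2 ^ p)) / 2 ^ p) := by
      rw [roundTo]
      field_simp
      ring
    rw [e1, abs_neg, abs_div, ← hR, abs_of_pos hR0, div_le_div_iff₀ hR0 (by positivity)]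
    rw [← hR] at h
    nlinarith
  -- Rounding is monotone and fixes 1, which is a multiple of 2^(-p).
  have hr1 : ∀ j < I.n, 1 ≤ roundTo (z j) p := fun j hj => by
    have h : (2 : ℝ) ^ p ≤ z j * 2 ^ p := le_mul_of_one_le_left (by positivity) (hz j hj)
    have h2 : (2 : ℤ) ^ p ≤ round (z j * 2 ^ p) := by
      have : round ((2 : ℝ) ^ p) ≤ round (z j * 2 ^ p) := by
        rw [round_eq, round_eq]
        exact Int.floor_le_floor (by linarith)
      have e2 : round ((2 : ℝ) ^ p) = (2 : ℤ) ^ p := by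
        have := round_intCast (α := ℝ) ((2 : ℤ) ^ p)
        push_cast at this
        exact this
      rwa [e2] at this
    rw [roundTo, le_div_iff₀ (by positivity), one_mul]
    exact_mod_cast h2
  have hz0 : ∀ j < I.n, 0 < z j := fun j hj => zero_lt_one.trans_le (hz j hj)
  refine ⟨?_, fun j hj => ⟨hr1 j hj, ?_⟩⟩
  swap
  · have h1 := (abs_le.1 (hround (z j))).2
    have : 1 / (2 * R) ≤ 1 := by
      rw [div_le_one (by positivity)]
      linarith
    linarith
  have hδ : ∀ j < I.n, |roundTo (z j) p - z j| ≤ 1 / (2 * R) * z j := fun j hj =>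
    (hround _).trans (le_mul_of_one_le_right (by positivity) (hz j hj))
  have h1 := sum_abs_B_sub_le_of_close (δ := 1 / (2 * R)) (by positivity)
    (by rw [div_le_div_iff₀ (by positivity) (by norm_num)]; linarith) hz0
    (fun j hj => zero_lt_one.trans_le (hr1 j hj)) hδ
  have h2 := sum_abs_B_sub_le hR0 hu hz0 hH huz
  have a1 := (abs_le.1 (Φ_sub_le hz0 (fun j hj => zero_lt_one.trans_le (hr1 j hj)))).2
  have a2 := (abs_le.1 (Φ_sub_le hu hz0)).2
  have hs := s_nonneg hy
  have hn' : (2 : ℝ) ≤ I.n := by exact_mod_cast hn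
  have b1 := mul_le_mul_of_nonneg_left h1 (show 0 ≤ 2 * I.s by positivity)
  have b2 := mul_le_mul_of_nonneg_left h2 (show 0 ≤ 2 * I.s by positivity)
  -- The first term is the cost of rounding, the second that of capping. As 2 + n² ≤ 2 n² for n ≥ 2,
  -- they sum to at most 4 s² n² / R, and 4 · 32 = 128 is the constant in the required precision.
  have b3 : 2 * I.s * (4 * (1 / (2 * R)) * I.s) + 2 * I.s * (I.s * I.n ^ 2 / R) ≤
      ε ^ 2 / (32 * I.n ^ 3) := by
    have e1 : 2 * I.s * (4 * (1 / (2 * R)) * I.s) + 2 * I.s * (I.s * I.n ^ 2 / R) =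
        2 * I.s ^ 2 * (2 + I.n ^ 2) / R := by
      field_simp
      ring
    rw [e1, div_le_div_iff₀ hR0 (by positivity)]
    have : 2 * I.s ^ 2 * (2 + (I.n : ℝ) ^ 2) ≤ 2 * I.s ^ 2 * (2 * I.n ^ 2) :=
      mul_le_mul_of_nonneg_left (by nlinarith) (by positivity)
    have := mul_le_mul_of_nonneg_right this (show (0 : ℝ) ≤ 32 * I.n ^ 3 by positivity)
    nlinarith
  have b4 : I.Φ y / I.n ^ 3 ≤ G ^ 2 := by
    rw [div_le_iff₀ (by positivity)]
    linarith
  have b5 : ε ^ 2 / (32 * I.n ^ 3) ≤ I.Φ y / (32 * I.n ^ 3) := by gcongr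
  -- The gain 3/32 minus the loss 1/32 leaves 1/16.
  have e2 : I.Φ y * (1 - 1 / (16 * I.n ^ 3)) =
      I.Φ y - 3 / 32 * (I.Φ y / I.n ^ 3) + I.Φ y / (32 * I.n ^ 3) := by
    field_simp
    ring
  rw [e2]
  linarith

/-- Averaging d_j - d_l over all l gives d_j itself, because the errors sum to zero. Thus a bound n
G on the spread bounds every single error. -/
theorem Φ_le_of_gap (hy : ∀ j < I.n, 0 < y j) {G : ℝ}
    (h : ∀ j < I.n, ∀ l < I.n, I.d y j - I.d y l ≤ I.n * G) : I.Φ y ≤ I.n ^ 3 * G ^ 2 := by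
  have h1 : ∀ j < I.n, |I.d y j| ≤ I.n * G := by
    intro j hj
    have hn : (0 : ℝ) < I.n := by
      exact_mod_cast (by omega : 0 < I.n)
    have h2 : I.n * I.d y j ≤ I.n * (I.n * G) := by
      have : ∑ l ∈ range I.n, (I.d y j - I.d y l) ≤ ∑ l ∈ range I.n, (I.n * G) :=
        sum_le_sum fun l hl => h j hj l (mem_range.1 hl)
      simpa [sum_sub_distrib, sum_d hy] using this
    have h3 : I.n * -I.d y j ≤ I.n * (I.n * G) := by
      have : ∑ l ∈ range I.n, (I.d y l - I.d y j) ≤ ∑ l ∈ range I.n, (I.n * G) :=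
        sum_le_sum fun l hl => h l (mem_range.1 hl) j hj
      simpa [sum_sub_distrib, sum_d hy] using this
    have h2 := le_of_mul_le_mul_left h2 hn
    have h3 := le_of_mul_le_mul_left h3 hn
    rw [abs_le]
    constructor <;> linarith
  have : I.Φ y ≤ ∑ j ∈ range I.n, (I.n * G) ^ 2 := sum_le_sum fun j hj => by
    have := h1 j (mem_range.1 hj)
    rw [← sq, ← sq_abs]
    exact pow_le_pow_left₀ (abs_nonneg _) this 2
  rw [sum_const, card_range, nsmul_eq_mul] at this
  calc _ ≤ _ := this
    _ = _ := by ring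

end Inst

/-! ### Capping consecutive ratios, and the count of iterations -/

/-- The capped scalings in increasing order. -/
noncomputable def capped (w : ℕ → ℝ) (H : ℝ) : ℕ → ℝ
  | 0 => 1
  | k + 1 => capped w H k * min (w (k + 1) / w k) H

/-- In sorted order all consecutive ratios are at least 1. If no factor between l and k is cut, the
ratio is preserved; one cut factor already makes both ratios at least H. -/
theorem capped_spec {w : ℕ → ℝ} {H : ℝ} {n : ℕ} (hH : 1 ≤ H) (hw : ∀ k < n, 0 < w k)
    (hs : ∀ k, k + 1 < n → w k ≤ w (k + 1)) {k : ℕ} (hk : k < n) :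
    (1 ≤ capped w H k ∧ capped w H k ≤ H ^ k) ∧ ∀ l ≤ k,
      (1 ≤ capped w H k / capped w H l ∧ 1 ≤ w k / w l) ∧
      (capped w H k / capped w H l = w k / w l ∨
        (H ≤ w k / w l ∧ H ≤ capped w H k / capped w H l)) := by
  induction k with
  | zero =>
    refine ⟨by simp [capped], fun l hl => ?_⟩
    obtain rfl : l = 0 := by omega
    have := (hw 0 hk).ne'
    simp [capped, this]
  | succ k ih =>
    obtain ⟨⟨h1, h2⟩, h3⟩ := ih (by omega)
    have p1 := hw k (by omega)
    have p2 := hw (k + 1) hk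
    have hr : 1 ≤ w (k + 1) / w k := by
      rw [le_div_iff₀ p1, one_mul]
      exact hs k hk
    have hm : 1 ≤ min (w (k + 1) / w k) H := le_min hr hH
    refine ⟨⟨?_, ?_⟩, fun l hl => ?_⟩
    · rw [capped]
      nlinarith
    · rw [capped, pow_succ]
      exact mul_le_mul h2 (min_le_right _ _) (by linarith) (by positivity)
    · rcases Nat.lt_or_ge l (k + 1) with hl' | hl'
      · obtain ⟨⟨g1, g2⟩, g3⟩ := h3 l (by omega)
        have e1 : capped w H (k + 1) / capped w H l =
            capped w H k / capped w H l * min (w (k + 1) / w k) H := by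
          rw [capped]; ring
        have e2 : w (k + 1) / w l = w k / w l * (w (k + 1) / w k) := by
          field_simp
        rw [e1, e2]
        refine ⟨⟨one_le_mul_of_one_le_of_one_le g1 hm, one_le_mul_of_one_le_of_one_le g2 hr⟩, ?_⟩
        rcases g3 with g3 | ⟨g3, g4⟩
        · rcases le_total (w (k + 1) / w k) H with h | h
          · left
            rw [min_eq_left h, g3]
          · right
            rw [min_eq_right h]
            constructor <;> nlinarith
        · right
          constructor <;> nlinarith
      · obtain rfl : l = k + 1 := by omega
        have q : 0 < capped w H (k + 1) := by
          rw [capped]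
          have : 0 < capped w H k := by linarith
          positivity
        rw [div_self q.ne', div_self p2.ne']
        simp

/-- The number of iterations. -/
theorem iteration_bound {n u v : ℕ} {s ε : ℝ} (hn : 2 ≤ n) (hs : 0 ≤ s) (hε : 0 < ε)
    (hu : u = 0 ∨ 2 ^ (u - 1) * ε ^ 2 < 128 * s ^ 2 * n ^ 5)
    (hv : ε ^ 2 < 2 * s ^ 2 * (1 - 1 / (16 * n ^ 3)) ^ v) :
    (u + v + 1 : ℝ) ≤ 72 * (n ^ 3 * Real.posLog (s * n / ε)) := by
  have hn' : (2 : ℝ) ≤ n := by exact_mod_cast hn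
  have hn8 : (8 : ℝ) ≤ n ^ 3 := by
    have := pow_le_pow_left₀ (by norm_num) hn' 3
    linarith
  have hθ0 : 0 ≤ 1 - 1 / (16 * (n : ℝ) ^ 3) := by
    rw [sub_nonneg, div_le_one (by positivity)]
    linarith
  have hθ1 : (1 - 1 / (16 * (n : ℝ) ^ 3)) ^ v ≤ 1 := pow_le_one₀ hθ0 (by
    rw [sub_le_self_iff]; positivity)
  have h2 : ε ^ 2 < 2 * s ^ 2 := by nlinarith [sq_nonneg s]
  have hs0 : 0 < s := by
    rcases hs.eq_or_lt with rfl | h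
    · nlinarith
    · exact h
  set L := Real.log (s * n / ε) with hL
  have l2 := Real.log_two_gt_d9
  have l2' := Real.log_two_lt_d9
  have hLe : L = Real.log (s / ε) + Real.log n := by
    rw [hL, ← Real.log_mul (by positivity) (by positivity)]
    congr 1
    ring
  -- The quotient s / ε may be below 1, but a potential still above ε² forces (s / ε)² > 1/2. With n
  -- ≥ 2 this gives L > (log 2) / 2, so the positive part of the logarithm is L itself, and additive
  -- constants can be absorbed into multiples of L.
  have hlog : -Real.log 2 < 2 * Real.log (s / ε) := by
    have : (1 : ℝ) / 2 < (s / ε) ^ 2 := by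
      rw [div_pow, div_lt_div_iff₀ (by norm_num) (by positivity)]
      linarith
    have := Real.log_lt_log (by norm_num) this
    rw [Real.log_pow, one_div, Real.log_inv] at this
    exact_mod_cast this
  have hlogn : Real.log 2 ≤ Real.log n := Real.log_le_log (by norm_num) hn'
  have hLpos : 0 < L := by linarith
  have hpos : Real.posLog (s * n / ε) = L := by
    rw [Real.posLog, max_eq_right hLpos.le]
  rw [hpos]
  -- Here `u` counts the increases of the precision. The last of them was made while the precision
  -- was still insufficient.
  have hu' : (u : ℝ) ≤ 72 * L := by
    rcases hu with rfl | hu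
    · simp; positivity
    rcases Nat.eq_zero_or_pos u with rfl | hu0
    · simp; positivity
    have h3 : (2 : ℝ) ^ (u - 1) < 128 * n ^ 5 * (s / ε) ^ 2 := by
      rw [div_pow, mul_div_assoc', lt_div_iff₀ (by positivity)]
      linarith
    have h4 := Real.log_lt_log (by positivity) h3
    rw [Real.log_pow, Real.log_mul (by positivity) (by positivity),
      Real.log_mul (by positivity) (by positivity), Real.log_pow, Real.log_pow,
      show (128 : ℝ) = 2 ^ 7 by norm_num, Real.log_pow, Nat.cast_sub hu0] at h4
    push_cast at h4
    nlinarith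
  -- Here `v` counts the steps. The potential decays like exp(-v / (16 n³)) from 2 s² and has not
  -- fallen to ε².
  have hv' : (v : ℝ) ≤ 32 * (n ^ 3 * L) := by
    have h3 : (1 - 1 / (16 * (n : ℝ) ^ 3)) ^ v ≤ Real.exp (-(v / (16 * n ^ 3))) := by
      rw [show -((v : ℝ) / (16 * n ^ 3)) = v * (-(1 / (16 * n ^ 3))) by ring, Real.exp_nat_mul]
      refine pow_le_pow_left₀ hθ0 ?_ v
      have := Real.add_one_le_exp (-(1 / (16 * (n : ℝ) ^ 3)))
      linarith
    have h4 : ε ^ 2 < 2 * s ^ 2 * Real.exp (-(v / (16 * n ^ 3))) :=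
      hv.trans_le (mul_le_mul_of_nonneg_left h3 (by positivity))
    have h5 : Real.exp (v / (16 * n ^ 3)) < 2 * (s / ε) ^ 2 := by
      rw [Real.exp_neg, ← div_eq_mul_inv, lt_div_iff₀ (Real.exp_pos _)] at h4
      rw [div_pow, mul_div_assoc', lt_div_iff₀ (by positivity)]
      linarith
    have h6 := Real.log_lt_log (Real.exp_pos _) h5
    rw [Real.log_exp, Real.log_mul (by norm_num) (by positivity), Real.log_pow] at h6
    have h7 : (v : ℝ) / (16 * n ^ 3) ≤ 2 * L := by
      push_cast at h6
      linarith
    rw [div_le_iff₀ (by positivity)] at h7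
    linarith
  -- As n³ ≥ 8, the 72 L increases of the precision cost only 9 n³ L. The total 9 + 32, and the `+
  -- 1` absorbed by 3 L, stay below 72.
  have h8 : 8 * L ≤ n ^ 3 * L := mul_le_mul_of_nonneg_right hn8 hLpos.le
  have h9 : 1 ≤ 3 * L := by linarith
  linarith

theorem Runs.seq' {P P' : Program} {σ : State} {N M : ℕ} {Mid Q : State → Prop}
    (h : Runs P σ N Mid) (h' : ∀ σ₁, Frame P σ σ₁ → Mid σ₁ → Runs P' σ₁ M Q) :
    Runs (.seq P P') σ (N + M) Q :=
  Runs.seq (h.mono le_rfl fun σ₁ _ hm hF => h' σ₁ hF hm)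

theorem Runs.ite' {b : Test} {P P' : Program} {σ : State} {N M : ℕ} {Q : State → Prop}
    (h₁ : b.Holds σ → Runs P σ N Q) (h₂ : ¬ b.Holds σ → Runs P' σ M Q) :
    Runs (.ite b P P') σ (N + M + 1) Q :=
  Runs.ite (fun h => (h₁ h).mono (by omega) fun _ _ h => h)
    fun h => (h₂ h).mono (by omega) fun _ _ h => h

theorem Runs.le {P : Program} {σ : State} {N N' : ℕ} {Q : State → Prop} (h : Runs P σ N Q)
    (hN : N ≤ N') : Runs P σ N' Q := h.mono hN fun _ _ h => h

theorem State.setNat_nat (σ : State) (a k x b : ℕ) :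
    (σ.setNat a k x).nat b = if b = a then Function.update (σ.nat b) k x else σ.nat b := by
  by_cases hb : b = a
  · subst hb
    simp [State.setNat]
  · simp [State.setNat, hb]

/-! ### Merge sort -/

/-- The next block pair: set the pointers of the merge. -/
def mergeReset (Nr : ℕ) : Program :=
  .seq (block [.nset 26 (.reg 25), .nadd 27 (.reg 26) (.reg 24)])
  (.seq (.ite (.nlt (.reg Nr) (.reg 27)) (block [.nset 27 (.reg Nr)]) .skip)
  (.seq (block [.nset 28 (.reg 27), .nadd 29 (.reg 28) (.reg 24)])
    (.ite (.nlt (.reg Nr) (.reg 29)) (block [.nset 29 (.reg Nr)]) .skip)))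

/-- Decide from which side to take: register `32` is `1` for the left side. -/
def mergeSide (key : ℕ) : Program :=
  .seq (block [.nset 32 (.lit 0)])
  (.ite (.nlt (.reg 26) (.reg 27))
    (.ite (.nlt (.reg 28) (.reg 29))
      (.seq (block [.nload 30 22 (.reg 26), .nload 31 22 (.reg 28)])
        (.ite (.rle ⟨key, .reg 30⟩ ⟨key, .reg 31⟩) (block [.nset 32 (.lit 1)]) .skip))
      (block [.nset 32 (.lit 1)]))
    .skip)

/-- Move one index. -/
def mergeMove : Program :=
  .ite (.nlt (.lit 0) (.reg 32))
    (block [.nload 30 22 (.reg 26), .nadd 26 (.reg 26) (.lit 1), .nstore 23 (.reg 25) (.reg 30)])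
    (block [.nload 30 22 (.reg 28), .nadd 28 (.reg 28) (.lit 1), .nstore 23 (.reg 25) (.reg 30)])

/-- Produce the next entry of the merged list. -/
def mergeStep (key Nr : ℕ) : Program :=
  .seq (.ite (.nle (.reg 29) (.reg 25)) (mergeReset Nr) .skip)
  (.seq (mergeSide key) mergeMove)

/-- Merge all neighbouring pairs of blocks of the current width. -/
def mergePass (key Nr : ℕ) : Program :=
  .seq (block [.nset 26 (.lit 0), .nset 27 (.lit 0), .nset 28 (.lit 0), .nset 29 (.lit 0)])
  (.seq (forLoop 25 Nr (mergeStep key Nr))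
  (.seq (forLoop 25 Nr (block [.nload 30 23 (.reg 25), .nstore 22 (.reg 25) (.reg 30)]))
    (block [.nadd 24 (.reg 24) (.reg 24)])))

/-- Sort the indices below the value of the register `Nr` by the real array `key`; the result is in
the index array `22`. -/
def sortIdx (key Nr : ℕ) : Program :=
  .seq (forLoop 25 Nr (block [.nstore 22 (.reg 25) (.reg 25)]))
  (.seq (block [.nset 24 (.lit 1)])
    (.while (.nlt (.reg 24) (.reg Nr)) (mergePass key Nr)))

/-- The invariant of merging: `inn` is the given list, `out` the output produced so far. -/
def MergeInv (K : ℕ → ℝ) (inn : ℕ → ℕ) (N w k i ie j je : ℕ) (out : ℕ → ℕ) : Prop :=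
  ∃ s, 2 * w ∣ s ∧ s ≤ i ∧ i ≤ ie ∧ ie ≤ j ∧ j ≤ je ∧ je ≤ N ∧ je ≤ s + 2 * w ∧ k + ie = i + j ∧
    (je = N ∨ 2 * w ∣ je) ∧
    (∀ a b, s ≤ a → a ≤ b → b < ie → K (inn a) ≤ K (inn b)) ∧
    (∀ a b, ie ≤ a → a ≤ b → b < je → K (inn a) ≤ K (inn b)) ∧
    (∀ q q', q ≤ q' → q' < k → q / (2 * w) = q' / (2 * w) → K (out q) ≤ K (out q')) ∧
    (∀ q, s ≤ q → q < k → (∀ a, i ≤ a → a < ie → K (out q) ≤ K (inn a)) ∧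
      ∀ b, j ≤ b → b < je → K (out q) ≤ K (inn b)) ∧
    (∀ p, p < i ∨ (ie ≤ p ∧ p < j) → ∃ q < k, out q = inn p) ∧ ∀ q < k, out q < N

section merge

variable {K : ℕ → ℝ} {inn out : ℕ → ℕ} {N w k i ie j je : ℕ}

/-- All pointers at 0 describe an exhausted pair of blocks, so the first step performs a reset. -/
theorem MergeInv.init : MergeInv K inn N w 0 0 0 0 0 out :=
  ⟨0, by simp, le_rfl, le_rfl, le_rfl, le_rfl, by simp, by simp, rfl, by simp, by omega, by omega,
    by omega, by omega, by omega, by omega⟩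

theorem MergeInv.k_le (h : MergeInv K inn N w k i ie j je out) : k ≤ je := by
  obtain ⟨s, -, h1, h2, h3, h4, h5, h6, h7, -⟩ := h
  omega

/-- A pair is exhausted when `je ≤ k`. Since k < N, the end `je` is then a multiple of 2 w, so `k`
starts a new pair. The minima with N cut the last, possibly incomplete, blocks. -/
theorem MergeInv.reset (hw : 0 < w)
    (hs : ∀ a b, a ≤ b → b < N → a / w = b / w → K (inn a) ≤ K (inn b))
    (h : MergeInv K inn N w k i ie j je out) (hk : je ≤ k) (hkN : k < N) :
    MergeInv K inn N w k k (min (k + w) N) (min (k + w) N) (min (min (k + w) N + w) N) out := by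
  have hkje := h.k_le
  obtain ⟨s, h0, h1, h2, h3, h4, h5, h6, h7, h8, h9, h10, h11, h12, h13, h14⟩ := h
  have hdk : 2 * w ∣ k := by
    rcases h8 with h8 | h8
    · omega
    · rwa [show k = je by omega]
  have hwk : w ∣ k := (Dvd.intro_left 2 rfl).trans hdk
  obtain ⟨t, rfl⟩ := hwk
  refine ⟨w * t, hdk, le_rfl, by omega, le_rfl, by omega, by omega, by omega, by omega, ?_, ?_, ?_,
    h11, fun q h1 h2 => by omega, ?_, h14⟩
  · rcases Nat.lt_or_ge (w * t + 2 * w) N with h | h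
    · right
      rw [show min (min (w * t + w) N + w) N = w * t + 2 * w by omega]
      exact (Nat.dvd_add_right hdk).2 (dvd_refl _)
    · left; omega
  · intro a b ha hab hb
    refine hs a b hab (by omega) ?_
    rw [Nat.div_eq_of_lt_le (m := a) (k := t) (by rw [mul_comm]; omega)
      (by rw [add_mul, mul_comm t]; omega),
      Nat.div_eq_of_lt_le (m := b) (k := t) (by rw [mul_comm]; omega)
      (by rw [add_mul, mul_comm t]; omega)]
  · intro a b ha hab hb
    have : min (w * t + w) N = w * t + w := by omega
    refine hs a b hab (by omega) ?_
    rw [Nat.div_eq_of_lt_le (m := a) (k := t + 1) (by rw [add_mul, mul_comm t]; omega)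
      (by rw [add_mul, add_mul, mul_comm t]; omega),
      Nat.div_eq_of_lt_le (m := b) (k := t + 1) (by rw [add_mul, mul_comm t]; omega)
      (by rw [add_mul, add_mul, mul_comm t]; omega)]
  · intro p hp
    exact h13 p (by omega)

/-- The multiple s of 2 w is at most k, so no position in the output block of k precedes s. This
makes the comparison of past outputs with the remaining inputs applicable to the whole block. -/
theorem MergeInv.block_start {s q : ℕ} (hw : 0 < w) (h0 : 2 * w ∣ s) (hsk : s ≤ k)
    (h : q / (2 * w) = k / (2 * w)) : s ≤ q := by
  obtain ⟨t, rfl⟩ := h0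
  have h1 : t ≤ k / (2 * w) := by
    rw [Nat.le_div_iff_mul_le (by omega)]
    linarith
  rw [← h, Nat.le_div_iff_mul_le (by omega)] at h1
  linarith

theorem MergeInv.left (hw : 0 < w) (hin : ∀ p < N, inn p < N)
    (h : MergeInv K inn N w k i ie j je out) (hi : i < ie)
    (hK : j < je → K (inn i) ≤ K (inn j)) :
    MergeInv K inn N w (k + 1) (i + 1) ie j je (Function.update out k (inn i)) := by
  obtain ⟨s, h0, h1, h2, h3, h4, h5, h6, h7, h8, h9, h10, h11, h12, h13, h14⟩ := h
  have hne : ∀ q, q < k → Function.update out k (inn i) q = out q := fun q hq =>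
    Function.update_of_ne hq.ne _ _
  have hself : Function.update out k (inn i) k = inn i := Function.update_self _ _ _
  refine ⟨s, h0, by omega, by omega, h3, h4, h5, h6, by omega, h8, h9, h10, ?_, ?_, ?_, ?_⟩
  · intro q q' hqq hq' hd
    rcases Nat.lt_or_ge q' k with hlt | hge
    · rw [hne q (by omega), hne q' hlt]
      exact h11 q q' hqq hlt hd
    · obtain rfl : q' = k := by omega
      rw [hself]
      rcases Nat.lt_or_ge q q' with hlt | hge
      · rw [hne q hlt]
        exact (h12 q (MergeInv.block_start hw h0 (by omega) hd) hlt).1 i le_rfl hi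
      · obtain rfl : q = q' := by omega
        rw [hself]
  · intro q hq hqk
    rcases Nat.lt_or_ge q k with hlt | hge
    · rw [hne q hlt]
      exact ⟨fun a ha ha' => (h12 q hq hlt).1 a (by omega) ha', (h12 q hq hlt).2⟩
    · obtain rfl : q = k := by omega
      rw [hself]
      exact ⟨fun a ha ha' => h9 i a h1 (by omega) ha', fun b hb hb' =>
        (hK (by omega)).trans (h10 j b h3 hb hb')⟩
  · intro p hp
    by_cases hpi : p = i
    · exact ⟨k, by omega, by rw [hself, hpi]⟩
    · obtain ⟨q, hq, he⟩ := h13 p (by omega)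
      exact ⟨q, by omega, by rw [hne q hq, he]⟩
  · intro q hq
    rcases Nat.lt_or_ge q k with hlt | hge
    · rw [hne q hlt]
      exact h14 q hlt
    · obtain rfl : q = k := by omega
      rw [hself]
      exact hin i (by omega)

theorem MergeInv.right (hw : 0 < w) (hin : ∀ p < N, inn p < N)
    (h : MergeInv K inn N w k i ie j je out) (hj : j < je)
    (hK : i < ie → K (inn j) ≤ K (inn i)) :
    MergeInv K inn N w (k + 1) i ie (j + 1) je (Function.update out k (inn j)) := by
  obtain ⟨s, h0, h1, h2, h3, h4, h5, h6, h7, h8, h9, h10, h11, h12, h13, h14⟩ := h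
  have hne : ∀ q, q < k → Function.update out k (inn j) q = out q := fun q hq =>
    Function.update_of_ne hq.ne _ _
  have hself : Function.update out k (inn j) k = inn j := Function.update_self _ _ _
  refine ⟨s, h0, by omega, by omega, by omega, by omega, h5, h6, by omega, h8, h9, h10,
    ?_, ?_, ?_, ?_⟩
  · intro q q' hqq hq' hd
    rcases Nat.lt_or_ge q' k with hlt | hge
    · rw [hne q (by omega), hne q' hlt]
      exact h11 q q' hqq hlt hd
    · obtain rfl : q' = k := by omega
      rw [hself]
      rcases Nat.lt_or_ge q q' with hlt | hge
      · rw [hne q hlt]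
        exact (h12 q (MergeInv.block_start hw h0 (by omega) hd) hlt).2 j le_rfl hj
      · obtain rfl : q = q' := by omega
        rw [hself]
  · intro q hq hqk
    rcases Nat.lt_or_ge q k with hlt | hge
    · rw [hne q hlt]
      exact ⟨(h12 q hq hlt).1, fun b hb hb' => (h12 q hq hlt).2 b (by omega) hb'⟩
    · obtain rfl : q = k := by omega
      rw [hself]
      exact ⟨fun a ha ha' => (hK (by omega)).trans (h9 i a h1 ha ha'), fun b hb hb' =>
        h10 j b h3 (by omega) hb'⟩
  · intro p hp
    by_cases hpi : p = j
    · exact ⟨k, by omega, by rw [hself, hpi]⟩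
    · obtain ⟨q, hq, he⟩ := h13 p (by omega)
      exact ⟨q, by omega, by rw [hne q hq, he]⟩
  · intro q hq
    rcases Nat.lt_or_ge q k with hlt | hge
    · rw [hne q hlt]
      exact h14 q hlt
    · obtain rfl : q = k := by omega
      rw [hself]
      exact hin j (by omega)

end merge

/-- The list `idx` contains all indices below `N`, sorted in blocks of width `w`. -/
def BlockSorted (K : ℕ → ℝ) (N w : ℕ) (idx : ℕ → ℕ) : Prop :=
  (∀ p < N, idx p < N) ∧ (∀ i < N, ∃ p < N, idx p = i) ∧
    ∀ a b, a ≤ b → b < N → a / w = b / w → K (idx a) ≤ K (idx b)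

/-- At k = N the relation `k + ie = i + j` forces both sides to be used up, so every input occurs in
the output. Surjectivity is all that is recorded of the permutation; injectivity follows by
counting. -/
theorem MergeInv.blockSorted {K : ℕ → ℝ} {inn out : ℕ → ℕ} {N w i ie j je : ℕ}
    (hb : BlockSorted K N w inn) (h : MergeInv K inn N w N i ie j je out) :
    BlockSorted K N (2 * w) out := by
  have hk := h.k_le
  obtain ⟨s, h0, h1, h2, h3, h4, h5, h6, h7, h8, h9, h10, h11, h12, h13, h14⟩ := h
  refine ⟨h14, fun a ha => ?_, fun a b hab hb' hd => h11 a b hab hb' hd⟩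
  obtain ⟨p, hp, rfl⟩ := hb.2.1 a ha
  exact h13 p (by omega)

section sort

variable {σ : State} {key Nr N w : ℕ} {inn : ℕ → ℕ}

theorem runs_mergeReset (hNr : σ.nat Nr 0 = N) (hw : σ.nat 24 0 = w) (h40 : Nr < 20) :
    Runs (mergeReset Nr) σ 8 fun τ => τ.nat 26 0 = σ.nat 25 0 ∧
      τ.nat 27 0 = min (σ.nat 25 0 + w) N ∧ τ.nat 28 0 = min (σ.nat 25 0 + w) N ∧
      τ.nat 29 0 = min (min (σ.nat 25 0 + w) N + w) N := by
  have n26 : Nr ≠ 26 := by omega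
  have n27 : Nr ≠ 27 := by omega
  have n28 : Nr ≠ 28 := by omega
  have n29 : Nr ≠ 29 := by omega
  refine (Runs.seq' (Mid := fun τ => τ.nat 26 0 = σ.nat 25 0 ∧ τ.nat 27 0 = σ.nat 25 0 + w ∧
    τ.nat 24 0 = w ∧ τ.nat Nr 0 = N) (Runs.block ?_) fun τ _ h1 =>
    Runs.seq' (Mid := fun τ => τ.nat 26 0 = σ.nat 25 0 ∧ τ.nat 27 0 = min (σ.nat 25 0 + w) N ∧
      τ.nat 24 0 = w ∧ τ.nat Nr 0 = N) (Runs.ite' (fun h => Runs.block ?_) fun h => Runs.skip ?_)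
      fun τ _ h2 => Runs.seq' (Mid := fun τ => τ.nat 26 0 = σ.nat 25 0 ∧
        τ.nat 27 0 = min (σ.nat 25 0 + w) N ∧ τ.nat 28 0 = min (σ.nat 25 0 + w) N ∧
        τ.nat 29 0 = min (σ.nat 25 0 + w) N + w ∧ τ.nat Nr 0 = N) (Runs.block ?_)
      fun τ _ h3 => Runs.ite' (fun h => Runs.block ?_) fun h => Runs.skip ?_).le (by simp)
  · simp [wp, Instr.Defined, Instr.step, n26, n27, hNr, hw]
  · obtain ⟨a1, a2, a3, a4⟩ := h1
    simp only [Test.Holds, Ix.eval_reg, a4, a2] at h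
    simp [wp, Instr.Defined, Instr.step, n27, a1, a3, a4]
    omega
  · obtain ⟨a1, a2, a3, a4⟩ := h1
    simp only [Test.Holds, Ix.eval_reg, a4, a2] at h
    refine ⟨a1, ?_, a3, a4⟩
    omega
  · obtain ⟨a1, a2, a3, a4⟩ := h2
    simp [wp, Instr.Defined, Instr.step, n28, n29, a1, a2, a3, a4]
  · obtain ⟨a1, a2, a3, a4, a5⟩ := h3
    simp only [Test.Holds, Ix.eval_reg, a4, a5] at h
    simp [wp, Instr.Defined, Instr.step, a1, a2, a3, a5]
    omega
  · obtain ⟨a1, a2, a3, a4, a5⟩ := h3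
    simp only [Test.Holds, Ix.eval_reg, a4, a5] at h
    refine ⟨a1, a2, a3, ?_⟩
    omega

theorem runs_mergeSide (σ : State) : Runs (mergeSide key) σ 9 fun τ =>
    ((τ.nat 32 0 = 1 ∧ σ.nat 26 0 < σ.nat 27 0 ∧ (σ.nat 28 0 < σ.nat 29 0 →
      σ.real key (σ.nat 22 (σ.nat 26 0)) ≤ σ.real key (σ.nat 22 (σ.nat 28 0)))) ∨
    (τ.nat 32 0 = 0 ∧ (σ.nat 26 0 < σ.nat 27 0 → σ.nat 28 0 < σ.nat 29 0 ∧
      σ.real key (σ.nat 22 (σ.nat 28 0)) ≤ σ.real key (σ.nat 22 (σ.nat 26 0))))) := by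
  refine (Runs.seq' (M := 7) (Mid := fun τ => τ = σ.setNat 32 0 0) (Runs.block ?_) ?_).le
    (by simp)
  · simp [wp, Instr.Defined, Instr.step]
  rintro _ - rfl
  refine Runs.ite' (N := 6) (fun h => Runs.ite' (N := 4) (fun h' => Runs.seq' (M := 2)
    (Mid := fun τ => τ = ((σ.setNat 32 0 0).setNat 30 0 (σ.nat 22 (σ.nat 26 0))).setNat 31 0
      (σ.nat 22 (σ.nat 28 0))) (Runs.block ?_) ?_)
    fun h' => Runs.block ?_) fun h => Runs.skip ?_
  · simp [wp, Instr.Defined, Instr.step]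
  · rintro _ - rfl
    refine Runs.ite' (fun h'' => Runs.block ?_) fun h'' => Runs.skip ?_
    all_goals
      simp [Instr.step, Test.Holds, wp, Instr.Defined, Cell.eval] at *
    · simp_all
    · exact fun _ => ⟨h', h''.le⟩
  all_goals
    simp [Instr.step, Test.Holds, wp, Instr.Defined] at *
  · exact ⟨h, fun h'' => absurd h'' (by omega)⟩
  · omega

theorem runs_mergeStep {K : ℕ → ℝ} {k : ℕ} (h40 : Nr < 20) (hNr : σ.nat Nr 0 = N)
    (hk : σ.nat 25 0 = k) (hkN : k < N)
    (hwp : 0 < w) (hw : σ.nat 24 0 = w) (hK : σ.real key = K) (hb : BlockSorted K N w inn)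
    (hin : σ.nat 22 = inn)
    (hI : MergeInv K inn N w k (σ.nat 26 0) (σ.nat 27 0) (σ.nat 28 0) (σ.nat 29 0) (σ.nat 23)) :
    Runs (mergeStep key Nr) σ 25 fun τ => MergeInv K inn N w (k + 1) (τ.nat 26 0) (τ.nat 27 0)
      (τ.nat 28 0) (τ.nat 29 0) (τ.nat 23) := by
  refine (Runs.seq' (N := 9) (Mid := fun τ => MergeInv K inn N w k (τ.nat 26 0) (τ.nat 27 0)
      (τ.nat 28 0) (τ.nat 29 0) (τ.nat 23) ∧ k < τ.nat 29 0 ∧ τ.nat 22 = inn ∧ τ.nat 25 0 = k ∧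
      τ.real key = K) (Runs.ite' (fun h => ((runs_mergeReset hNr hw h40).mono le_rfl ?_)) fun h =>
      Runs.skip ⟨hI, by simpa [Test.Holds, hk] using h, hin, hk, hK⟩) fun τ _ h => Runs.seq' (runs_mergeSide τ) fun τ' hF h' =>
      (Runs.ite' (fun hb => Runs.block ?_) fun hb => Runs.block ?_)).le (by simp)
  · rintro τ hF ⟨h1, h2, h3, h4⟩
    simp only [Test.Holds, Ix.eval_reg, hk] at h
    rw [h1, h2, h3, h4, hk, hF.1 22 rfl, hF.1 25 rfl, hF.1 23 rfl, hF.2 key rfl]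
    exact ⟨hI.reset hwp hb.2.2 h hkN, by omega, hin, hk, hK⟩
  all_goals
    obtain ⟨h1, h2, h3, h4, h5⟩ := h
    simp only [Test.Holds, Ix.eval_reg, Ix.eval_lit] at hb
    rw [h3, h5] at h'
    have e22 := hF.1 22 rfl
    have e23 := hF.1 23 rfl
    have e26 := hF.1 26 rfl
    have e27 := hF.1 27 rfl
    have e28 := hF.1 28 rfl
    have e29 := hF.1 29 rfl
    have e25 := hF.1 25 rfl
    simp [wp, Instr.Defined, Instr.step, State.setNat_nat, e22, e23, e26, e27, e28, e29, e25, h3,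
      h4]
  · rcases h' with ⟨-, a1, a2⟩ | ⟨a1, -⟩
    · exact h1.left hwp (by assumption : BlockSorted K N w inn).1 a1 a2
    · omega
  · rcases h' with ⟨a1, -⟩ | ⟨-, a1⟩
    · omega
    · refine h1.right hwp (by assumption : BlockSorted K N w inn).1 ?_ fun h => (a1 h).2
      -- If the right side were exhausted as well, the position k would have reached `je`.
      by_contra hcon
      obtain ⟨s, b0, b1, b2, b3, b4, b5, b6, b7, -⟩ := h1
      have : ¬ τ.nat 26 0 < τ.nat 27 0 := fun h => hcon (a1 h).1
      omega

theorem runs_mergePass {K : ℕ → ℝ} (h40 : Nr < 20) (hNr : σ.nat Nr 0 = N) (hwp : 0 < w)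
    (hw : σ.nat 24 0 = w) (hK : σ.real key = K) (hb : BlockSorted K N w (σ.nat 22)) :
    Runs (mergePass key Nr) σ (N * 31 + 9) fun τ => τ.nat 24 0 = 2 * w ∧
      BlockSorted K N (2 * w) (τ.nat 22) := by
  have n26 : Nr ≠ 26 := by omega
  have n27 : Nr ≠ 27 := by omega
  have n28 : Nr ≠ 28 := by omega
  have n29 : Nr ≠ 29 := by omega
  have n25 : Nr ≠ 25 := by omega
  -- The sorting works in index arrays from 22 on, so the length register, being below 20, is safe;
  -- the finitely many cases are checked one by one.
  have f1 : (mergeStep key Nr).natFree Nr = true := by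
    have : ∀ a ∈ Finset.range 20, (mergeStep key Nr).natFree a = true := by
      intro a ha
      have : a < 20 := Finset.mem_range.1 ha
      interval_cases a <;> rfl
    exact this Nr (Finset.mem_range.2 h40)
  have f2 : (block [.nload 30 23 (.reg 25), .nstore 22 (.reg 25) (.reg 30)]).natFree Nr = true := by
    have n22 : ¬ 22 = Nr := by omega
    have n30 : ¬ 30 = Nr := by omega
    simp [block, Program.natFree, Program.all, Instr.natDest, n22, n30]
  set σ₀ := ((((σ.setNat 26 0 0).setNat 27 0 0).setNat 28 0 0).setNat 29 0 0) with hσ₀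
  refine (Runs.seq' (Mid := fun τ => τ = σ₀) (Runs.block ?_) ?_).le
    (by simp only [List.length_cons, List.length_nil]; rw [show N * 31 + 9 =
      4 + (N * (25 + 2) + 2 + (N * (2 + 2) + 2 + 1)) by ring])
  · simp [wp, Instr.Defined, Instr.step, hσ₀]
  rintro τ - rfl
  have eN : σ₀.nat Nr 0 = N := by simp [hσ₀, n26, n27, n28, n29, hNr]
  have e24 : σ₀.nat 24 0 = w := by simp [hσ₀, hw]
  have e22 : σ₀.nat 22 = σ.nat 22 := by simp [hσ₀, State.setNat_nat]
  have eK : σ₀.real key = K := by simp [hσ₀, hK]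
  refine Runs.seq' (Runs.forLoop (N := N) (c := 25) (fun k τ => MergeInv K (σ.nat 22) N w k
    (τ.nat 26 0) (τ.nat 27 0) (τ.nat 28 0) (τ.nat 29 0) (τ.nat 23)) eN rfl f1 n25 ?_ ?_) ?_
  · intro k hk σ₁ hF h25 hN' hI
    refine (runs_mergeStep h40 hN' h25 hk hwp (by rw [hF.1 24 rfl, e24])
      (by rw [hF.2 key rfl, eK]) hb (by rw [hF.1 22 rfl, e22]) hI).mono le_rfl ?_
    intro τ _ h
    simpa [State.setNat_nat] using h
  · simpa [hσ₀] using MergeInv.init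
  intro τ hF hI
  have hbs := hI.blockSorted hb
  have eN' : τ.nat Nr 0 = N := by
    rw [hF.1 Nr ?_, eN]
    simp only [forLoop, Program.natFree, Program.all, Bool.and_eq_true] at f1 ⊢
    refine ⟨?_, f1, ?_⟩ <;> simpa [Instr.natDest] using n25.symm
  refine Runs.seq' (Runs.forLoop (N := N) (c := 2) (fun k σ₁ => ∀ q < k, σ₁.nat 22 q = τ.nat 23 q)
    eN' rfl f2 n25 ?_ (by simp)) ?_
  · intro k hk σ₁ hF₁ h25 hN' hI
    refine Runs.block ?_
    simp [wp, Instr.Defined, Instr.step, h25, hF₁.1 23 rfl]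
    intro q hq
    split_ifs with h
    · rw [h]
    · exact hI q (by omega)
  · intro τ' hF' h22
    refine Runs.block ?_
    have : τ'.nat 24 0 = w := by rw [hF'.1 24 rfl, hF.1 24 rfl, e24]
    simp [wp, Instr.Defined, Instr.step, State.setNat_nat, this]
    refine ⟨by ring, ?_⟩
    refine ⟨fun p hp => by rw [h22 p hp]; exact hbs.1 p hp, fun i hi => ?_, fun a b hab hb' hd => ?_⟩
    · obtain ⟨p, hp, he⟩ := hbs.2.1 i hi
      exact ⟨p, hp, by rw [h22 p hp, he]⟩
    · rw [h22 a (by omega), h22 b hb']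
      exact hbs.2.2 a b hab hb' hd

/-- The list `idx` enumerates the indices below `N` in increasing order of `K`. -/
def SortedBy (K : ℕ → ℝ) (N : ℕ) (idx : ℕ → ℕ) : Prop :=
  (∀ p < N, idx p < N) ∧ (∀ i < N, ∃ p < N, idx p = i) ∧
    ∀ a b, a ≤ b → b < N → K (idx a) ≤ K (idx b)

/-- The block width after k passes is 2^k. Once it reaches N, all positions share block 0 and the
list is sorted. -/
theorem runs_sortIdx (h40 : Nr < 20) (hNr : σ.nat Nr 0 = N) :
    Runs (sortIdx key Nr) σ ((Nat.log 2 N + 1) * (N * 31 + 10) + N * 3 + 4) fun τ =>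
      SortedBy (σ.real key) N (τ.nat 22) := by
  have n25 : Nr ≠ 25 := by omega
  have n24 : Nr ≠ 24 := by omega
  have f2 : (block [.nstore 22 (.reg 25) (.reg 25)]).natFree Nr = true := by
    have n22 : ¬ 22 = Nr := by omega
    simp [block, Program.natFree, Program.all, Instr.natDest, n22]
  have f1 : (mergePass key Nr).natFree Nr = true := by
    have : ∀ a ∈ Finset.range 20, (mergePass key Nr).natFree a = true := by
      intro a ha
      have : a < 20 := Finset.mem_range.1 ha
      interval_cases a <;> rfl
    exact this Nr (Finset.mem_range.2 h40)
  refine (Runs.seq' (M := 1 + ((Nat.log 2 N + 1) * (N * 31 + 10) + 1))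
    (Runs.forLoop (N := N) (c := 1) (fun k τ => ∀ q < k, τ.nat 22 q = q)
    hNr rfl f2 n25 ?_ (by simp)) ?_).le (by omega)
  · intro k hk σ₁ hF₁ h25 hN' hI
    refine Runs.block ?_
    simp [wp, Instr.Defined, Instr.step, h25]
    intro q hq
    split_ifs with h
    · rw [h]
    · exact hI q (by omega)
  intro τ hF h22
  have eN : τ.nat Nr 0 = N := by
    rw [hF.1 Nr ?_, hNr]
    simp only [forLoop, Program.natFree, Program.all, Bool.and_eq_true] at f2 ⊢
    refine ⟨?_, f2, ?_⟩ <;> simpa [Instr.natDest] using n25.symm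
  have eK : τ.real key = σ.real key := hF.2 key rfl
  refine Runs.seq' (Mid := fun τ' => τ' = τ.setNat 24 0 1) (Runs.block ?_) ?_
  · simp [wp, Instr.Defined, Instr.step]
  rintro τ' - rfl
  refine (Runs.whileLoop (fun k τ₁ => τ₁.nat 24 0 = 2 ^ k ∧
    BlockSorted (σ.real key) N (2 ^ k) (τ₁.nat 22)) ?_ ?_).mono le_rfl ?_
  · rintro k σ₁ hF₁ ⟨h1, h2⟩ hlt
    have hN₁ : σ₁.nat Nr 0 = N := by rw [hF₁.1 Nr f1]; simpa [n24] using eN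
    simp only [Test.Holds, Ix.eval_reg, h1, hN₁] at hlt
    refine ⟨?_, ?_⟩
    · have := Nat.le_log_of_pow_le (by norm_num) hlt.le
      omega
    · refine (runs_mergePass h40 hN₁ (by positivity) h1 (by rw [hF₁.2 key rfl]; exact eK)
        h2).mono le_rfl ?_
      rintro τ₂ - ⟨g1, g2⟩
      rw [pow_succ, mul_comm]
      exact ⟨g1, g2⟩
  · refine ⟨by simp, fun p hp => ?_, fun i hi => ⟨i, hi, ?_⟩, fun a b hab hb hd => ?_⟩
    · simpa [h22 p hp] using hp
    · simp [h22 i hi]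
    · simp only [pow_zero, Nat.div_one] at hd
      rw [hd]
  · rintro τ₂ hF₂ ⟨k, hk, ⟨h1, h2⟩, h3⟩
    have hN₁ : τ₂.nat Nr 0 = N := by
      rw [hF₂.1 Nr f1]
      simpa [n24] using eN
    simp only [Test.Holds, Ix.eval_reg, h1, hN₁, not_lt] at h3
    refine ⟨h2.1, h2.2.1, fun a b hab hb => h2.2.2 a b hab hb ?_⟩
    rw [Nat.div_eq_of_lt (by omega), Nat.div_eq_of_lt (by omega)]

end sort

/-! ### The program

Index arrays: `10`-`13` loop variable and temporaries, `14`, `15` marks of nonempty columns and rows,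
`16`, `17` flags for an empty column or row, `18` flag of the main loop, `19` holds `m + 1`,
`22`-`32` belong to the sorting, `33`-`37` to the binary search, `40` holds the precision `p`,
`41` holds `n - 1`. -/

/-- Sum of the squared column errors, the row scaling and the scaled matrix. -/
def evalP : Program :=
  .seq (forLoop 10 0 (block [.rconst ⟨13, .reg 10⟩ 0]))
  (.seq (forLoop 10 1 (block [.rconst ⟨15, .reg 10⟩ 0]))
  (.seq (forLoop 10 2 (block [.nload 11 3 (.reg 10), .nload 12 4 (.reg 10),
    .rmul ⟨12, .lit 0⟩ ⟨0, .reg 10⟩ ⟨5, .reg 12⟩,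
    .radd ⟨13, .reg 11⟩ ⟨13, .reg 11⟩ ⟨12, .lit 0⟩]))
  (.seq (forLoop 10 0 (block [.rdiv ⟨4, .reg 10⟩ ⟨1, .reg 10⟩ ⟨13, .reg 10⟩]))
  (.seq (forLoop 10 2 (block [.nload 11 3 (.reg 10), .nload 12 4 (.reg 10),
    .rmul ⟨14, .reg 10⟩ ⟨0, .reg 10⟩ ⟨5, .reg 12⟩,
    .rmul ⟨14, .reg 10⟩ ⟨14, .reg 10⟩ ⟨4, .reg 11⟩,
    .radd ⟨15, .reg 12⟩ ⟨15, .reg 12⟩ ⟨14, .reg 10⟩]))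
  (.seq (block [.rconst ⟨18, .lit 0⟩ 0, .nset 18 (.lit 0)])
  (.seq (forLoop 10 1 (block [.rsub ⟨16, .reg 10⟩ ⟨15, .reg 10⟩ ⟨2, .reg 10⟩,
    .rmul ⟨17, .lit 0⟩ ⟨16, .reg 10⟩ ⟨16, .reg 10⟩,
    .radd ⟨18, .lit 0⟩ ⟨18, .lit 0⟩ ⟨17, .lit 0⟩]))
    (.ite (.rlt ⟨19, .lit 0⟩ ⟨18, .lit 0⟩) (block [.nset 18 (.lit 1)]) .skip)))))))

/-- The largest gap between consecutive column errors. -/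
def gapP : Program :=
  .seq (sortIdx 16 1)
  (.seq (block [.rconst ⟨21, .lit 0⟩ 0])
  (forLoop 10 41 (.seq (block [.nadd 37 (.reg 10) (.lit 1), .nload 11 22 (.reg 10),
      .nload 12 22 (.reg 37), .rsub ⟨20, .lit 0⟩ ⟨16, .reg 12⟩ ⟨16, .reg 11⟩])
    (.ite (.rlt ⟨21, .lit 0⟩ ⟨20, .lit 0⟩)
      (block [.rmove ⟨21, .lit 0⟩ ⟨20, .lit 0⟩, .rmove ⟨22, .lit 0⟩ ⟨16, .reg 11⟩]) .skip))))

/-- The set of columns below the gap. -/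
def selectP : Program :=
  forLoop 10 1 (.ite (.rle ⟨16, .reg 10⟩ ⟨22, .lit 0⟩)
    (block [.nstore 6 (.reg 10) (.lit 1)]) (block [.nstore 6 (.reg 10) (.lit 0)]))

/-- The row shares of the set of columns, the weights of the entries, and the breakpoints. -/
def shareP : Program :=
  .seq (forLoop 10 0 (block [.rconst ⟨25, .reg 10⟩ 0]))
  (.seq (forLoop 10 2 (.seq (block [.nload 11 3 (.reg 10), .nload 12 4 (.reg 10),
      .nload 13 6 (.reg 12)])
    (.ite (.nlt (.lit 0) (.reg 13))
      (block [.radd ⟨25, .reg 11⟩ ⟨25, .reg 11⟩ ⟨14, .reg 10⟩]) .skip)))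
  (.seq (forLoop 10 0 (block [.rdiv ⟨26, .reg 10⟩ ⟨25, .reg 10⟩ ⟨1, .reg 10⟩]))
  (.seq (forLoop 10 2 (.seq (block [.nload 11 3 (.reg 10), .nload 12 4 (.reg 10),
      .nload 13 6 (.reg 12)])
    (.ite (.nlt (.lit 0) (.reg 13))
      (block [.rsub ⟨27, .lit 0⟩ ⟨10, .lit 0⟩ ⟨26, .reg 11⟩,
        .rmul ⟨28, .reg 10⟩ ⟨14, .reg 10⟩ ⟨27, .lit 0⟩,
        .rdiv ⟨28, .reg 10⟩ ⟨28, .reg 10⟩ ⟨26, .reg 11⟩])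
      (block [.rmove ⟨28, .reg 10⟩ ⟨14, .reg 10⟩]))))
  (.seq (forLoop 10 0 (.ite (.rlt ⟨54, .lit 0⟩ ⟨26, .reg 10⟩)
      (block [.rdiv ⟨29, .reg 10⟩ ⟨10, .lit 0⟩ ⟨26, .reg 10⟩])
      (block [.rconst ⟨29, .reg 10⟩ 0])))
    (block [.rconst ⟨29, .reg 0⟩ 0, .rdiv ⟨24, .lit 0⟩ ⟨21, .lit 0⟩ ⟨23, .lit 0⟩])))))

/-- The estimated movement of all columns for the factor in real register `30`; index register `36`
tells whether the threshold in real register `24` is reached. -/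
def moveP : Program :=
  .seq (forLoop 10 1 (block [.rconst ⟨32, .reg 10⟩ 0]))
  (.seq (forLoop 10 2 (.seq (block [.nload 11 3 (.reg 10), .nload 12 4 (.reg 10),
      .rmul ⟨31, .lit 0⟩ ⟨30, .lit 0⟩ ⟨26, .reg 11⟩])
    (.seq (.ite (.rlt ⟨10, .lit 0⟩ ⟨31, .lit 0⟩) (block [.rmove ⟨31, .lit 0⟩ ⟨10, .lit 0⟩]) .skip)
      (block [.rmul ⟨31, .lit 0⟩ ⟨31, .lit 0⟩ ⟨28, .reg 10⟩,
        .radd ⟨32, .reg 12⟩ ⟨32, .reg 12⟩ ⟨31, .lit 0⟩]))))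
  (.seq (block [.nset 36 (.lit 0)])
    (forLoop 10 1 (.ite (.rle ⟨24, .lit 0⟩ ⟨32, .reg 10⟩) (block [.nset 36 (.lit 1)]) .skip))))

/-- `moveP` for the breakpoint at the sorted position in the register `v`. -/
def moveAtP (v : ℕ) : Program :=
  .seq (block [.nload 11 22 (.reg v), .rmove ⟨30, .lit 0⟩ ⟨29, .reg 11⟩]) moveP

/-- Binary search for neighbouring breakpoints. -/
def searchP : Program :=
  .seq (block [.nset 33 (.lit 0), .nset 34 (.reg 0), .nadd 37 (.reg 33) (.lit 1)])
  (.while (.nlt (.reg 37) (.reg 34))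
    (.seq (block [.nadd 35 (.reg 33) (.reg 34), .nhalf 35 (.reg 35)])
    (.seq (moveAtP 35)
    (.seq (.ite (.nlt (.reg 36) (.lit 1)) (block [.nset 33 (.reg 35)]) (block [.nset 34 (.reg 35)]))
      (block [.nadd 37 (.reg 33) (.lit 1)])))))

/-- Linear interpolation between neighbouring breakpoints. -/
def interpP : Program :=
  .seq (moveAtP 33)
  (.seq (block [.rmove ⟨52, .lit 0⟩ ⟨30, .lit 0⟩])
  (.seq (forLoop 10 1 (block [.rmove ⟨33, .reg 10⟩ ⟨32, .reg 10⟩]))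
  (.seq (moveAtP 34)
  (.seq (block [.rmove ⟨53, .lit 0⟩ ⟨30, .lit 0⟩, .rsub ⟨35, .lit 0⟩ ⟨53, .lit 0⟩ ⟨52, .lit 0⟩,
    .rmove ⟨38, .lit 0⟩ ⟨53, .lit 0⟩])
  (forLoop 10 1 (.ite (.rle ⟨24, .lit 0⟩ ⟨32, .reg 10⟩)
    (.seq (block [.rsub ⟨34, .lit 0⟩ ⟨24, .lit 0⟩ ⟨33, .reg 10⟩,
        .rsub ⟨36, .lit 0⟩ ⟨32, .reg 10⟩ ⟨33, .reg 10⟩,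
        .rmul ⟨37, .lit 0⟩ ⟨34, .lit 0⟩ ⟨35, .lit 0⟩,
        .rdiv ⟨37, .lit 0⟩ ⟨37, .lit 0⟩ ⟨36, .lit 0⟩,
        .radd ⟨37, .lit 0⟩ ⟨37, .lit 0⟩ ⟨52, .lit 0⟩])
      (.ite (.rlt ⟨37, .lit 0⟩ ⟨38, .lit 0⟩) (block [.rmove ⟨38, .lit 0⟩ ⟨37, .lit 0⟩]) .skip))
    .skip))))))

/-- Scale up the set of columns, and compute the cap on the gaps. -/
def liftP : Program :=
  .seq (block [.radd ⟨39, .lit 0⟩ ⟨10, .lit 0⟩ ⟨38, .lit 0⟩])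
  (.seq (forLoop 10 1 (.seq (block [.rmove ⟨40, .reg 10⟩ ⟨5, .reg 10⟩, .nload 13 6 (.reg 10)])
    (.ite (.nlt (.lit 0) (.reg 13)) (block [.rmul ⟨40, .reg 10⟩ ⟨40, .reg 10⟩ ⟨39, .lit 0⟩]) .skip)))
  (.seq (block [.rmove ⟨41, .lit 0⟩ ⟨0, .lit 0⟩, .rmove ⟨42, .lit 0⟩ ⟨0, .lit 0⟩])
  (.seq (forLoop 10 2 (.seq
    (.ite (.rlt ⟨41, .lit 0⟩ ⟨0, .reg 10⟩) (block [.rmove ⟨41, .lit 0⟩ ⟨0, .reg 10⟩]) .skip)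
    (.ite (.rlt ⟨0, .reg 10⟩ ⟨42, .lit 0⟩) (block [.rmove ⟨42, .lit 0⟩ ⟨0, .reg 10⟩]) .skip)))
    (block [.rmul ⟨44, .lit 0⟩ ⟨43, .lit 0⟩ ⟨41, .lit 0⟩,
      .rdiv ⟨44, .lit 0⟩ ⟨44, .lit 0⟩ ⟨42, .lit 0⟩]))))

/-- Cap the gaps between the column scalings. -/
def capP : Program :=
  .seq (sortIdx 40 1)
  (.seq (block [.nload 11 22 (.lit 0), .rconst ⟨46, .reg 11⟩ 1])
  (forLoop 10 41 (.seq (block [.nadd 37 (.reg 10) (.lit 1), .nload 11 22 (.reg 10),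
      .nload 12 22 (.reg 37), .rdiv ⟨45, .lit 0⟩ ⟨40, .reg 12⟩ ⟨40, .reg 11⟩])
    (.seq (.ite (.rlt ⟨44, .lit 0⟩ ⟨45, .lit 0⟩) (block [.rmove ⟨45, .lit 0⟩ ⟨44, .lit 0⟩]) .skip)
      (block [.rmul ⟨46, .reg 12⟩ ⟨46, .reg 11⟩ ⟨45, .lit 0⟩])))))

/-- Round the column scalings. -/
def roundP : Program := forLoop 10 1 (.instr (.rround ⟨5, .reg 10⟩ ⟨46, .reg 10⟩ (.reg 40)))

/-- The part of a step that finds the set of columns and its breakpoints. -/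
def prepareP : Program :=
  .seq gapP (.seq selectP (.seq shareP (.seq (sortIdx 29 19) (moveAtP 0))))

/-- The part of a step that computes the new column scaling. -/
def findP : Program := .seq searchP (.seq interpP (.seq liftP capP))

/-- One step of the algorithm. -/
def stepP : Program :=
  .seq prepareP
  (.ite (.nlt (.reg 36) (.lit 1)) (block [.nset 5 (.lit 1), .nset 18 (.lit 0)])
    (.seq findP (.seq roundP evalP)))

/-- One iteration: increase the precision, or do a step. -/
def iterP : Program :=
  .seq (block [.rmul ⟨51, .lit 0⟩ ⟨43, .lit 0⟩ ⟨19, .lit 0⟩])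
  (.ite (.rlt ⟨51, .lit 0⟩ ⟨50, .lit 0⟩)
    (block [.nadd 40 (.reg 40) (.lit 1), .rmul ⟨43, .lit 0⟩ ⟨43, .lit 0⟩ ⟨11, .lit 0⟩])
    stepP)

/-- The constants. -/
def constP : Program :=
  .seq (block [.rconst ⟨10, .lit 0⟩ 1, .rconst ⟨11, .lit 0⟩ 2, .rconst ⟨23, .lit 0⟩ 4,
    .rconst ⟨49, .lit 0⟩ 128, .rconst ⟨43, .lit 0⟩ 1, .rconst ⟨54, .lit 0⟩ 0, .nset 40 (.lit 0),
    .nsub 41 (.reg 1) (.lit 1), .nadd 19 (.reg 0) (.lit 1), .rconst ⟨47, .lit 0⟩ 0,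
    .rconst ⟨48, .lit 0⟩ 0])
  (.seq (forLoop 10 1 (block [.radd ⟨47, .lit 0⟩ ⟨47, .lit 0⟩ ⟨2, .reg 10⟩,
    .radd ⟨48, .lit 0⟩ ⟨48, .lit 0⟩ ⟨10, .lit 0⟩]))
  (block [.rmove ⟨50, .lit 0⟩ ⟨47, .lit 0⟩, .rmul ⟨50, .lit 0⟩ ⟨50, .lit 0⟩ ⟨47, .lit 0⟩,
    .rmul ⟨50, .lit 0⟩ ⟨50, .lit 0⟩ ⟨48, .lit 0⟩, .rmul ⟨50, .lit 0⟩ ⟨50, .lit 0⟩ ⟨48, .lit 0⟩,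
    .rmul ⟨50, .lit 0⟩ ⟨50, .lit 0⟩ ⟨48, .lit 0⟩, .rmul ⟨50, .lit 0⟩ ⟨50, .lit 0⟩ ⟨48, .lit 0⟩,
    .rmul ⟨50, .lit 0⟩ ⟨50, .lit 0⟩ ⟨48, .lit 0⟩, .rmul ⟨50, .lit 0⟩ ⟨50, .lit 0⟩ ⟨49, .lit 0⟩,
    .rmul ⟨19, .lit 0⟩ ⟨3, .lit 0⟩ ⟨3, .lit 0⟩]))

/-- The start of the algorithm. -/
def startP : Program :=
  .seq constP (.seq (forLoop 10 1 (.instr (.rconst ⟨5, .reg 10⟩ 1))) evalP)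

/-- Find empty rows and columns; the empty columns are marked in array `6`. -/
def markP : Program :=
  .seq (forLoop 10 2 (block [.nload 11 3 (.reg 10), .nload 12 4 (.reg 10),
    .nstore 15 (.reg 11) (.lit 1), .nstore 14 (.reg 12) (.lit 1)]))
  (.seq (forLoop 10 1 (.seq (block [.nload 11 14 (.reg 10)])
    (.ite (.nlt (.reg 11) (.lit 1)) (block [.nstore 6 (.reg 10) (.lit 1), .nset 16 (.lit 1)]) .skip)))
    (forLoop 10 0 (.seq (block [.nload 11 15 (.reg 10)])
      (.ite (.nlt (.reg 11) (.lit 1)) (block [.nset 17 (.lit 1)]) .skip))))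

/-- The main loop. -/
def mainLoop : Program := .while (.nlt (.lit 0) (.reg 18)) (.seq .iteration iterP)

/-- The whole program. -/
def scalingProgram : Program :=
  .seq markP
  (.ite (.nlt (.lit 0) (.reg 16)) (block [.nset 5 (.lit 1)])
  (.ite (.nlt (.lit 0) (.reg 17))
    (.seq (forLoop 10 1 (block [.nstore 6 (.reg 10) (.lit 1)])) (block [.nset 5 (.lit 1)]))
    (.seq startP mainLoop)))

/-- The levels of the real arrays. -/
def level : ℕ → ℕ
  | 0 => 0 | 1 => 0 | 2 => 0 | 3 => 0 | 5 => 0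
  | 4 => 3 | 12 => 1 | 13 => 2 | 14 => 4 | 15 => 5 | 16 => 6 | 17 => 7 | 18 => 8 | 20 => 7
  | 21 => 7 | 22 => 6 | 24 => 8 | 25 => 5 | 26 => 6 | 27 => 7 | 28 => 8 | 29 => 7 | 30 => 7
  | 31 => 9 | 32 => 10 | 33 => 10 | 34 => 11 | 35 => 8 | 36 => 11 | 37 => 12 | 38 => 12 | 39 => 13
  | 40 => 14 | 43 => 2 | 44 => 3 | 45 => 15 | 46 => 16 | 48 => 2 | 50 => 3 | 51 => 3 | 52 => 7
  | 53 => 7 | _ => 1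

/-- A finite check. The levels follow the flow of data within an iteration. An accumulator may read
itself, because its summands or factors lie strictly below it. -/
theorem scalingProgram_leveled : scalingProgram.all (Instr.leveled level) = true := by decide

theorem level_le (a : ℕ) : level a ≤ 16 := by
  unfold level
  split <;> norm_num

/-! ### Evaluation of the column errors and selection of the gap -/

/-- The program writes none of the index arrays `ns` and none of the real arrays `rs`. -/
def Program.keeps (P : Program) (ns rs : List ℕ) : Bool :=
  ns.all (fun a => P.natFree a) && rs.all fun a => P.realFree a

theorem Frame.nat_of_keeps {P : Program} {σ σ' : State} {ns rs : List ℕ} (hF : Frame P σ σ')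
    (h : P.keeps ns rs = true) {a : ℕ} (ha : a ∈ ns) : σ'.nat a = σ.nat a := by
  simp only [Program.keeps, Bool.and_eq_true, List.all_eq_true] at h
  exact hF.1 a (h.1 a ha)

theorem Frame.real_of_keeps {P : Program} {σ σ' : State} {ns rs : List ℕ} (hF : Frame P σ σ')
    (h : P.keeps ns rs = true) {a : ℕ} (ha : a ∈ rs) : σ'.real a = σ.real a := by
  simp only [Program.keeps, Bool.and_eq_true, List.all_eq_true] at h
  exact hF.2 a (h.2 a ha)

/-- The input is in memory. -/
structure Inp (I : Inst) (ε : ℝ) (σ : State) : Prop where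
  n0 : σ.nat 0 0 = I.m
  n1 : σ.nat 1 0 = I.n
  n2 : σ.nat 2 0 = I.E
  n3 : σ.nat 3 = I.row
  n4 : σ.nat 4 = I.col
  r0 : σ.real 0 = I.a
  r1 : σ.real 1 = I.r
  r2 : σ.real 2 = I.c
  r3 : σ.real 3 0 = ε

/-- The input and the constants are in memory. -/
structure Env (I : Inst) (ε : ℝ) (σ : State) : Prop extends Inp I ε σ where
  one : σ.real 10 0 = 1
  two : σ.real 11 0 = 2
  four : σ.real 23 0 = 4
  zero : σ.real 54 0 = 0
  n41 : σ.nat 41 0 = I.n - 1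
  n19 : σ.nat 19 0 = I.m + 1
  target : σ.real 50 0 = 128 * I.s ^ 2 * I.n ^ 5
  eps2 : σ.real 19 0 = ε ^ 2

section

variable {I : Inst} {ε : ℝ} {P : Program} {σ σ' : State}

theorem Inp.frame (hI : Inp I ε σ) (hF : Frame P σ σ')
    (h : P.keeps [0, 1, 2, 3, 4] [0, 1, 2, 3] = true) : Inp I ε σ' where
  n0 := by rw [hF.nat_of_keeps h (by simp), hI.n0]
  n1 := by rw [hF.nat_of_keeps h (by simp), hI.n1]
  n2 := by rw [hF.nat_of_keeps h (by simp), hI.n2]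
  n3 := by rw [hF.nat_of_keeps h (by simp), hI.n3]
  n4 := by rw [hF.nat_of_keeps h (by simp), hI.n4]
  r0 := by rw [hF.real_of_keeps h (by simp), hI.r0]
  r1 := by rw [hF.real_of_keeps h (by simp), hI.r1]
  r2 := by rw [hF.real_of_keeps h (by simp), hI.r2]
  r3 := by rw [hF.real_of_keeps h (by simp), hI.r3]

theorem Env.frame (hI : Env I ε σ) (hF : Frame P σ σ')
    (h : P.keeps [0, 1, 2, 3, 4, 41, 19] [0, 1, 2, 3, 10, 11, 23, 54, 50, 19] = true) :
    Env I ε σ' where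
  n0 := by rw [hF.nat_of_keeps h (by simp), hI.n0]
  n1 := by rw [hF.nat_of_keeps h (by simp), hI.n1]
  n2 := by rw [hF.nat_of_keeps h (by simp), hI.n2]
  n3 := by rw [hF.nat_of_keeps h (by simp), hI.n3]
  n4 := by rw [hF.nat_of_keeps h (by simp), hI.n4]
  r0 := by rw [hF.real_of_keeps h (by simp), hI.r0]
  r1 := by rw [hF.real_of_keeps h (by simp), hI.r1]
  r2 := by rw [hF.real_of_keeps h (by simp), hI.r2]
  r3 := by rw [hF.real_of_keeps h (by simp), hI.r3]
  one := by rw [hF.real_of_keeps h (by simp), hI.one]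
  two := by rw [hF.real_of_keeps h (by simp), hI.two]
  four := by rw [hF.real_of_keeps h (by simp), hI.four]
  zero := by rw [hF.real_of_keeps h (by simp), hI.zero]
  n41 := by rw [hF.nat_of_keeps h (by simp), hI.n41]
  n19 := by rw [hF.nat_of_keeps h (by simp), hI.n19]
  target := by rw [hF.real_of_keeps h (by simp), hI.target]
  eps2 := by rw [hF.real_of_keeps h (by simp), hI.eps2]

end

/-- The size of the problem. -/
def Inst.X (I : Inst) : ℕ := I.m + I.n + I.E + 1

/-- The results of `evalP` for the column scaling `y`. -/
structure Evald (I : Inst) (ε : ℝ) (y : ℕ → ℝ) (σ : State) : Prop where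
  x : ∀ i < I.m, σ.real 4 i = I.x y i
  B : ∀ e < I.E, σ.real 14 e = I.B y e
  d : ∀ j < I.n, σ.real 16 j = I.d y j
  flag : (σ.nat 18 0 = 1 ∧ ε ^ 2 < I.Φ y) ∨ (σ.nat 18 0 = 0 ∧ I.Φ y ≤ ε ^ 2)

section

variable {I : Inst} {ε : ℝ} {σ : State}

theorem runs_evalP (hI : Inp I ε σ) (h19 : σ.real 19 0 = ε ^ 2)
    (hy : ∀ j < I.n, 0 < σ.real 5 j) :
    Runs evalP σ (40 * I.X) (Evald I ε (σ.real 5)) := by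
  refine Runs.le (N := (I.m * 3 + 2) + ((I.n * 3 + 2) + ((I.E * 6 + 2) + ((I.m * 3 + 2) +
    ((I.E * 7 + 2) + (2 + ((I.n * 5 + 2) + 2))))))) ?_ (by simp only [Inst.X]; omega)
  -- clear the sums
  refine Runs.seq' (Runs.forLoop (c := 1) (fun k τ => ∀ i < k, τ.real 13 i = 0) hI.n0 rfl rfl
    (by decide) ?_ (by simp)) fun σ₁ F₁ h₁ => ?_
  · intro k hk τ hF h10 hN h
    refine Runs.block ?_
    simp [wp, Instr.Defined, Instr.step, h10]
    intro i hi hik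
    exact h i (by omega)
  have I₁ := hI.frame F₁ rfl
  refine Runs.seq' (Runs.forLoop (c := 1) (fun k τ => ∀ j < k, τ.real 15 j = 0) I₁.n1 rfl rfl
    (by decide) ?_ (by simp)) fun σ₂ F₂ h₂ => ?_
  · intro k hk τ hF h10 hN h
    refine Runs.block ?_
    simp [wp, Instr.Defined, Instr.step, h10]
    intro i hi hik
    exact h i (by omega)
  have I₂ := I₁.frame F₂ rfl
  have y₂ : σ₂.real 5 = σ.real 5 := by rw [F₂.2 5 rfl, F₁.2 5 rfl]
  -- the row sums
  refine Runs.seq' (Runs.forLoop (c := 4) (fun k τ => ∀ i < I.m, τ.real 13 i =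
    scat I.row (fun e => I.a e * σ.real 5 (I.col e)) k i) I₂.n2 rfl rfl (by decide) ?_ ?_)
    fun σ₃ F₃ h₃ => ?_
  · intro k hk τ hF h10 hN h
    have J := I₂.frame hF rfl
    have y₃ : τ.real 5 = σ.real 5 := by rw [hF.2 5 rfl, y₂]
    refine Runs.block ?_
    simp [wp, Instr.Defined, Instr.step, Cell.eval, h10, J.n3, J.n4, J.r0, y₃, scat_succ]
    intro i hi
    by_cases hik : i = I.row k
    · simp [hik, h _ (I.row_lt k hk)]
    · simp [hik, Ne.symm hik, h i hi]
  · intro i hi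
    simp [F₂.2 13 rfl, h₁ i hi]
  have I₃ := I₂.frame F₃ rfl
  have y₃ : σ₃.real 5 = σ.real 5 := by rw [F₃.2 5 rfl, y₂]
  have q₃ : ∀ j < I.n, σ₃.real 15 j = 0 := by rw [F₃.2 15 rfl]; exact h₂
  -- the row scaling
  refine Runs.seq' (Runs.forLoop (c := 1) (fun k τ => ∀ i < k, τ.real 4 i = I.x (σ.real 5) i)
    I₃.n0 rfl rfl (by decide) ?_ (by simp)) fun σ₄ F₄ h₄ => ?_
  · intro k hk τ hF h10 hN h
    have J := I₃.frame hF rfl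
    have e13 : τ.real 13 k = I.D (σ.real 5) k := by rw [hF.2 13 rfl, h₃ k hk]; rfl
    refine Runs.block ?_
    simp [wp, Instr.Defined, Instr.step, Cell.eval, h10, e13, J.r1, (Inst.D_pos hy hk).ne']
    intro i hi
    split_ifs with hik
    · rw [hik, Inst.x]
    · exact h i (by omega)
  have I₄ := I₃.frame F₄ rfl
  have y₄ : σ₄.real 5 = σ.real 5 := by rw [F₄.2 5 rfl, y₃]
  have q₄ : ∀ j < I.n, σ₄.real 15 j = 0 := by rw [F₄.2 15 rfl]; exact q₃
  -- the entries and the column sums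
  refine Runs.seq' (Runs.forLoop (c := 5) (fun k τ => (∀ e < k, τ.real 14 e = I.B (σ.real 5) e) ∧
    ∀ j < I.n, τ.real 15 j = scat I.col (I.B (σ.real 5)) k j) I₄.n2 rfl rfl (by decide) ?_ ?_)
    fun σ₅ F₅ h₅ => ?_
  · rintro k hk τ hF h10 hN ⟨hB, hq⟩
    have J := I₄.frame hF rfl
    have y₅ : τ.real 5 = σ.real 5 := by rw [hF.2 5 rfl, y₄]
    have x₅ : τ.real 4 (I.row k) = I.x (σ.real 5) (I.row k) := by
      rw [hF.2 4 rfl, h₄ _ (I.row_lt k hk)]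
    have eB : I.a k * σ.real 5 (I.col k) * I.x (σ.real 5) (I.row k) = I.B (σ.real 5) k := rfl
    refine Runs.block ?_
    simp [wp, Instr.Defined, Instr.step, Cell.eval, h10, J.n3, J.n4, J.r0, y₅, x₅, eB, scat_succ]
    constructor
    · intro e he
      split_ifs with hek
      · rw [hek]
      · exact hB e (by omega)
    · intro j hj
      by_cases hjk : j = I.col k
      · simp [hjk, hq _ (I.col_lt k hk)]
      · simp [hjk, Ne.symm hjk, hq j hj]
  · simpa using q₄
  have I₅ := I₄.frame F₅ rfl
  refine Runs.seq' (Mid := fun τ => τ.real 18 0 = 0 ∧ τ.nat 18 0 = 0) (Runs.block ?_)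
    fun σ₆ F₆ h₆ => ?_
  · simp [wp, Instr.Defined, Instr.step]
  have I₆ := I₅.frame F₆ rfl
  -- the column errors
  refine Runs.seq' (Runs.forLoop (c := 3) (fun k τ => (∀ j < k, τ.real 16 j = I.d (σ.real 5) j) ∧
    τ.real 18 0 = ∑ j ∈ range k, I.d (σ.real 5) j * I.d (σ.real 5) j) I₆.n1 rfl rfl (by decide)
    ?_ ?_) fun σ₇ F₇ h₇ => ?_
  · rintro k hk τ hF h10 hN ⟨hd, hs⟩
    have J := I₆.frame hF rfl
    have e15 : τ.real 15 k = I.q (σ.real 5) k := by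
      rw [hF.2 15 rfl, F₆.2 15 rfl, h₅.2 k hk]; rfl
    have ed : I.q (σ.real 5) k - I.c k = I.d (σ.real 5) k := rfl
    refine Runs.block ?_
    simp [wp, Instr.Defined, Instr.step, Cell.eval, h10, J.r2, e15, ed, hs, sum_range_succ]
    intro j hj
    split_ifs with hjk
    · rw [hjk]
    · exact hd j (by omega)
  · simpa using h₆.1
  have h18 : σ₇.nat 18 0 = 0 := by rw [F₇.1 18 rfl]; exact h₆.2
  have e19 : σ₇.real 19 0 = ε ^ 2 := by
    rw [F₇.2 19 rfl, F₆.2 19 rfl, F₅.2 19 rfl, F₄.2 19 rfl, F₃.2 19 rfl, F₂.2 19 rfl, F₁.2 19 rfl,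
      h19]
  have e4 : ∀ i < I.m, σ₇.real 4 i = I.x (σ.real 5) i := by
    rw [F₇.2 4 rfl, F₆.2 4 rfl, F₅.2 4 rfl]; exact h₄
  have e14 : ∀ e < I.E, σ₇.real 14 e = I.B (σ.real 5) e := by
    rw [F₇.2 14 rfl, F₆.2 14 rfl]; exact h₅.1
  have e18 : σ₇.real 18 0 = I.Φ (σ.real 5) := h₇.2
  refine Runs.ite' (fun h => Runs.block ?_) fun h => Runs.skip ?_
  · simp only [Test.Holds, Cell.eval, Ix.eval_lit, e18, e19] at h
    simp only [wp, Instr.Defined, Instr.step, true_and]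
    exact ⟨e4, e14, h₇.1, Or.inl ⟨by simp, h⟩⟩
  · simp only [Test.Holds, Cell.eval, Ix.eval_lit, e18, e19, not_lt] at h
    exact ⟨e4, e14, h₇.1, Or.inr ⟨h18, h⟩⟩

/-- The largest gap `G` of the column errors, above the value `thr`. -/
def IsGap (I : Inst) (y : ℕ → ℝ) (thr G : ℝ) : Prop :=
  (∃ j < I.n, I.d y j ≤ thr) ∧ (∃ j < I.n, ¬ I.d y j ≤ thr) ∧
    (∀ j < I.n, ¬ I.d y j ≤ thr → thr + G ≤ I.d y j) ∧ 0 < G ∧ I.Φ y ≤ I.n ^ 3 * G ^ 2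

/-- Consecutive gaps of at most G bound the spread by n G. Since Φ > 0, the value G = 0 is
impossible, so a gap was recorded; by sortedness no error lies strictly inside it. -/
theorem isGap_of_sorted {y : ℕ → ℝ} {thr G : ℝ} {idx : ℕ → ℕ} (hy : ∀ j < I.n, 0 < y j)
    (hΦ : 0 < I.Φ y) (hs : SortedBy (I.d y) I.n idx)
    (hG : ∀ k, k + 1 < I.n → I.d y (idx (k + 1)) - I.d y (idx k) ≤ G)
    (hG' : G = 0 ∨ 0 < G ∧ ∃ k, k + 1 < I.n ∧ G = I.d y (idx (k + 1)) - I.d y (idx k) ∧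
      thr = I.d y (idx k)) : IsGap I y thr G := by
  have hG0 : 0 ≤ G := by rcases hG' with h | h; exacts [h.ge, h.1.le]
  have hstep : ∀ b < I.n, ∀ a ≤ b, I.d y (idx b) - I.d y (idx a) ≤ (b - a : ℕ) * G := by
    intro b
    induction b with
    | zero => intro _ a ha; simp [Nat.le_zero.1 ha]
    | succ b ih =>
      intro hb a ha
      rcases Nat.lt_or_ge a (b + 1) with h | h
      · have h1 := ih (by omega) a (by omega)
        have h2 := hG b hb
        rw [show b + 1 - a = (b - a) + 1 by omega]
        push_cast
        linarith
      · obtain rfl : a = b + 1 := by omega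
        simp
  have hbound : I.Φ y ≤ I.n ^ 3 * G ^ 2 := by
    refine Inst.Φ_le_of_gap hy fun j hj l hl => ?_
    obtain ⟨b, hb, rfl⟩ := hs.2.1 j hj
    obtain ⟨a, ha, rfl⟩ := hs.2.1 l hl
    rcases le_total a b with h | h
    · refine (hstep b hb a h).trans (mul_le_mul_of_nonneg_right ?_ hG0)
      exact_mod_cast (by omega : b - a ≤ I.n)
    · have := hs.2.2 b a h ha
      have : 0 ≤ I.n * G := by positivity
      linarith
  -- With G = 0 the bound just proved would make Φ vanish.
  rcases hG' with h | ⟨hpos, k, hk, hGk, hthr⟩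
  · rw [h] at hbound
    norm_num at hbound
    linarith
  refine ⟨⟨idx k, hs.1 k (by omega), hthr.ge⟩, ⟨idx (k + 1), hs.1 _ hk, ?_⟩, ?_, hpos, hbound⟩
  · rw [hthr]
    linarith
  · intro j hj hj'
    obtain ⟨b, hb, rfl⟩ := hs.2.1 j hj
    rcases Nat.lt_or_ge k b with h | h
    · have := hs.2.2 (k + 1) b h hb
      rw [hthr]
      linarith
    · exact absurd (hthr ▸ hs.2.2 b k h (by omega)) hj'

theorem SortedBy.congr {K K' : ℕ → ℝ} {N : ℕ} {idx : ℕ → ℕ} (h : SortedBy K N idx)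
    (hK : ∀ i < N, K i = K' i) : SortedBy K' N idx :=
  ⟨h.1, h.2.1, fun a b hab hb => by
    rw [← hK _ (h.1 a (by omega)), ← hK _ (h.1 b hb)]
    exact h.2.2 a b hab hb⟩

/-- An upper bound for the cost of sorting at most `I.X` numbers. -/
def Inst.sortCost (I : Inst) : ℕ := (Nat.log 2 I.X + 1) * (I.X * 50)

theorem sortCost_le {N : ℕ} (h : N ≤ I.X) :
    (Nat.log 2 N + 1) * (N * 31 + 10) + N * 3 + 4 ≤ I.sortCost := by
  have h1 : 1 ≤ I.X := by simp [Inst.X]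
  have h2 : Nat.log 2 N ≤ Nat.log 2 I.X := Nat.log_mono_right h
  calc (Nat.log 2 N + 1) * (N * 31 + 10) + N * 3 + 4
      ≤ (Nat.log 2 I.X + 1) * (I.X * 31 + 10) + I.X * 3 + 4 := by gcongr
    _ ≤ I.sortCost := by
      rw [Inst.sortCost]
      nlinarith [Nat.zero_le (Nat.log 2 I.X), Nat.zero_le (Nat.log 2 I.X * (I.X - 1))]

theorem runs_gapP {y : ℕ → ℝ} (hE : Env I ε σ) (hV : Evald I ε y σ) (hy : ∀ j < I.n, 0 < y j)
    (hΦ : 0 < I.Φ y) :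
    Runs gapP σ (I.sortCost + 15 * I.X) fun τ => IsGap I y (τ.real 22 0) (τ.real 21 0) := by
  refine Runs.le (N := I.sortCost + (1 + ((I.n - 1) * (7 + 2) + 2))) ?_
    (by simp only [Inst.X]; omega)
  refine Runs.seq' ((runs_sortIdx (Nr := 1) (by norm_num) hE.n1).le
    (sortCost_le (by simp only [Inst.X]; omega))) fun σ₁ F₁ h₁ => ?_
  have E₁ := hE.frame F₁ rfl
  have d₁ : ∀ j < I.n, σ₁.real 16 j = I.d y j := by rw [F₁.2 16 rfl]; exact hV.d
  have hs := h₁.congr hV.d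
  refine Runs.seq' (Mid := fun τ => τ.real 21 0 = 0) (Runs.block ?_) fun σ₂ F₂ h₂ => ?_
  · simp [wp, Instr.Defined, Instr.step]
  have E₂ := E₁.frame F₂ rfl
  have d₂ : ∀ j < I.n, σ₂.real 16 j = I.d y j := by rw [F₂.2 16 rfl]; exact d₁
  have i₂ : σ₂.nat 22 = σ₁.nat 22 := F₂.1 22 rfl
  -- The value 0 in real register 21 means that no positive gap has been found yet, and the
  -- threshold in register 22 is then meaningless.
  refine (Runs.forLoop (c := 7) (fun k τ =>
    (∀ l < k, I.d y (σ₁.nat 22 (l + 1)) - I.d y (σ₁.nat 22 l) ≤ τ.real 21 0) ∧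
    (τ.real 21 0 = 0 ∨ 0 < τ.real 21 0 ∧ ∃ l, l + 1 < I.n ∧
      τ.real 21 0 = I.d y (σ₁.nat 22 (l + 1)) - I.d y (σ₁.nat 22 l) ∧
      τ.real 22 0 = I.d y (σ₁.nat 22 l))) E₂.n41 rfl rfl (by decide) ?_ ?_).mono le_rfl ?_
  · rintro k hk τ hF h10 hN ⟨hb, hb'⟩
    have d₃ : ∀ j < I.n, τ.real 16 j = I.d y j := by rw [hF.2 16 rfl]; exact d₂
    have i₃ : τ.nat 22 = σ₁.nat 22 := by rw [hF.1 22 rfl, i₂]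
    have hk1 : k + 1 < I.n := by omega
    have a1 := d₃ _ (hs.1 k (by omega))
    have a2 := d₃ _ (hs.1 (k + 1) hk1)
    refine Runs.seq' (N := 4) (M := 3) (Mid := fun τ' => τ'.nat 11 0 = σ₁.nat 22 k ∧
      τ'.real 20 0 = I.d y (σ₁.nat 22 (k + 1)) - I.d y (σ₁.nat 22 k)) (Runs.block ?_)
      fun τ' F' h' => Runs.ite' (N := 2) (M := 0) (fun h => Runs.block ?_) fun h => Runs.skip ?_
    · simp [wp, Instr.Defined, Instr.step, Cell.eval, h10, i₃, a1, a2]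
    · have e16 := F'.2 16 rfl
      have e21 := F'.2 21 rfl
      simp only [Test.Holds, Cell.eval, Ix.eval_lit, e21, h'.2] at h
      simp [wp, Instr.Defined, Instr.step, Cell.eval, h'.1, h'.2, e16, a1]
      refine ⟨fun l hl => ?_, Or.inr ⟨?_, k, hk1, rfl, rfl⟩⟩
      · rcases Nat.lt_or_ge l k with hlk | hlk
        · have := hb l hlk
          linarith
        · rw [show l = k by omega]
          linarith
      · rcases hb' with h0 | h0
        · linarith
        · linarith [h0.1]
    · have e22 := F'.2 22 rfl
      have e21 := F'.2 21 rfl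
      simp only [Test.Holds, Cell.eval, Ix.eval_lit, e21, h'.2, not_lt] at h
      simp only [State.setNat_real, e22, e21]
      refine ⟨fun l hl => ?_, hb'⟩
      rcases Nat.lt_or_ge l k with hlk | hlk
      · exact hb l hlk
      · rwa [show l = k by omega]
  · simp [h₂]
  · rintro τ hF ⟨hb, hb'⟩
    exact isGap_of_sorted hy hΦ hs (fun k hk => hb k (by omega)) hb'

theorem runs_selectP (hE : Env I ε σ) : Runs selectP σ (10 * I.X) fun τ =>
    ∀ j < I.n, (τ.nat 6 j = 1 ∧ σ.real 16 j ≤ σ.real 22 0) ∨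
      (τ.nat 6 j = 0 ∧ ¬ σ.real 16 j ≤ σ.real 22 0) := by
  refine Runs.le (N := I.n * (3 + 2) + 2) ?_ (by simp only [Inst.X]; omega)
  refine Runs.forLoop (fun k τ => ∀ j < k, (τ.nat 6 j = 1 ∧ σ.real 16 j ≤ σ.real 22 0) ∨
      (τ.nat 6 j = 0 ∧ ¬ σ.real 16 j ≤ σ.real 22 0)) hE.n1 rfl rfl (by decide) ?_ (by simp)
  intro k hk τ hF h10 hN h
  refine Runs.ite' (N := 1) (M := 1) (fun hb => Runs.block ?_) fun hb => Runs.block ?_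
  all_goals
    simp only [Test.Holds, Cell.eval, Ix.eval_lit, Ix.eval_reg, h10, hF.2 16 rfl, hF.2 22 rfl] at hb
    simp [wp, Instr.Defined, Instr.step, h10]
    intro j hj
    by_cases hjk : j = k
    · simpa [hjk] using hb
    · simpa [hjk] using h j (by omega)

end

/-! ### The estimated movement and the choice of the factor -/

/-- The shares, weights and breakpoints for the set `T` of columns are in memory. -/
structure Shares (I : Inst) (y : ℕ → ℝ) (T : ℕ → Prop) [DecidablePred T] (θ : ℝ) (σ : State) :
    Prop where
  f : ∀ i < I.m, σ.real 26 i = I.f y T i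
  W : ∀ e < I.E, σ.real 28 e = I.W y T e
  t : ∀ i < I.m, σ.real 29 i = if 0 < I.f y T i then 1 / I.f y T i else 0
  tm : σ.real 29 I.m = 0
  θ : σ.real 24 0 = θ

section

variable {I : Inst} {ε : ℝ} {σ σ' : State} {y : ℕ → ℝ} {T : ℕ → Prop} [DecidablePred T] {θ : ℝ}

theorem Shares.frame {P : Program} (h : Shares I y T θ σ) (hF : Frame P σ σ')
    (hk : P.keeps [] [26, 28, 29, 24] = true) : Shares I y T θ σ' where
  f := by rw [hF.real_of_keeps hk (by simp)]; exact h.f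
  W := by rw [hF.real_of_keeps hk (by simp)]; exact h.W
  t := by rw [hF.real_of_keeps hk (by simp)]; exact h.t
  tm := by rw [hF.real_of_keeps hk (by simp)]; exact h.tm
  θ := by rw [hF.real_of_keeps hk (by simp)]; exact h.θ

theorem runs_shareP (hE : Env I ε σ) (hB : ∀ e < I.E, σ.real 14 e = I.B y e)
    (hy : ∀ j < I.n, 0 < y j) (hT : ∀ j < I.n, (σ.nat 6 j = 1 ∧ T j) ∨ (σ.nat 6 j = 0 ∧ ¬ T j)) :
    Runs shareP σ (50 * I.X) (Shares I y T (σ.real 21 0 / 4)) := by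
  have hTc : ∀ e < I.E, (σ.nat 6 (I.col e) = 1 ∧ T (I.col e)) ∨
      (σ.nat 6 (I.col e) = 0 ∧ ¬ T (I.col e)) := fun e he => hT _ (I.col_lt e he)
  refine Runs.le (N := (I.m * 3 + 2) + ((I.E * (5 + 2) + 2) + ((I.m * 3 + 2) +
    ((I.E * (8 + 2) + 2) + ((I.m * (3 + 2) + 2) + 2))))) ?_ (by simp only [Inst.X]; omega)
  refine Runs.seq' (Runs.forLoop (c := 1) (fun k τ => ∀ i < k, τ.real 25 i = 0) hE.n0 rfl rfl
    (by decide) ?_ (by simp)) fun σ₁ F₁ h₁ => ?_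
  · intro k hk τ hF h10 hN h
    refine Runs.block ?_
    simp [wp, Instr.Defined, Instr.step, h10]
    intro i hi hik
    exact h i (by omega)
  have E₁ := hE.frame F₁ rfl
  have B₁ : ∀ e < I.E, σ₁.real 14 e = I.B y e := by rw [F₁.2 14 rfl]; exact hB
  have n₁ : σ₁.nat 6 = σ.nat 6 := F₁.1 6 rfl
  refine Runs.seq' (Runs.forLoop (c := 5) (fun k τ => ∀ i < I.m, τ.real 25 i =
    scat I.row (fun e => if T (I.col e) then I.B y e else 0) k i) E₁.n2 rfl rfl (by decide) ?_ ?_)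
    fun σ₂ F₂ h₂ => ?_
  · intro k hk τ hF h10 hN h
    have J := E₁.frame hF rfl
    have n₂ : τ.nat 6 = σ.nat 6 := by rw [hF.1 6 rfl, n₁]
    have b₂ : τ.real 14 k = I.B y k := by rw [hF.2 14 rfl, B₁ k hk]
    refine Runs.seq' (N := 3) (M := 2) (Mid := fun τ' => τ'.nat 11 0 = I.row k ∧
      τ'.nat 13 0 = σ.nat 6 (I.col k)) (Runs.block ?_) fun τ' F' h' =>
      Runs.ite' (N := 1) (M := 0) (fun hb => Runs.block ?_) fun hb => Runs.skip ?_
    · simp [wp, Instr.Defined, Instr.step, h10, J.n3, J.n4, n₂]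
    · have hTk : T (I.col k) := by
        rcases hTc k hk with h | h
        · exact h.2
        · simp [Test.Holds, h'.2, h.1] at hb
      have e10 : τ'.nat 10 0 = k := by rw [F'.1 10 rfl, h10]
      simp [wp, Instr.Defined, Instr.step, Cell.eval, h'.1, e10, F'.2 25 rfl, F'.2 14 rfl, b₂,
        scat_succ, hTk]
      intro i hi
      by_cases hik : i = I.row k
      · simp [hik, h _ (I.row_lt k hk)]
      · simp [hik, Ne.symm hik, h i hi]
    · have hTk : ¬ T (I.col k) := by
        rcases hTc k hk with h | h
        · simp [Test.Holds, h'.2, h.1] at hb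
        · exact h.2
      intro i hi
      simp [F'.2 25 rfl, scat_succ, hTk, h i hi]
  · intro i hi
    simp [h₁ i hi]
  have E₂ := E₁.frame F₂ rfl
  have B₂ : ∀ e < I.E, σ₂.real 14 e = I.B y e := by rw [F₂.2 14 rfl]; exact B₁
  have n₂ : σ₂.nat 6 = σ.nat 6 := by rw [F₂.1 6 rfl, n₁]
  refine Runs.seq' (Runs.forLoop (c := 1) (fun k τ => ∀ i < k, τ.real 26 i = I.f y T i)
    E₂.n0 rfl rfl (by decide) ?_ (by simp)) fun σ₃ F₃ h₃ => ?_
  · intro k hk τ hF h10 hN h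
    have J := E₂.frame hF rfl
    have e25 : τ.real 25 k = scat I.row (fun e => if T (I.col e) then I.B y e else 0) I.E k := by
      rw [hF.2 25 rfl, h₂ k hk]
    refine Runs.block ?_
    simp [wp, Instr.Defined, Instr.step, Cell.eval, h10, e25, J.r1, (I.r_pos k hk).ne']
    intro i hi
    split_ifs with hik
    · rw [hik, Inst.f]
    · exact h i (by omega)
  have E₃ := E₂.frame F₃ rfl
  have B₃ : ∀ e < I.E, σ₃.real 14 e = I.B y e := by rw [F₃.2 14 rfl]; exact B₂
  have n₃ : σ₃.nat 6 = σ.nat 6 := by rw [F₃.1 6 rfl, n₂]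
  refine Runs.seq' (Runs.forLoop (c := 8) (fun k τ => ∀ e < k, τ.real 28 e = I.W y T e)
    E₃.n2 rfl rfl (by decide) ?_ (by simp)) fun σ₄ F₄ h₄ => ?_
  · intro k hk τ hF h10 hN h
    have J := E₃.frame hF rfl
    have n₄ : τ.nat 6 = σ.nat 6 := by rw [hF.1 6 rfl, n₃]
    have b₄ : τ.real 14 k = I.B y k := by rw [hF.2 14 rfl, B₃ k hk]
    have f₄ : τ.real 26 (I.row k) = I.f y T (I.row k) := by
      rw [hF.2 26 rfl, h₃ _ (I.row_lt k hk)]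
    refine Runs.seq' (N := 3) (M := 5) (Mid := fun τ' => τ'.nat 11 0 = I.row k ∧
      τ'.nat 13 0 = σ.nat 6 (I.col k)) (Runs.block ?_) fun τ' F' h' =>
      Runs.ite' (N := 3) (M := 1) (fun hb => Runs.block ?_) fun hb => Runs.block ?_
    · simp [wp, Instr.Defined, Instr.step, h10, J.n3, J.n4, n₄]
    · have hTk : T (I.col k) := by
        rcases hTc k hk with h | h
        · exact h.2
        · simp [Test.Holds, h'.2, h.1] at hb
      have e10 : τ'.nat 10 0 = k := by rw [F'.1 10 rfl, h10]
      simp [wp, Instr.Defined, Instr.step, Cell.eval, h'.1, e10, F'.2 26 rfl, F'.2 14 rfl, b₄, f₄,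
        F'.2 10 rfl, J.one, (Inst.f_pos hy hk hTk).ne']
      intro e he
      rw [F'.2 28 rfl]
      split_ifs with hek
      · rw [hek, Inst.W, if_pos hTk]
      · exact h e (by omega)
    · have hTk : ¬ T (I.col k) := by
        rcases hTc k hk with h | h
        · simp [Test.Holds, h'.2, h.1] at hb
        · exact h.2
      have e10 : τ'.nat 10 0 = k := by rw [F'.1 10 rfl, h10]
      simp [wp, Instr.Defined, Instr.step, Cell.eval, e10, F'.2 14 rfl, b₄]
      intro e he
      rw [F'.2 28 rfl]
      split_ifs with hek
      · rw [hek, Inst.W, if_neg hTk]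
      · exact h e (by omega)
  have E₄ := E₃.frame F₄ rfl
  have f₄ : ∀ i < I.m, σ₄.real 26 i = I.f y T i := by rw [F₄.2 26 rfl]; exact h₃
  refine Runs.seq' (Runs.forLoop (c := 3) (fun k τ => ∀ i < k, τ.real 29 i =
    if 0 < I.f y T i then 1 / I.f y T i else 0) E₄.n0 rfl rfl (by decide) ?_ (by simp))
    fun σ₅ F₅ h₅ => ?_
  · intro k hk τ hF h10 hN h
    have J := E₄.frame hF rfl
    have e26 : τ.real 26 k = I.f y T k := by rw [hF.2 26 rfl, f₄ k hk]
    refine Runs.ite' (N := 1) (M := 1) (fun hb => Runs.block ?_) fun hb => Runs.block ?_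
    all_goals
      simp only [Test.Holds, Cell.eval, Ix.eval_lit, Ix.eval_reg, h10, J.zero, e26] at hb
    · simp [wp, Instr.Defined, Instr.step, Cell.eval, h10, J.one, e26, hb.ne']
      intro i hi
      by_cases hik : i = k
      · simp [hik, hb]
      · simpa [hik] using h i (by omega)
    · simp [wp, Instr.Defined, Instr.step, h10]
      intro i hi
      by_cases hik : i = k
      · simp [hik, hb]
      · simpa [hik] using h i (by omega)
  have E₅ := E₄.frame F₅ rfl
  have f₅ : ∀ i < I.m, σ₅.real 26 i = I.f y T i := by rw [F₅.2 26 rfl]; exact f₄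
  have W₅ : ∀ e < I.E, σ₅.real 28 e = I.W y T e := by rw [F₅.2 28 rfl]; exact h₄
  have e21 : σ₅.real 21 = σ.real 21 := by
    rw [F₅.2 21 rfl, F₄.2 21 rfl, F₃.2 21 rfl, F₂.2 21 rfl, F₁.2 21 rfl]
  refine Runs.block ?_
  refine ⟨trivial, ?_, ?_⟩
  · simp [Instr.Defined, Instr.step, Cell.eval, E₅.four]
  · constructor
    · simpa [Instr.step] using f₅
    · simpa [Instr.step] using W₅
    · intro i hi
      simp [Instr.step, E₅.n0, hi.ne, h₅ i hi]
    · simp [Instr.step, E₅.n0]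
    · simp [Instr.step, Cell.eval, E₅.four, e21]

/-- The result of `moveP`. -/
def Moved (I : Inst) (y : ℕ → ℝ) (T : ℕ → Prop) [DecidablePred T] (θ β : ℝ) (σ : State) : Prop :=
  (∀ j < I.n, σ.real 32 j = I.g y T β j) ∧
    ((σ.nat 36 0 = 1 ∧ ∃ j < I.n, θ ≤ I.g y T β j) ∨
      (σ.nat 36 0 = 0 ∧ ∀ j < I.n, I.g y T β j < θ))

theorem runs_moveP (hE : Env I ε σ) (hS : Shares I y T θ σ) :
    Runs moveP σ (25 * I.X) (Moved I y T θ (σ.real 30 0)) := by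
  set β := σ.real 30 0 with hβ
  refine Runs.le (N := (I.n * 3 + 2) + ((I.E * (7 + 2) + 2) + (1 + (I.n * (2 + 2) + 2)))) ?_
    (by simp only [Inst.X]; omega)
  refine Runs.seq' (Runs.forLoop (c := 1) (fun k τ => ∀ i < k, τ.real 32 i = 0) hE.n1 rfl rfl
    (by decide) ?_ (by simp)) fun σ₁ F₁ h₁ => ?_
  · intro k hk τ hF h10 hN h
    refine Runs.block ?_
    simp [wp, Instr.Defined, Instr.step, h10]
    intro i hi hik
    exact h i (by omega)
  have E₁ := hE.frame F₁ rfl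
  have S₁ := hS.frame F₁ rfl
  have b₁ : σ₁.real 30 0 = β := by rw [F₁.2 30 rfl]
  refine Runs.seq' (Runs.forLoop (c := 7) (fun k τ => ∀ j < I.n, τ.real 32 j =
    scat I.col (fun e => min (β * I.f y T (I.row e)) 1 * I.W y T e) k j) E₁.n2 rfl rfl (by decide)
    ?_ ?_) fun σ₂ F₂ h₂ => ?_
  · intro k hk τ hF h10 hN h
    have J := E₁.frame hF rfl
    have S := S₁.frame hF rfl
    have b₂ : τ.real 30 0 = β := by rw [hF.2 30 rfl, b₁]
    have f₂ := S.f _ (I.row_lt k hk)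
    have W₂ := S.W k hk
    refine Runs.seq' (N := 3) (M := 4) (Mid := fun τ' => τ'.nat 12 0 = I.col k ∧
      τ'.real 31 0 = β * I.f y T (I.row k)) (Runs.block ?_) fun τ' F' h' =>
      Runs.seq' (N := 2) (M := 2) (Mid := fun τ' => τ'.nat 12 0 = I.col k ∧
        τ'.real 31 0 = min (β * I.f y T (I.row k)) 1) (Runs.ite' (N := 1) (M := 0)
          (fun hb => Runs.block ?_) fun hb => Runs.skip ?_) fun τ'' F'' h'' => Runs.block ?_
    · simp [wp, Instr.Defined, Instr.step, Cell.eval, h10, J.n3, J.n4, b₂, f₂]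
    · simp only [Test.Holds, Cell.eval, Ix.eval_lit, h'.2, F'.2 10 rfl, J.one] at hb
      simp [wp, Instr.Defined, Instr.step, Cell.eval, h'.1, F'.2 10 rfl, J.one, hb.le]
    · simp only [Test.Holds, Cell.eval, Ix.eval_lit, h'.2, F'.2 10 rfl, J.one, not_lt] at hb
      exact ⟨h'.1, by rw [h'.2, min_eq_left hb]⟩
    · have e10 : τ''.nat 10 0 = k := by rw [F''.1 10 rfl, F'.1 10 rfl, h10]
      have e28 : τ''.real 28 = τ.real 28 := by rw [F''.2 28 rfl, F'.2 28 rfl]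
      have e32 : τ''.real 32 = τ.real 32 := by rw [F''.2 32 rfl, F'.2 32 rfl]
      simp [wp, Instr.Defined, Instr.step, Cell.eval, h''.1, h''.2, e10, e28, e32, W₂, scat_succ]
      intro j hj
      by_cases hjk : j = I.col k
      · simp [hjk, h _ (I.col_lt k hk)]
      · simp [hjk, Ne.symm hjk, h j hj]
  · intro j hj
    simp [h₁ j hj]
  have E₂ := E₁.frame F₂ rfl
  have S₂ := S₁.frame F₂ rfl
  refine Runs.seq' (Mid := fun τ => τ.nat 36 0 = 0) (Runs.block ?_) fun σ₃ F₃ h₃ => ?_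
  · simp [wp, Instr.Defined, Instr.step]
  have E₃ := E₂.frame F₃ rfl
  have S₃ := S₂.frame F₃ rfl
  have g₃ : ∀ j < I.n, σ₃.real 32 j = I.g y T β j := by rw [F₃.2 32 rfl]; exact h₂
  refine (Runs.forLoop (c := 2) (fun k τ => ((τ.nat 36 0 = 1 ∧ ∃ j < I.n, θ ≤ I.g y T β j) ∨
      (τ.nat 36 0 = 0 ∧ ∀ j < k, I.g y T β j < θ))) E₃.n1 rfl rfl (by decide) ?_ ?_).mono le_rfl ?_
  · intro k hk τ hF h10 hN h
    have S := S₃.frame hF rfl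
    have gk : τ.real 32 k = I.g y T β k := by rw [hF.2 32 rfl, g₃ k hk]
    refine Runs.ite' (N := 1) (M := 0) (fun hb => Runs.block ?_) fun hb => Runs.skip ?_
    · simp only [Test.Holds, Cell.eval, Ix.eval_lit, Ix.eval_reg, h10, gk, S.θ] at hb
      simp [wp, Instr.Defined, Instr.step]
      exact ⟨k, hk, hb⟩
    · simp only [Test.Holds, Cell.eval, Ix.eval_lit, Ix.eval_reg, h10, gk, S.θ, not_le] at hb
      rcases h with h | ⟨h, h'⟩
      · exact Or.inl (by simpa using h)
      · refine Or.inr ⟨by simpa using h, fun j hj => ?_⟩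
        rcases Nat.lt_or_ge j k with hjk | hjk
        · exact h' j hjk
        · rwa [show j = k by omega]
  · simp [h₃]
  · intro τ hF h
    exact ⟨by rw [hF.2 32 rfl]; exact g₃, h⟩

/-- The sorted breakpoint at position `k`. -/
def bp (σ : State) (k : ℕ) : ℝ := σ.real 29 (σ.nat 22 k)

theorem bp_frame {P : Program} (hF : Frame P σ σ') (hk : P.keeps [22] [29] = true) (k : ℕ) :
    bp σ' k = bp σ k := by
  rw [bp, bp, hF.real_of_keeps hk (by simp), hF.nat_of_keeps hk (by simp)]

theorem runs_moveAtP (v : ℕ) (hE : Env I ε σ) (hS : Shares I y T θ σ) :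
    Runs (moveAtP v) σ (25 * I.X + 2) fun τ => Moved I y T θ (bp σ (σ.nat v 0)) τ ∧
      τ.real 30 0 = bp σ (σ.nat v 0) := by
  refine Runs.le (N := 2 + 25 * I.X) ?_ (by omega)
  refine Runs.seq' (Mid := fun τ => τ.real 30 0 = bp σ (σ.nat v 0)) (Runs.block ?_)
    fun σ₁ F₁ h₁ => ?_
  · simp [wp, Instr.Defined, Instr.step, Cell.eval, bp]
  have := runs_moveP (hE.frame F₁ rfl) (hS.frame F₁ rfl)
  rw [h₁] at this
  exact this.mono le_rfl fun τ hF h => ⟨h, by rw [hF.2 30 rfl, h₁]⟩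

/-- The result of the binary search. -/
def Bracket (I : Inst) (y : ℕ → ℝ) (T : ℕ → Prop) [DecidablePred T] (θ : ℝ) (t : ℕ → ℝ)
    (lo hi : ℕ) : Prop :=
  lo < hi ∧ hi ≤ I.m ∧ (∀ j < I.n, I.g y T (t lo) j < θ) ∧ ∃ j < I.n, θ ≤ I.g y T (t hi) j

/-- The lower end keeps all estimates below θ and the upper end has one that reaches θ. The midpoint
satisfies one of the two alternatives, so monotonicity of the estimates is not used. Halving is
recorded as `(hi - lo - 1) * 2 ^ k ≤ m`, which bounds the rounds by a logarithm. -/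
theorem runs_searchP (hE : Env I ε σ) (hS : Shares I y T θ σ)
    (h0 : ∀ j < I.n, I.g y T (bp σ 0) j < θ) (h1 : ∃ j < I.n, θ ≤ I.g y T (bp σ I.m) j) :
    Runs searchP σ ((Nat.log 2 I.X + 1) * (40 * I.X)) fun τ =>
      Bracket I y T θ (bp σ) (τ.nat 33 0) (τ.nat 34 0) ∧ τ.nat 34 0 = τ.nat 33 0 + 1 := by
  have hX : 1 ≤ I.X := by simp [Inst.X]
  have hmX : I.m ≤ I.X := by simp only [Inst.X]; omega
  refine Runs.le (N := 3 + ((Nat.log 2 I.m + 1) * ((25 * I.X + 8) + 1) + 1)) ?_ ?_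
  swap
  · have h2 : Nat.log 2 I.m ≤ Nat.log 2 I.X := Nat.log_mono_right hmX
    calc _ ≤ 3 + ((Nat.log 2 I.X + 1) * ((25 * I.X + 8) + 1) + 1) := by gcongr
      _ ≤ _ := by nlinarith [Nat.zero_le (Nat.log 2 I.X), Nat.zero_le (Nat.log 2 I.X * (I.X - 1))]
  have hm : 0 < I.m := by
    rcases Nat.eq_zero_or_pos I.m with h | h
    · obtain ⟨j, hj, hj'⟩ := h1
      rw [h] at hj'
      exact absurd hj' (not_le.2 (h0 j hj))
    · exact h
  refine Runs.seq' (Mid := fun τ => τ.nat 33 0 = 0 ∧ τ.nat 34 0 = I.m ∧ τ.nat 37 0 = 1)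
    (Runs.block ?_) fun σ₁ F₁ h₁ => ?_
  · simp [wp, Instr.Defined, Instr.step, hE.n0]
  have E₁ := hE.frame F₁ rfl
  have S₁ := hS.frame F₁ rfl
  have b₁ := bp_frame F₁ rfl
  refine (Runs.whileLoop (c := 25 * I.X + 8) (T := Nat.log 2 I.m + 1) (fun k τ =>
    Bracket I y T θ (bp σ) (τ.nat 33 0) (τ.nat 34 0) ∧ τ.nat 37 0 = τ.nat 33 0 + 1 ∧
    (τ.nat 34 0 - τ.nat 33 0 - 1) * 2 ^ k ≤ I.m) ?_ ?_).mono le_rfl ?_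
  · rintro k τ hF ⟨⟨a1, a2, a3, a4⟩, a5, a6⟩ hb
    have E₂ := E₁.frame hF rfl
    have S₂ := S₁.frame hF rfl
    have b₂ : ∀ k, bp τ k = bp σ k := fun k => by rw [bp_frame hF rfl, b₁]
    simp only [Test.Holds, Ix.eval_reg, a5] at hb
    refine ⟨?_, ?_⟩
    · have : 2 ^ k ≤ I.m := by
        calc 2 ^ k = 1 * 2 ^ k := (one_mul _).symm
          _ ≤ (τ.nat 34 0 - τ.nat 33 0 - 1) * 2 ^ k := by gcongr; omega
          _ ≤ I.m := a6
      have := Nat.le_log_of_pow_le (by norm_num) this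
      omega
    set lo := τ.nat 33 0
    set hi := τ.nat 34 0
    refine Runs.le (N := 2 + ((25 * I.X + 2) + (3 + 1))) ?_ (by omega)
    refine Runs.seq' (Mid := fun τ' => τ'.nat 35 0 = (lo + hi) / 2) (Runs.block ?_)
      fun τ₁ G₁ g₁ => ?_
    · simp [wp, Instr.Defined, Instr.step, lo, hi]
    refine Runs.seq' (runs_moveAtP 35 (E₂.frame G₁ rfl) (S₂.frame G₁ rfl)) fun τ₂ G₂ g₂ => ?_
    have l₂ : τ₂.nat 33 0 = lo := by rw [G₂.1 33 rfl, G₁.1 33 rfl]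
    have u₂ : τ₂.nat 34 0 = hi := by rw [G₂.1 34 rfl, G₁.1 34 rfl]
    have m₂ : τ₂.nat 35 0 = (lo + hi) / 2 := by rw [G₂.1 35 rfl, g₁]
    rw [bp_frame G₁ rfl, b₂, g₁] at g₂
    refine Runs.seq' (Mid := fun τ' => Bracket I y T θ (bp σ) (τ'.nat 33 0) (τ'.nat 34 0) ∧
      (τ'.nat 34 0 - τ'.nat 33 0 - 1) * 2 ^ (k + 1) ≤ I.m) (Runs.ite' (N := 1) (M := 1)
        (fun hc => Runs.block ?_) fun hc => Runs.block ?_) fun τ₃ G₃ g₃ => Runs.block ?_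
    · simp only [Test.Holds, Ix.eval_reg, Ix.eval_lit] at hc
      simp [wp, Instr.Defined, Instr.step, u₂, m₂]
      have hg : ∀ j < I.n, I.g y T (bp σ ((lo + hi) / 2)) j < θ := by
        rcases g₂.1.2 with h | h
        · omega
        · exact h.2
      refine ⟨⟨by omega, a2, hg, a4⟩, le_trans ?_ a6⟩
      rw [pow_succ, ← mul_assoc, mul_right_comm]
      gcongr
      omega
    · simp only [Test.Holds, Ix.eval_reg, Ix.eval_lit] at hc
      simp [wp, Instr.Defined, Instr.step, l₂, m₂]
      have hg : ∃ j < I.n, θ ≤ I.g y T (bp σ ((lo + hi) / 2)) j := by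
        rcases g₂.1.2 with h | h
        · exact h.2
        · omega
      refine ⟨⟨by omega, by omega, a3, hg⟩, le_trans ?_ a6⟩
      rw [pow_succ, ← mul_assoc, mul_right_comm]
      gcongr
      omega
    · simpa [wp, Instr.Defined, Instr.step] using g₃
  · rw [h₁.1, h₁.2.1, h₁.2.2]
    refine ⟨⟨hm, le_rfl, h0, h1⟩, rfl, ?_⟩
    simp
  · rintro τ hF ⟨k, hk, ⟨a1, a2, a3⟩, hb⟩
    simp only [Test.Holds, Ix.eval_reg, a2] at hb
    exact ⟨a1, by have := a1.1; omega⟩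

/-- Between neighbouring breakpoints the estimates are linear. -/
theorem Inst.g_linear {tlo thi β : ℝ} (hy : ∀ j < I.n, 0 < y j) (h : tlo < thi)
    (hβ : tlo ≤ β) (hβ' : β ≤ thi)
    (ht : ∀ i < I.m, 0 < I.f y T i → 1 / I.f y T i ≤ tlo ∨ thi ≤ 1 / I.f y T i) (j : ℕ) :
    (I.g y T β j - I.g y T tlo j) * (thi - tlo) =
      (I.g y T thi j - I.g y T tlo j) * (β - tlo) := by
  -- No breakpoint lies strictly inside the interval. So each minimum is zero throughout (f = 0),
  -- constantly 1 (breakpoint at most `tlo`), or linear in β (breakpoint at least `thi`).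
  have key : ∀ e < I.E, (min (β * I.f y T (I.row e)) 1 - min (tlo * I.f y T (I.row e)) 1) *
      (thi - tlo) = (min (thi * I.f y T (I.row e)) 1 - min (tlo * I.f y T (I.row e)) 1) *
      (β - tlo) := by
    intro e he
    have hi := I.row_lt e he
    rcases (f_nonneg (T := T) hy hi).eq_or_lt with h1 | h1
    · simp [← h1]
    · rcases ht _ hi h1 with h2 | h2
      · rw [div_le_iff₀ h1] at h2
        rw [min_eq_right h2, min_eq_right (h2.trans (by gcongr)),
          min_eq_right (h2.trans (by gcongr))]
        ring
      · rw [le_div_iff₀ h1] at h2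
        rw [min_eq_left h2, min_eq_left (le_trans (by gcongr) h2),
          min_eq_left (le_trans (by gcongr) h2)]
        ring
  rw [g, g, g, ← scat_sub, ← scat_sub, mul_comm, mul_comm _ (β - tlo), ← scat_const_mul,
    ← scat_const_mul]
  refine scat_congr fun e he _ => ?_
  linear_combination I.W y T e * key e he

/-- The factor found by interpolation moves the columns by exactly the threshold. -/
theorem interp_spec {tlo thi β : ℝ} (hy : ∀ j < I.n, 0 < y j) (h0 : 0 ≤ tlo) (h : tlo < thi)
    (ht : ∀ i < I.m, 0 < I.f y T i → 1 / I.f y T i ≤ tlo ∨ thi ≤ 1 / I.f y T i)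
    (hlo : ∀ j < I.n, I.g y T tlo j < θ) (hhi : ∃ j < I.n, θ ≤ I.g y T thi j)
    (hβ : β = thi ∨ ∃ j < I.n, θ ≤ I.g y T thi j ∧ β = (θ - I.g y T tlo j) * (thi - tlo) /
      (I.g y T thi j - I.g y T tlo j) + tlo)
    (hβ' : ∀ j < I.n, θ ≤ I.g y T thi j → β ≤ (θ - I.g y T tlo j) * (thi - tlo) /
      (I.g y T thi j - I.g y T tlo j) + tlo) :
    0 ≤ β ∧ (∀ j < I.n, I.g y T β j ≤ θ) ∧ ∃ j < I.n, θ ≤ I.g y T β j := by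
  have hpos : ∀ j < I.n, θ ≤ I.g y T thi j → 0 < I.g y T thi j - I.g y T tlo j := fun j hj hj' => by
    linarith [hlo j hj]
  have hthi : ∀ j < I.n, θ ≤ I.g y T thi j → (θ - I.g y T tlo j) * (thi - tlo) /
      (I.g y T thi j - I.g y T tlo j) + tlo ≤ thi := fun j hj hj' => by
    have h1 := hpos j hj hj'
    have : (θ - I.g y T tlo j) * (thi - tlo) / (I.g y T thi j - I.g y T tlo j) ≤ thi - tlo := by
      rw [div_le_iff₀ h1]
      nlinarith
    linarith
  -- The value `thi` is only the start of a minimum. A column that reaches θ at `thi` has its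
  -- crossing point at or before `thi`, so the minimum is a crossing point in any case.
  obtain ⟨j₀, hj₀, hθ₀, he₀⟩ : ∃ j < I.n, θ ≤ I.g y T thi j ∧ β = (θ - I.g y T tlo j) *
      (thi - tlo) / (I.g y T thi j - I.g y T tlo j) + tlo := by
    rcases hβ with hβ | hβ
    · obtain ⟨j, hj, hj'⟩ := hhi
      exact ⟨j, hj, hj', le_antisymm (hβ' j hj hj') (hβ ▸ hthi j hj hj')⟩
    · exact hβ
  have hβlo : tlo ≤ β := by
    have h1 := hpos j₀ hj₀ hθ₀
    have h2 := hlo j₀ hj₀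
    have : 0 ≤ (θ - I.g y T tlo j₀) * (thi - tlo) / (I.g y T thi j₀ - I.g y T tlo j₀) :=
      div_nonneg (mul_nonneg (by linarith) (by linarith)) h1.le
    linarith
  have hβhi : β ≤ thi := (hβ' j₀ hj₀ hθ₀).trans (hthi j₀ hj₀ hθ₀)
  have hlin := Inst.g_linear (I := I) (T := T) hy h hβlo hβhi ht
  have hd : 0 < thi - tlo := by linarith
  refine ⟨h0.trans hβlo, fun j hj => ?_, j₀, hj₀, ?_⟩
  · by_cases hj' : θ ≤ I.g y T thi j
    · have h1 := hpos j hj hj'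
      have h2 := hβ' j hj hj'
      have h3 : (β - tlo) * (I.g y T thi j - I.g y T tlo j) ≤ (θ - I.g y T tlo j) * (thi - tlo) := by
        rw [← le_div_iff₀ h1]
        linarith
      have h4 : (I.g y T β j - I.g y T tlo j) * (thi - tlo) ≤
          (θ - I.g y T tlo j) * (thi - tlo) := by
        rw [hlin j]
        linarith
      have := le_of_mul_le_mul_right h4 hd
      linarith
    -- A column below θ at both ends stays below θ in between, by linearity.
    · have h1 := hlo j hj
      rw [not_le] at hj'
      have h3 : (I.g y T β j - I.g y T tlo j) * (thi - tlo) ≤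
          (θ - I.g y T tlo j) * (thi - tlo) := by
        rw [hlin j]
        nlinarith [mul_nonneg (sub_nonneg.2 hβlo) (sub_nonneg.2 hj'.le),
          mul_nonneg (sub_nonneg.2 h1.le) (sub_nonneg.2 hβhi)]
      have := le_of_mul_le_mul_right h3 hd
      linarith
  · have h1 := hpos j₀ hj₀ hθ₀
    have h3 : (θ - I.g y T tlo j₀) * (thi - tlo) ≤ (I.g y T β j₀ - I.g y T tlo j₀) * (thi - tlo) := by
      rw [hlin j₀, he₀, add_sub_cancel_right, mul_div_cancel₀ _ h1.ne']
    have := le_of_mul_le_mul_right h3 hd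
    linarith

theorem runs_interpP (hE : Env I ε σ) (hS : Shares I y T θ σ) (hy : ∀ j < I.n, 0 < y j)
    (hs : SortedBy (σ.real 29) (I.m + 1) (σ.nat 22))
    (hB : Bracket I y T θ (bp σ) (σ.nat 33 0) (σ.nat 34 0)) (hB' : σ.nat 34 0 = σ.nat 33 0 + 1) :
    Runs interpP σ (80 * I.X) fun τ => 0 ≤ τ.real 38 0 ∧
      (∀ j < I.n, I.g y T (τ.real 38 0) j ≤ θ) ∧ ∃ j < I.n, θ ≤ I.g y T (τ.real 38 0) j := by
  obtain ⟨b1, b2, b3, b4⟩ := hB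
  set lo := σ.nat 33 0 with hlo
  set hi := σ.nat 34 0 with hhi
  have hne : bp σ lo ≠ bp σ hi := fun h => by
    obtain ⟨j, hj, hj'⟩ := b4
    rw [← h] at hj'
    exact absurd hj' (not_le.2 (b3 j hj))
  have hlt : bp σ lo < bp σ hi := lt_of_le_of_ne (hs.2.2 lo hi b1.le (by omega)) hne
  have ht0 : ∀ i < I.m + 1, 0 ≤ σ.real 29 i := by
    intro i hi
    rcases Nat.lt_or_ge i I.m with h | h
    · rw [hS.t i h]
      split_ifs with h'
      · positivity
      · exact le_rfl
    · rw [show i = I.m by omega, hS.tm]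
  have h0 : 0 ≤ bp σ lo := ht0 _ (hs.1 lo (by omega))
  -- The two ends are neighbours in the sorted list, so every other breakpoint lies on one side of
  -- the interval.
  have ht : ∀ i < I.m, 0 < I.f y T i → 1 / I.f y T i ≤ bp σ lo ∨ bp σ hi ≤ 1 / I.f y T i := by
    intro i hi' hf
    obtain ⟨k, hk, he⟩ := hs.2.1 i (by omega)
    have e1 : 1 / I.f y T i = bp σ k := by rw [bp, he, hS.t i hi', if_pos hf]
    rw [e1]
    rcases Nat.lt_or_ge lo k with h | h
    · exact Or.inr (hs.2.2 hi k (by omega) hk)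
    · exact Or.inl (hs.2.2 k lo h (by omega))
  refine Runs.le (N := (25 * I.X + 2) + (1 + ((I.n * 3 + 2) + ((25 * I.X + 2) + (3 +
    (I.n * (8 + 2) + 2)))))) ?_ (by simp only [Inst.X]; omega)
  refine Runs.seq' (runs_moveAtP 33 hE hS) fun σ₁ F₁ h₁ => ?_
  have E₁ := hE.frame F₁ rfl
  have S₁ := hS.frame F₁ rfl
  refine Runs.seq' (Mid := fun τ => τ.real 52 0 = bp σ lo) (Runs.block ?_) fun σ₂ F₂ h₂ => ?_
  · simp [wp, Instr.Defined, Instr.step, Cell.eval, h₁.2, hlo]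
  have E₂ := E₁.frame F₂ rfl
  have S₂ := S₁.frame F₂ rfl
  have g₂ : ∀ j < I.n, σ₂.real 32 j = I.g y T (bp σ lo) j := by rw [F₂.2 32 rfl]; exact h₁.1.1
  refine Runs.seq' (Runs.forLoop (c := 1) (fun k τ => ∀ j < k, τ.real 33 j = I.g y T (bp σ lo) j)
    E₂.n1 rfl rfl (by decide) ?_ (by simp)) fun σ₃ F₃ h₃ => ?_
  · intro k hk τ hF h10 hN h
    have gk : τ.real 32 k = I.g y T (bp σ lo) k := by rw [hF.2 32 rfl, g₂ k hk]
    refine Runs.block ?_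
    simp [wp, Instr.Defined, Instr.step, Cell.eval, h10, gk]
    intro j hj
    split_ifs with hjk
    · rw [hjk]
    · exact h j (by omega)
  have E₃ := E₂.frame F₃ rfl
  have S₃ := S₂.frame F₃ rfl
  have e34 : σ₃.nat 34 0 = hi := by rw [F₃.1 34 rfl, F₂.1 34 rfl, F₁.1 34 rfl]
  have ebp : bp σ₃ hi = bp σ hi := by rw [bp_frame F₃ rfl, bp_frame F₂ rfl, bp_frame F₁ rfl]
  have e52 : σ₃.real 52 0 = bp σ lo := by rw [F₃.2 52 rfl, h₂]
  have hmv := runs_moveAtP 34 E₃ S₃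
  rw [e34, ebp] at hmv
  refine Runs.seq' hmv fun σ₄ F₄ h₄ => ?_
  have E₄ := E₃.frame F₄ rfl
  have S₄ := S₃.frame F₄ rfl
  refine Runs.seq' (Mid := fun τ => τ.real 35 0 = bp σ hi - bp σ lo ∧ τ.real 38 0 = bp σ hi)
    (Runs.block ?_) fun σ₅ F₅ h₅ => ?_
  · simp [wp, Instr.Defined, Instr.step, Cell.eval, h₄.2, F₄.2 52 rfl, e52]
  have E₅ := E₄.frame F₅ rfl
  have S₅ := S₄.frame F₅ rfl
  have ghi : ∀ j < I.n, σ₅.real 32 j = I.g y T (bp σ hi) j := by rw [F₅.2 32 rfl]; exact h₄.1.1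
  have glo : ∀ j < I.n, σ₅.real 33 j = I.g y T (bp σ lo) j := by
    rw [F₅.2 33 rfl, F₄.2 33 rfl]; exact h₃
  have t₅ : σ₅.real 52 0 = bp σ lo := by rw [F₅.2 52 rfl, F₄.2 52 rfl, e52]
  refine (Runs.forLoop (c := 8) (fun k τ => (τ.real 38 0 = bp σ hi ∨ ∃ j < I.n,
    θ ≤ I.g y T (bp σ hi) j ∧ τ.real 38 0 = (θ - I.g y T (bp σ lo) j) * (bp σ hi - bp σ lo) /
      (I.g y T (bp σ hi) j - I.g y T (bp σ lo) j) + bp σ lo) ∧ ∀ j < k, θ ≤ I.g y T (bp σ hi) j →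
      τ.real 38 0 ≤ (θ - I.g y T (bp σ lo) j) * (bp σ hi - bp σ lo) /
      (I.g y T (bp σ hi) j - I.g y T (bp σ lo) j) + bp σ lo) E₅.n1 rfl rfl (by decide) ?_
      ?_).mono le_rfl ?_
  · rintro k hk τ hF h10 hN ⟨ha, hb⟩
    have S := S₅.frame hF rfl
    have gh : τ.real 32 k = I.g y T (bp σ hi) k := by rw [hF.2 32 rfl, ghi k hk]
    have gl : τ.real 33 k = I.g y T (bp σ lo) k := by rw [hF.2 33 rfl, glo k hk]
    have e35 : τ.real 35 0 = bp σ hi - bp σ lo := by rw [hF.2 35 rfl, h₅.1]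
    have t₆ : τ.real 52 0 = bp σ lo := by rw [hF.2 52 rfl, t₅]
    have h38 : ∀ x : ℝ, x ≤ τ.real 38 0 → ∀ j < k, θ ≤ I.g y T (bp σ hi) j →
        x ≤ (θ - I.g y T (bp σ lo) j) * (bp σ hi - bp σ lo) /
          (I.g y T (bp σ hi) j - I.g y T (bp σ lo) j) + bp σ lo := fun x hx j hj hj' =>
      hx.trans (hb j hj hj')
    refine Runs.ite' (N := 7) (M := 0) (fun hc => ?_) fun hc => Runs.skip ?_
    · simp only [Test.Holds, Cell.eval, Ix.eval_lit, Ix.eval_reg, h10, gh, S.θ] at hc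
      have hd : I.g y T (bp σ hi) k - I.g y T (bp σ lo) k ≠ 0 := by
        have := b3 k hk
        intro h
        linarith
      refine Runs.seq' (N := 5) (M := 2) (Mid := fun τ' => τ'.real 37 0 =
        (θ - I.g y T (bp σ lo) k) * (bp σ hi - bp σ lo) /
          (I.g y T (bp σ hi) k - I.g y T (bp σ lo) k) + bp σ lo) (Runs.block ?_) fun τ' F' h' =>
        Runs.ite' (N := 1) (M := 0) (fun hc' => Runs.block ?_) fun hc' => Runs.skip ?_
      · simp [wp, Instr.Defined, Instr.step, Cell.eval, h10, gh, gl, e35, t₆, S.θ, hd]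
      · simp only [Test.Holds, Cell.eval, Ix.eval_lit, h', F'.2 38 rfl] at hc'
        simp only [wp, Instr.Defined, Instr.step, Cell.eval, Ix.eval_lit, h', State.setNat_real,
          State.setReal_real_apply, and_self, if_true, true_and]
        refine ⟨Or.inr ⟨k, hk, hc, rfl⟩, fun j hj hj' => ?_⟩
        rcases Nat.lt_or_ge j k with hjk | hjk
        · exact h38 _ hc'.le j hjk hj'
        · rw [show j = k by omega]
      · simp only [Test.Holds, Cell.eval, Ix.eval_lit, h', F'.2 38 rfl, not_lt] at hc'
        simp only [State.setNat_real, F'.2 38 rfl]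
        refine ⟨ha, fun j hj hj' => ?_⟩
        rcases Nat.lt_or_ge j k with hjk | hjk
        · exact hb j hjk hj'
        · rwa [show j = k by omega]
    · simp only [Test.Holds, Cell.eval, Ix.eval_lit, Ix.eval_reg, h10, gh, S.θ] at hc
      simp only [State.setNat_real]
      refine ⟨ha, fun j hj hj' => ?_⟩
      rcases Nat.lt_or_ge j k with hjk | hjk
      · exact hb j hjk hj'
      · rw [show j = k by omega] at hj'
        exact absurd hj' hc
  · simpa using Or.inl h₅.2
  · rintro τ hF ⟨ha, hb⟩
    exact interp_spec hy h0 hlt ht b3 b4 ha hb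

end

/-! ### Lifting the selected columns and capping the ratios -/

section

variable {I : Inst} {ε : ℝ} {σ σ' : State} {y : ℕ → ℝ} {T : ℕ → Prop} [DecidablePred T] {θ : ℝ}

/-- Two facts on the cap are kept: that it dominates all R a / a', for the perturbation bound, and
that it is one of these numbers, for the size of the rounded scalings. -/
theorem runs_liftP (hE : Env I ε σ) (hE0 : 0 < I.E) (hR : 0 ≤ σ.real 43 0)
    (hT : ∀ j < I.n, (σ.nat 6 j = 1 ∧ T j) ∨ (σ.nat 6 j = 0 ∧ ¬ T j)) :
    Runs liftP σ (20 * I.X) fun τ =>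
      (∀ j < I.n, τ.real 40 j = Inst.up (σ.real 5) T (σ.real 38 0) j) ∧
      (∀ e < I.E, ∀ e' < I.E, σ.real 43 0 * (I.a e / I.a e') ≤ τ.real 44 0) ∧
      ∃ e < I.E, ∃ e' < I.E, τ.real 44 0 = σ.real 43 0 * (I.a e / I.a e') := by
  refine Runs.le (N := 1 + ((I.n * (4 + 2) + 2) + (2 + ((I.E * (4 + 2) + 2) + 2)))) ?_
    (by simp only [Inst.X]; omega)
  refine Runs.seq' (Mid := fun τ => τ.real 39 0 = 1 + σ.real 38 0) (Runs.block ?_)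
    fun σ₁ F₁ h₁ => ?_
  · simp [wp, Instr.Defined, Instr.step, Cell.eval, hE.one]
  have E₁ := hE.frame F₁ rfl
  have T₁ : σ₁.nat 6 = σ.nat 6 := F₁.1 6 rfl
  have y₁ : σ₁.real 5 = σ.real 5 := F₁.2 5 rfl
  have R₁ : σ₁.real 43 = σ.real 43 := F₁.2 43 rfl
  refine Runs.seq' (Runs.forLoop (c := 4) (fun k τ => ∀ j < k,
    τ.real 40 j = Inst.up (σ.real 5) T (σ.real 38 0) j) E₁.n1 rfl rfl (by decide) ?_ (by simp))
    fun σ₂ F₂ h₂ => ?_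
  · intro k hk τ hF h10 hN h
    have y₂ : τ.real 5 = σ.real 5 := by rw [hF.2 5 rfl, y₁]
    have T₂ : τ.nat 6 = σ.nat 6 := by rw [hF.1 6 rfl, T₁]
    have e39 : τ.real 39 0 = 1 + σ.real 38 0 := by rw [hF.2 39 rfl, h₁]
    refine Runs.seq' (N := 2) (M := 2) (Mid := fun τ' => τ'.nat 13 0 = σ.nat 6 k ∧
      τ'.real 40 k = σ.real 5 k ∧ ∀ j < k, τ'.real 40 j = Inst.up (σ.real 5) T (σ.real 38 0) j)
      (Runs.block ?_) fun τ' F' h' =>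
      Runs.ite' (N := 1) (M := 0) (fun hb => Runs.block ?_) fun hb => Runs.skip ?_
    · simp [wp, Instr.Defined, Instr.step, Cell.eval, h10, y₂, T₂]
      intro j hj
      rw [if_neg hj.ne, h j hj]
    · have hTk : T k := by
        rcases hT k hk with h | h
        · exact h.2
        · simp [Test.Holds, h'.1, h.1] at hb
      have e10 : τ'.nat 10 0 = k := by rw [F'.1 10 rfl, h10]
      simp [wp, Instr.Defined, Instr.step, Cell.eval, e10, h'.2.1, F'.2 39 rfl, e39]
      intro j hj
      split_ifs with hjk
      · rw [hjk, Inst.up, if_pos hTk]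
      · exact h'.2.2 j (by omega)
    · have hTk : ¬ T k := by
        rcases hT k hk with h | h
        · simp [Test.Holds, h'.1, h.1] at hb
        · exact h.2
      intro j hj
      rcases Nat.lt_or_ge j k with hjk | hjk
      · exact h'.2.2 j hjk
      · obtain rfl : j = k := by omega
        rw [Inst.up, if_neg hTk]
        exact h'.2.1
  have E₂ := E₁.frame F₂ rfl
  refine Runs.seq' (Mid := fun τ => τ.real 41 0 = I.a 0 ∧ τ.real 42 0 = I.a 0) (Runs.block ?_)
    fun σ₃ F₃ h₃ => ?_
  · simp [wp, Instr.Defined, Instr.step, Cell.eval, E₂.r0]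
  have E₃ := E₂.frame F₃ rfl
  refine Runs.seq' (Runs.forLoop (c := 4) (fun k τ =>
    (∃ e < I.E, τ.real 41 0 = I.a e) ∧ (∃ e < I.E, τ.real 42 0 = I.a e) ∧
    ∀ e < k, I.a e ≤ τ.real 41 0 ∧ τ.real 42 0 ≤ I.a e) E₃.n2 rfl rfl (by decide) ?_ ?_)
    fun σ₄ F₄ h₄ => ?_
  · rintro k hk τ hF h10 hN ⟨ha, hb, hc⟩
    have J := E₃.frame hF rfl
    refine Runs.seq' (N := 2) (M := 2) (Mid := fun τ' => (∃ e < I.E, τ'.real 41 0 = I.a e) ∧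
      (∃ e < I.E, τ'.real 42 0 = I.a e) ∧ (∀ e < k + 1, I.a e ≤ τ'.real 41 0) ∧
      ∀ e < k, τ'.real 42 0 ≤ I.a e)
      (Runs.ite' (N := 1) (M := 0) (fun hb => Runs.block ?_) fun hb => Runs.skip ?_)
      fun τ' F' h' =>
      Runs.ite' (N := 1) (M := 0) (fun hb => Runs.block ?_) fun hb => Runs.skip ?_
    · simp only [Test.Holds, Cell.eval, Ix.eval_lit, Ix.eval_reg, h10, J.r0] at hb
      simp [wp, Instr.Defined, Instr.step, Cell.eval, h10, J.r0]
      refine ⟨⟨k, hk, rfl⟩, by assumption, fun e he => ?_, fun e he => (hc e he).2⟩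
      rcases Nat.lt_or_ge e k with h | h
      · exact (hc e h).1.trans hb.le
      · rw [show e = k by omega]
    · simp only [Test.Holds, Cell.eval, Ix.eval_lit, Ix.eval_reg, h10, J.r0, not_lt] at hb
      refine ⟨ha, by assumption, fun e he => ?_, fun e he => (hc e he).2⟩
      rcases Nat.lt_or_ge e k with h | h
      · exact (hc e h).1
      · rwa [show e = k by omega]
    · have e10 : τ'.nat 10 0 = k := by rw [F'.1 10 rfl, h10]
      simp only [Test.Holds, Cell.eval, Ix.eval_lit, Ix.eval_reg, e10, F'.2 0 rfl, J.r0] at hb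
      simp [wp, Instr.Defined, Instr.step, Cell.eval, e10, F'.2 0 rfl, J.r0]
      refine ⟨h'.1, ⟨k, hk, rfl⟩, fun e he => ⟨h'.2.2.1 e (by omega), ?_⟩⟩
      rcases Nat.lt_or_ge e k with h | h
      · exact hb.le.trans (h'.2.2.2 e h)
      · rw [show e = k by omega]
    · have e10 : τ'.nat 10 0 = k := by rw [F'.1 10 rfl, h10]
      simp only [Test.Holds, Cell.eval, Ix.eval_lit, Ix.eval_reg, e10, F'.2 0 rfl, J.r0,
        not_lt] at hb
      refine ⟨h'.1, h'.2.1, fun e he => ⟨h'.2.2.1 e he, ?_⟩⟩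
      rcases Nat.lt_or_ge e k with h | h
      · exact h'.2.2.2 e h
      · rwa [show e = k by omega]
  · simpa [h₃.1, h₃.2] using ⟨0, hE0, rfl⟩
  obtain ⟨⟨e₁, he₁, h41⟩, ⟨e₂, he₂, h42⟩, hb⟩ := h₄
  have e43 : σ₄.real 43 0 = σ.real 43 0 := by
    rw [F₄.2 43 rfl, F₃.2 43 rfl, F₂.2 43 rfl, R₁]
  have e40 : σ₄.real 40 = σ₂.real 40 := by rw [F₄.2 40 rfl, F₃.2 40 rfl]
  refine Runs.block ?_
  simp [wp, Instr.Defined, Instr.step, Cell.eval, h41, h42, e43, e40, (I.a_pos e₂ he₂).ne']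
  refine ⟨h₂, fun e he e' he' => ?_, e₁, he₁, e₂, he₂, by ring⟩
  rw [mul_div_assoc]
  refine mul_le_mul_of_nonneg_left ?_ hR
  rw [← h41, ← h42]
  exact div_le_div₀ (h41 ▸ (I.a_pos e₁ he₁).le) (hb e he).1 (h42 ▸ I.a_pos e₂ he₂) (hb e' he').2

/-- A surjection of a finite set onto itself is injective. Thus writing a capped value through the
index list does not overwrite an earlier one. -/
theorem SortedBy.injOn {K : ℕ → ℝ} {N : ℕ} {idx : ℕ → ℕ} (h : SortedBy K N idx) :
    Set.InjOn idx (range N : Set ℕ) := by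
  refine injOn_of_surjOn_of_card_le (t := range N) idx (fun p hp => ?_) (fun i hi => ?_) le_rfl
  · simpa using h.1 p (by simpa using hp)
  · obtain ⟨p, hp, rfl⟩ := h.2.1 i (by simpa using hi)
    exact ⟨p, by simpa using hp, rfl⟩

/-- `z` arises from `u` by capping the ratios of consecutive entries with `H`. -/
def IsCapping (n : ℕ) (u z : ℕ → ℝ) (H : ℝ) : Prop :=
  (∀ j < n, 1 ≤ z j ∧ z j ≤ H ^ n) ∧
    ∀ j < n, ∀ l < n, z l / z j = u l / u j ∨ (H ≤ u l / u j ∧ H ≤ z l / z j) ∨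
      (H ≤ u j / u l ∧ H ≤ z j / z l)

theorem isCapping_of_sorted {n : ℕ} {u z : ℕ → ℝ} {H : ℝ} {idx : ℕ → ℕ} (hH : 1 ≤ H)
    (hu : ∀ j < n, 0 < u j) (hs : SortedBy u n idx)
    (hz : ∀ k < n, z (idx k) = capped (fun k => u (idx k)) H k) : IsCapping n u z H := by
  have key := fun {k : ℕ} (hk : k < n) => capped_spec (w := fun k => u (idx k)) hH
    (fun k hk => hu _ (hs.1 k hk)) (fun k hk => hs.2.2 k (k + 1) (by omega) hk) hk
  constructor
  · intro j hj
    obtain ⟨k, hk, rfl⟩ := hs.2.1 j hj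
    rw [hz k hk]
    exact ⟨(key hk).1.1, (key hk).1.2.trans (pow_le_pow_right₀ hH hk.le)⟩
  · intro j hj l hl
    obtain ⟨a, ha, rfl⟩ := hs.2.1 j hj
    obtain ⟨b, hb, rfl⟩ := hs.2.1 l hl
    rw [hz a ha, hz b hb]
    rcases le_total a b with h | h
    · rcases ((key hb).2 a h).2 with h' | h'
      · exact Or.inl h'
      · exact Or.inr (Or.inl h')
    · rcases ((key ha).2 b h).2 with h' | h'
      · left
        rw [← inv_div, h', inv_div]
      · exact Or.inr (Or.inr h')

theorem runs_capP (hE : Env I ε σ) (hn : 0 < I.n) (hH : 1 ≤ σ.real 44 0)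
    (hu : ∀ j < I.n, 0 < σ.real 40 j) :
    Runs capP σ (I.sortCost + 15 * I.X) fun τ =>
      IsCapping I.n (σ.real 40) (τ.real 46) (σ.real 44 0) := by
  refine Runs.le (N := I.sortCost + (2 + ((I.n - 1) * (7 + 2) + 2))) ?_
    (by simp only [Inst.X]; omega)
  refine Runs.seq' ((runs_sortIdx (Nr := 1) (by norm_num) hE.n1).le
    (sortCost_le (by simp only [Inst.X]; omega))) fun σ₁ F₁ hs => ?_
  have E₁ := hE.frame F₁ rfl
  have u₁ : σ₁.real 40 = σ.real 40 := F₁.2 40 rfl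
  have H₁ : σ₁.real 44 = σ.real 44 := F₁.2 44 rfl
  refine Runs.seq' (Mid := fun τ => τ.real 46 (σ₁.nat 22 0) = 1) (Runs.block ?_)
    fun σ₂ F₂ h₂ => ?_
  · simp [wp, Instr.Defined, Instr.step]
  have E₂ := E₁.frame F₂ rfl
  refine (Runs.forLoop (c := 7) (fun k τ => ∀ l ≤ k, τ.real 46 (σ₁.nat 22 l) =
    capped (fun k => σ.real 40 (σ₁.nat 22 k)) (σ.real 44 0) l) E₂.n41 rfl rfl (by decide) ?_
    ?_).mono le_rfl ?_
  · intro k hk τ hF h10 hN h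
    have i₃ : τ.nat 22 = σ₁.nat 22 := by rw [hF.1 22 rfl, F₂.1 22 rfl]
    have u₃ : τ.real 40 = σ.real 40 := by rw [hF.2 40 rfl, F₂.2 40 rfl, u₁]
    have H₃ : τ.real 44 = σ.real 44 := by rw [hF.2 44 rfl, F₂.2 44 rfl, H₁]
    have hk0 : σ₁.nat 22 k < I.n := hs.1 k (by omega)
    refine Runs.seq' (N := 4) (M := 3) (Mid := fun τ' => τ'.nat 11 0 = σ₁.nat 22 k ∧
      τ'.nat 12 0 = σ₁.nat 22 (k + 1) ∧
      τ'.real 45 0 = σ.real 40 (σ₁.nat 22 (k + 1)) / σ.real 40 (σ₁.nat 22 k)) (Runs.block ?_)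
      fun τ' F' h' => Runs.seq' (N := 2) (M := 1) (Mid := fun τ'' => τ''.nat 11 0 = σ₁.nat 22 k ∧
      τ''.nat 12 0 = σ₁.nat 22 (k + 1) ∧ τ''.real 45 0 =
        min (σ.real 40 (σ₁.nat 22 (k + 1)) / σ.real 40 (σ₁.nat 22 k)) (σ.real 44 0))
      (Runs.ite' (N := 1) (M := 0) (fun hb => Runs.block ?_) fun hb => Runs.skip ?_)
      fun τ'' F'' h'' => Runs.block ?_
    · simp [wp, Instr.Defined, Instr.step, Cell.eval, h10, i₃, u₃, (hu _ hk0).ne']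
    · simp only [Test.Holds, Cell.eval, Ix.eval_lit, h'.2.2, F'.2 44 rfl, H₃] at hb
      simp [wp, Instr.Defined, Instr.step, Cell.eval, h'.1, h'.2.1, F'.2 44 rfl, H₃, hb.le]
    · simp only [Test.Holds, Cell.eval, Ix.eval_lit, h'.2.2, F'.2 44 rfl, H₃, not_lt] at hb
      exact ⟨h'.1, h'.2.1, by rw [h'.2.2, min_eq_left hb]⟩
    · have e46 : τ''.real 46 = τ.real 46 := by rw [F''.2 46 rfl, F'.2 46 rfl]
      simp [wp, Instr.Defined, Instr.step, Cell.eval, h''.1, h''.2.1, h''.2.2, e46, h k le_rfl]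
      intro l hl
      split_ifs with hlk
      · have : l = k + 1 := hs.injOn (by simp; omega) (by simp; omega) hlk
        rw [this, capped]
      · refine h l ?_
        rcases Nat.lt_or_ge k l with h | h
        · exact absurd (by rw [show l = k + 1 by omega]) hlk
        · exact h
  · simpa [capped] using h₂
  · intro τ hF h
    exact isCapping_of_sorted hH hu hs fun k hk => h k (by omega)

end

/-! ### A complete step, and the admissible values of column scalings -/

/-- The columns `S` certify that the problem is infeasible. -/
def Inst.Cert (I : Inst) (S : ℕ → Prop) : Prop :=
  open Classical in
  ∑ i ∈ range I.m, (if ∃ e < I.E, I.row e = i ∧ S (I.col e) then I.r i else 0) <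
    ∑ j ∈ range I.n, if S j then I.c j else 0

/-- A memory array agrees with the scaling that it represents only at indices below n; the entries,
and hence the potential, see nothing else. -/
theorem Inst.B_congr {I : Inst} {u y : ℕ → ℝ} (h : ∀ j < I.n, u j = y j) {e : ℕ} (he : e < I.E) :
    I.B u e = I.B y e := by
  rw [B, B, x, x, D, D, h _ (I.col_lt e he)]
  rw [scat_congr fun e he _ => by rw [h _ (I.col_lt e he)]]

theorem Inst.Φ_congr {I : Inst} {u y : ℕ → ℝ} (h : ∀ j < I.n, u j = y j) : I.Φ u = I.Φ y := by
  have : ∀ j, I.d u j = I.d y j := fun j => by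
    rw [d, d, q, q, scat_congr fun e he _ => B_congr h he]
  simp only [Φ, this]

section

variable {I : Inst} {ε : ℝ} {σ σ' : State} {y : ℕ → ℝ} {T : ℕ → Prop} [DecidablePred T] {θ : ℝ}

/-- The set `T` of columns is in array `6`. -/
def Selected (I : Inst) (T : ℕ → Prop) (σ : State) : Prop :=
  ∀ j < I.n, (σ.nat 6 j = 1 ∧ T j) ∨ (σ.nat 6 j = 0 ∧ ¬ T j)

/-- The result of `prepareP`, for the largest gap `G` above `thr`. -/
structure Prepared (I : Inst) (y : ℕ → ℝ) (thr G : ℝ) (σ : State) : Prop where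
  gap : IsGap I y thr G
  sel : Selected I (fun j => I.d y j ≤ thr) σ
  shares : Shares I y (fun j => I.d y j ≤ thr) (G / 4) σ
  sorted : SortedBy (σ.real 29) (I.m + 1) (σ.nat 22)
  moved : Moved I y (fun j => I.d y j ≤ thr) (G / 4) (bp σ I.m) σ

theorem runs_prepareP (hE : Env I ε σ) (hV : Evald I ε y σ) (hy : ∀ j < I.n, 0 < y j)
    (hΦ : 0 < I.Φ y) :
    Runs prepareP σ (2 * I.sortCost + 110 * I.X) fun τ => ∃ thr G, Prepared I y thr G τ := by
  have hX : 1 ≤ I.X := by simp [Inst.X]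
  refine Runs.le (N := (I.sortCost + 15 * I.X) + (10 * I.X + (50 * I.X + (I.sortCost +
    (25 * I.X + 2))))) ?_ (by omega)
  refine Runs.seq' (runs_gapP hE hV hy hΦ) fun σ₁ F₁ h₁ => ?_
  have E₁ := hE.frame F₁ rfl
  have d₁ : ∀ j < I.n, σ₁.real 16 j = I.d y j := by rw [F₁.2 16 rfl]; exact hV.d
  have B₁ : ∀ e < I.E, σ₁.real 14 e = I.B y e := by rw [F₁.2 14 rfl]; exact hV.B
  set thr := σ₁.real 22 0
  set G := σ₁.real 21 0 with hG
  refine Runs.seq' (runs_selectP E₁) fun σ₂ F₂ h₂ => ?_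
  have E₂ := E₁.frame F₂ rfl
  have B₂ : ∀ e < I.E, σ₂.real 14 e = I.B y e := by rw [F₂.2 14 rfl]; exact B₁
  have s₂ : Selected I (fun j => I.d y j ≤ thr) σ₂ := by
    intro j hj
    simpa only [d₁ j hj] using h₂ j hj
  refine Runs.seq' (runs_shareP E₂ B₂ hy s₂) fun σ₃ F₃ h₃ => ?_
  rw [F₂.2 21 rfl, ← hG] at h₃
  have E₃ := E₂.frame F₃ rfl
  have s₃ : Selected I (fun j => I.d y j ≤ thr) σ₃ := by rw [Selected, F₃.1 6 rfl]; exact s₂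
  refine Runs.seq' ((runs_sortIdx (Nr := 19) (by norm_num) E₃.n19).le
    (sortCost_le (by simp only [Inst.X]; have := E₃.n19; omega))) fun σ₄ F₄ h₄ => ?_
  have E₄ := E₃.frame F₄ rfl
  have S₄ := h₃.frame F₄ rfl
  have s₄ : Selected I (fun j => I.d y j ≤ thr) σ₄ := by rw [Selected, F₄.1 6 rfl]; exact s₃
  rw [← F₄.2 29 rfl] at h₄
  have hm := runs_moveAtP 0 E₄ S₄
  rw [E₄.n0] at hm
  refine hm.mono le_rfl fun τ hF h => ⟨thr, G, h₁, ?_, S₄.frame hF rfl, ?_, ?_⟩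
  · rw [Selected, hF.1 6 rfl]; exact s₄
  · rw [hF.1 22 rfl, hF.2 29 rfl]; exact h₄
  · rw [bp_frame hF rfl]; exact h.1

theorem Shares.bp_nonneg (hS : Shares I y T θ σ) (hs : SortedBy (σ.real 29) (I.m + 1) (σ.nat 22))
    {k : ℕ} (hk : k < I.m + 1) : 0 ≤ bp σ k := by
  have h := hs.1 k hk
  rcases Nat.lt_or_ge (σ.nat 22 k) I.m with h' | h'
  · rw [bp, hS.t _ h']
    split_ifs <;> positivity
  · rw [bp, show σ.nat 22 k = I.m by omega, hS.tm]

/-- The extra breakpoint 0 at index m is the least one. All estimates vanish there, which supplies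
the lower end of the binary search. -/
theorem Shares.bp_zero (hS : Shares I y T θ σ)
    (hs : SortedBy (σ.real 29) (I.m + 1) (σ.nat 22)) : bp σ 0 = 0 := by
  refine le_antisymm ?_ (hS.bp_nonneg hs (by omega))
  obtain ⟨k, hk, he⟩ := hs.2.1 I.m (by omega)
  have := hs.2.2 0 k (by omega) hk
  rwa [he, hS.tm] at this

/-- The last sorted breakpoint dominates every 1 / f_i with f_i > 0, so all minima are saturated and
`Inst.certificate` applies. Each row meeting the selected columns has a positive share, so r(N(T))
is at most the sum in that lemma. -/
theorem cert_of_moved {thr G : ℝ} (hy : ∀ j < I.n, 0 < y j) (hP : Prepared I y thr G σ)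
    (h : ∀ j < I.n, I.g y (fun j => I.d y j ≤ thr) (bp σ I.m) j < G / 4) :
    I.Cert fun j => σ.nat 6 j = 1 := by
  obtain ⟨h1, h2, h3, h4, -⟩ := hP.gap
  have hc := Inst.certificate hy h4 (fun j _ h => h) h3 h1 h2 (fun i hi hf => ?_) h
  swap
  · obtain ⟨k, hk, he⟩ := hP.sorted.2.1 i (by omega)
    have h5 := hP.sorted.2.2 k I.m (by omega) (by omega)
    rw [he, hP.shares.t i hi, if_pos hf, div_le_iff₀ hf] at h5
    exact h5
  have hT : ∀ j < I.n, σ.nat 6 j = 1 ↔ I.d y j ≤ thr := by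
    intro j hj
    rcases hP.sel j hj with h | h <;> simp [h.1, h.2]
  refine lt_of_le_of_lt (sum_le_sum fun i hi => ?_) (hc.trans_le (sum_le_sum fun j hj => ?_))
  · have hr := (I.r_pos i (mem_range.1 hi)).le
    split_ifs with ha hb hb
    · exact le_rfl
    · obtain ⟨e, he, rfl, hS⟩ := ha
      exact absurd (Inst.f_pos hy he ((hT _ (I.col_lt e he)).1 hS)) hb
    · exact hr
    · exact le_rfl
  · simp only [hT j (mem_range.1 hj)]
    exact le_rfl

theorem runs_findP {thr G : ℝ} (hE : Env I ε σ) (hn : 0 < I.n) (hE0 : 0 < I.E)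
    (hR : 1 ≤ σ.real 43 0) (hy : ∀ j < I.n, 0 < σ.real 5 j)
    (hP : Prepared I (σ.real 5) thr G σ)
    (hg : ∃ j < I.n, G / 4 ≤ I.g (σ.real 5) (fun j => I.d (σ.real 5) j ≤ thr) (bp σ I.m) j) :
    Runs findP σ (2 * I.sortCost + 120 * I.X) fun τ => ∃ u H, (∀ j < I.n, 0 < u j) ∧
      I.Φ u ≤ I.Φ (σ.real 5) - 3 / 32 * G ^ 2 ∧ IsCapping I.n u (τ.real 46) H ∧
      (∀ e < I.E, ∀ e' < I.E, σ.real 43 0 * (I.a e / I.a e') ≤ H) ∧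
      ∃ e < I.E, ∃ e' < I.E, H = σ.real 43 0 * (I.a e / I.a e') := by
  refine Runs.le (N := (Nat.log 2 I.X + 1) * (40 * I.X) + (80 * I.X + (20 * I.X +
    (I.sortCost + 15 * I.X)))) ?_ ?_
  swap
  · have : (Nat.log 2 I.X + 1) * (40 * I.X) ≤ I.sortCost := by
      rw [Inst.sortCost]
      exact Nat.mul_le_mul_left _ (by omega)
    omega
  set y := σ.real 5 with hy'
  obtain ⟨h1, h2, h3, h4, -⟩ := hP.gap
  have g0 : ∀ j < I.n, I.g y (fun j => I.d y j ≤ thr) (bp σ 0) j < G / 4 := by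
    intro j hj
    rw [hP.shares.bp_zero hP.sorted, Inst.g, scat]
    simp only [zero_mul, zero_le_one, inf_of_le_left, ite_self, sum_const_zero]
    positivity
  refine Runs.seq' (runs_searchP hE hP.shares g0 hg) fun σ₁ F₁ h₁ => ?_
  have E₁ := hE.frame F₁ rfl
  have S₁ := hP.shares.frame F₁ rfl
  have s₁ : SortedBy (σ₁.real 29) (I.m + 1) (σ₁.nat 22) := by
    rw [F₁.1 22 rfl, F₁.2 29 rfl]; exact hP.sorted
  have b₁ : bp σ₁ = bp σ := funext fun k => bp_frame F₁ rfl k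
  rw [← b₁] at h₁
  refine Runs.seq' (runs_interpP E₁ S₁ hy s₁ h₁.1 h₁.2) fun σ₂ F₂ h₂ => ?_
  have E₂ := E₁.frame F₂ rfl
  have t₂ : Selected I (fun j => I.d y j ≤ thr) σ₂ := by
    rw [Selected, F₂.1 6 rfl, F₁.1 6 rfl]; exact hP.sel
  have R₂ : σ₂.real 43 = σ.real 43 := by rw [F₂.2 43 rfl, F₁.2 43 rfl]
  have y₂ : σ₂.real 5 = y := by rw [F₂.2 5 rfl, F₁.2 5 rfl]
  have hl := runs_liftP E₂ hE0 (by rw [R₂]; linarith) t₂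
  rw [R₂, y₂] at hl
  refine Runs.seq' hl fun σ₃ F₃ h₃ => ?_
  have E₃ := E₂.frame F₃ rfl
  have u₃ : ∀ j < I.n, 0 < σ₃.real 40 j := by
    intro j hj
    rw [h₃.1 j hj]
    exact Inst.up_pos hy h₂.1 j hj
  have H₃ : 1 ≤ σ₃.real 44 0 := by
    have := h₃.2.1 0 hE0 0 hE0
    rw [div_self (I.a_pos 0 hE0).ne', mul_one] at this
    linarith
  refine (runs_capP E₃ hn H₃ u₃).mono le_rfl fun τ _ h => ⟨_, _, u₃, ?_, h, h₃.2⟩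
  have hc : I.Φ (σ₃.real 40) = I.Φ (Inst.up y (fun j => I.d y j ≤ thr) (σ₂.real 38 0)) :=
    Inst.Φ_congr h₃.1
  rw [hc]
  exact Inst.Φ_up_le hy h4.le h₂.1 (fun j _ h => h) h3 h₂.2.1 h₂.2.2

/-- The values that column scalings take during a run. -/
def Inst.Value (I : Inst) (ε x : ℝ) : Prop :=
  ∃ p k : ℕ, (p = 0 ∨ 2 ^ (p - 1) * ε ^ 2 < 128 * I.s ^ 2 * I.n ^ 5) ∧ x = k / 2 ^ p ∧
    ∀ M, 1 ≤ M → (∀ e < I.E, ∀ e' < I.E, I.a e / I.a e' ≤ M) → x ≤ 2 * (2 ^ p * M) ^ I.n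

/-- The real array `5` contains only such values. -/
def Inst.Good (I : Inst) (ε : ℝ) (σ : State) : Prop := ∀ k, I.Value ε (σ.real 5 k)

/-- These are the values 0 of the untouched cells and 1 of the initial scaling, both at precision 0.
-/
theorem Inst.value_natCast {k : ℕ} (hk : k ≤ 1) : I.Value ε k := by
  refine ⟨0, k, Or.inl rfl, by simp, fun M hM _ => ?_⟩
  have h1 : (k : ℝ) ≤ 1 := by exact_mod_cast hk
  have h2 : 1 ≤ (2 ^ 0 * M) ^ I.n := one_le_pow₀ (by simpa using hM)
  linarith

theorem Runs.good {P : Program} {N : ℕ} {Q : State → Prop} (h : Runs P σ N Q)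
    (hf : P.realFree 5 = true) (hG : I.Good ε σ) : RunsJ (I.Good ε) P σ N Q :=
  h.toRunsJ hf (fun w => ∀ k, I.Value ε (w k)) hG

/-- Midway through the loop, array `5` mixes old and new scalings. The property `Good` survives
because it is a condition on single cells. -/
theorem runs_roundP (hE : Env I ε σ) (hG : I.Good ε σ)
    (hz : ∀ j < I.n, I.Value ε (roundTo (σ.real 46 j) (σ.nat 40 0))) :
    RunsJ (I.Good ε) roundP σ (5 * I.X) fun τ => I.Good ε τ ∧
      ∀ j < I.n, τ.real 5 j = roundTo (σ.real 46 j) (σ.nat 40 0) := by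
  refine RunsJ.mono (N := I.n * (1 + 2) + 2) (Q := fun τ => (I.Good ε τ ∧ ∀ j < I.n, τ.real 5 j =
    roundTo (σ.real 46 j) (σ.nat 40 0))) ?_ (by simp only [Inst.X]; omega) fun τ _ h => h
  refine RunsJ.forLoop (fun k τ => I.Good ε τ ∧ ∀ j < k, τ.real 5 j =
    roundTo (σ.real 46 j) (σ.nat 40 0)) hE.n1 rfl rfl (by decide) (fun k τ h => h.1) ?_
    ⟨hG, by simp⟩
  rintro k hk τ hF h10 hN ⟨h1, h2⟩
  have e : ∀ j, (Instr.step τ (.rround ⟨5, .reg 10⟩ ⟨46, .reg 10⟩ (.reg 40))).real 5 j =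
      if j = k then roundTo (σ.real 46 k) (σ.nat 40 0) else τ.real 5 j := by
    intro j
    simp [Instr.step, Cell.eval, h10, hF.2 46 rfl, hF.1 40 rfl]
  have hg : I.Good ε (Instr.step τ (.rround ⟨5, .reg 10⟩ ⟨46, .reg 10⟩ (.reg 40))) := by
    intro j
    rw [e]
    split_ifs
    exacts [hz k hk, h1 j]
  refine RunsJ.instr trivial hg ⟨hg, fun j hj => ?_⟩
  rw [State.setNat_real, e]
  split_ifs with hjk
  · rw [hjk]
  · exact h2 j (by omega)

/-- Capping gives z ≤ H^n with H ≤ 2^p M, rounding adds at most 1, and 1 ≤ z lets the factor 2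
absorb this. -/
theorem value_roundTo {u z : ℕ → ℝ} {H : ℝ} {p : ℕ}
    (hp : p = 0 ∨ 2 ^ (p - 1) * ε ^ 2 < 128 * I.s ^ 2 * I.n ^ 5) (hz : IsCapping I.n u z H)
    (hH : ∃ e < I.E, ∃ e' < I.E, H = 2 ^ p * (I.a e / I.a e'))
    (hr : ∀ j < I.n, 1 ≤ roundTo (z j) p ∧ roundTo (z j) p ≤ z j + 1) {j : ℕ} (hj : j < I.n) :
    I.Value ε (roundTo (z j) p) := by
  obtain ⟨h1, h2⟩ := hz.1 j hj
  have h0 : 0 ≤ round (z j * 2 ^ p) := by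
    have h3 := (hr j hj).1
    rw [roundTo, le_div_iff₀ (by positivity), one_mul] at h3
    have : (0 : ℝ) ≤ round (z j * 2 ^ p) := le_trans (by positivity) h3
    exact_mod_cast this
  refine ⟨p, (round (z j * 2 ^ p)).toNat, hp, ?_, fun M hM hM' => ?_⟩
  · rw [roundTo]
    congr 1
    exact_mod_cast (Int.toNat_of_nonneg h0).symm
  · obtain ⟨e, he, e', he', rfl⟩ := hH
    have h3 : (2 ^ p * (I.a e / I.a e')) ^ I.n ≤ (2 ^ p * M) ^ I.n := by
      have := I.a_pos e he
      have := I.a_pos e' he'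
      gcongr
      exact hM' e he e' he'
    linarith [(hr j hj).2]

/-- The result of a step: a certificate, or a better column scaling. -/
def Stepped (I : Inst) (ε : ℝ) (y : ℕ → ℝ) (fl : ℕ) (σ : State) : Prop :=
  (∀ j < I.n, 1 ≤ σ.real 5 j) ∧
    ((σ.nat 5 0 = 1 ∧ σ.nat 18 0 = 0 ∧ I.Cert fun j => σ.nat 6 j = 1) ∨
      (σ.nat 5 0 = fl ∧ Evald I ε (σ.real 5) σ ∧
        I.Φ (σ.real 5) ≤ I.Φ y * (1 - 1 / (16 * I.n ^ 3))))

theorem runs_stepP (hE : Env I ε σ) (hV : Evald I ε (σ.real 5) σ) (hn : 2 ≤ I.n) (hE0 : 0 < I.E)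
    (hy : ∀ j < I.n, 1 ≤ σ.real 5 j) (hΦ : ε ^ 2 < I.Φ (σ.real 5))
    (hR : σ.real 43 0 = 2 ^ σ.nat 40 0) (hG : I.Good ε σ)
    (hp : σ.nat 40 0 = 0 ∨ 2 ^ (σ.nat 40 0 - 1) * ε ^ 2 < 128 * I.s ^ 2 * I.n ^ 5)
    (ht : 128 * I.s ^ 2 * I.n ^ 5 ≤ 2 ^ σ.nat 40 0 * ε ^ 2) :
    RunsJ (I.Good ε) stepP σ (4 * I.sortCost + 280 * I.X) fun τ =>
      Stepped I ε (σ.real 5) (σ.nat 5 0) τ ∧ I.Good ε τ := by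
  have hX : 1 ≤ I.X := by simp [Inst.X]
  set y := σ.real 5 with hy'
  set p := σ.nat 40 0 with hp'
  have hy0 : ∀ j < I.n, 0 < y j := fun j hj => lt_of_lt_of_le one_pos (hy j hj)
  refine RunsJ.mono (N := (2 * I.sortCost + 110 * I.X) + ((2 * I.sortCost + 120 * I.X) +
    (5 * I.X + 40 * I.X) + 1 + 1)) (Q := fun τ => Stepped I ε y (σ.nat 5 0) τ ∧ I.Good ε τ) ?_
    (by omega) fun _ _ h => h
  refine RunsJ.seq (((runs_prepareP hE hV hy0 ((sq_nonneg ε).trans_lt hΦ)).good rfl hG).mono le_rfl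
    fun σ₁ F₁ h _ => ?_)
  obtain ⟨thr, G, h₁⟩ := h
  have E₁ := hE.frame F₁ rfl
  have y₁ : σ₁.real 5 = y := F₁.2 5 rfl
  have G₁ : I.Good ε σ₁ := by rw [Inst.Good, y₁]; exact hG
  rw [add_assoc _ 1 1]
  refine (RunsJ.ite (N := (2 * I.sortCost + 120 * I.X) + (5 * I.X + 40 * I.X) + 1) G₁ (fun hb => ?_)
    fun hb => ?_).mono (by omega) fun _ _ h => h
  · have hg : ∀ j < I.n, I.g y (fun j => I.d y j ≤ thr) (bp σ₁ I.m) j < G / 4 := by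
      simp only [Test.Holds, Ix.eval_reg, Ix.eval_lit] at hb
      rcases h₁.moved.2 with h | h
      · omega
      · exact h.2
    have hc := cert_of_moved hy0 h₁ hg
    have : Runs (block [.nset 5 (.lit 1), .nset 18 (.lit 0)]) σ₁ 2 fun τ =>
        τ.nat 5 0 = 1 ∧ τ.nat 18 0 = 0 := by
      refine Runs.block ?_
      simp [wp, Instr.Defined, Instr.step]
    refine (this.good rfl G₁).mono (by omega) fun τ hF h => ⟨⟨?_, Or.inl ⟨h.1, h.2, ?_⟩⟩, ?_⟩
    · rwa [hF.2 5 rfl, y₁]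
    · rwa [hF.1 6 rfl]
    · rw [Inst.Good, hF.2 5 rfl]; exact G₁
  · have hg : ∃ j < I.n, G / 4 ≤ I.g y (fun j => I.d y j ≤ thr) (bp σ₁ I.m) j := by
      simp only [Test.Holds, Ix.eval_reg, Ix.eval_lit] at hb
      rcases h₁.moved.2 with h | h
      · exact h.2
      · omega
    have R₁ : σ₁.real 43 0 = 2 ^ p := by rw [F₁.2 43 rfl, hR]
    rw [← y₁] at h₁ hg
    refine RunsJ.mono (N := (2 * I.sortCost + 120 * I.X) + (5 * I.X + 40 * I.X))
      (Q := fun τ => Stepped I ε y (σ.nat 5 0) τ ∧ I.Good ε τ) ?_ (by omega) fun _ _ h => h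
    refine RunsJ.seq (((runs_findP E₁ (by omega) hE0 (by rw [R₁]; exact one_le_pow₀ one_le_two)
      (by rwa [y₁]) h₁ hg).good rfl G₁).mono le_rfl fun σ₂ F₂ h _ => ?_)
    rw [y₁, R₁] at h
    obtain ⟨u, H, hu, hup, hz, hH, hH'⟩ := h
    have E₂ := E₁.frame F₂ rfl
    have y₂ : σ₂.real 5 = y := by rw [F₂.2 5 rfl, y₁]
    have G₂ : I.Good ε σ₂ := by rw [Inst.Good, y₂]; exact hG
    have p₂ : σ₂.nat 40 0 = p := by rw [F₂.1 40 rfl, F₁.1 40 rfl]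
    obtain ⟨hst, hr⟩ := Inst.Φ_step rfl hn hy0 hu (fun j hj => (hz.1 j hj).1) hΦ ht
      (by rw [← y₁]; exact h₁.gap.2.2.2.2) hup hH hz.2
    refine RunsJ.seq ((runs_roundP E₂ G₂ fun j hj => ?_).mono le_rfl fun σ₃ F₃ h₃ _ => ?_)
    · rw [p₂]
      exact value_roundTo hp hz hH' hr hj
    rw [p₂] at h₃
    have E₃ := E₂.frame F₃ rfl
    have hy₃ : ∀ j < I.n, 1 ≤ σ₃.real 5 j := fun j hj => by
      rw [h₃.2 j hj]
      exact (hr j hj).1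
    refine ((runs_evalP E₃.toInp E₃.eps2 fun j hj => one_pos.trans_le (hy₃ j hj)).good rfl
      h₃.1).mono le_rfl fun τ F h => ?_
    have y₄ : τ.real 5 = σ₃.real 5 := F.2 5 rfl
    refine ⟨⟨?_, Or.inr ⟨?_, ?_, ?_⟩⟩, ?_⟩
    · rwa [y₄]
    · rw [F.1 5 rfl, F₃.1 5 rfl, F₂.1 5 rfl, F₁.1 5 rfl]
    · rwa [y₄]
    · rw [y₄, Inst.Φ_congr h₃.2]
      exact hst
    · rw [Inst.Good, y₄]
      exact h₃.1

end

/-! ### The main loop and the initialization -/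

section

variable {I : Inst} {ε : ℝ} {σ σ' : State}

/-- The invariant of the main loop after `k` iterations. -/
def LoopInv (I : Inst) (ε : ℝ) (k : ℕ) (σ : State) : Prop :=
  Env I ε σ ∧ I.Good ε σ ∧ (∀ j < I.n, 1 ≤ σ.real 5 j) ∧ σ.real 43 0 = 2 ^ σ.nat 40 0 ∧
    (σ.nat 40 0 = 0 ∨ 2 ^ (σ.nat 40 0 - 1) * ε ^ 2 < 128 * I.s ^ 2 * I.n ^ 5) ∧
    ∃ v, k = σ.nat 40 0 + v ∧
      ((σ.nat 5 0 = 1 ∧ σ.nat 18 0 = 0 ∧ I.Cert fun j => σ.nat 6 j = 1) ∨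
        (σ.nat 5 0 = 0 ∧ Evald I ε (σ.real 5) σ ∧
          I.Φ (σ.real 5) ≤ 2 * I.s ^ 2 * (1 - 1 / (16 * I.n ^ 3)) ^ v))

/-- The iteration number is the sum of the exponent p and the number v of steps, and each iteration
raises exactly one of them or ends with a certificate, which is counted in v. As the loop continues
only while Φ > ε², `iteration_bound` limits p + v + 1. -/
theorem runsJ_iterP {k : ℕ} (hε : 0 < ε) (h : LoopInv I ε k σ) (hb : 0 < σ.nat 18 0) :
    k < ⌊72 * (I.n ^ 3 * Real.posLog (I.s * I.n / ε))⌋₊ ∧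
      RunsJ (I.Good ε) iterP σ (4 * I.sortCost + 282 * I.X) (LoopInv I ε (k + 1)) := by
  obtain ⟨hE, hG, hy, hR, hp, v, rfl, hf | ⟨hf, hV, hΦ⟩⟩ := h
  · omega
  have hy0 : ∀ j < I.n, 0 < σ.real 5 j := fun j hj => one_pos.trans_le (hy j hj)
  have hlt : ε ^ 2 < I.Φ (σ.real 5) := by
    rcases hV.flag with h | h
    · exact h.2
    · omega
  -- With fewer columns the potential is 0 and the loop would have stopped.
  have hn : 2 ≤ I.n := by
    by_contra hn
    have := Inst.Φ_eq_zero hy0 (by omega)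
    have := sq_nonneg ε
    linarith
  -- Without rows s = 0, so the potential would be 0; and a row has an entry.
  have hE0 : 0 < I.E := by
    rcases Nat.eq_zero_or_pos I.m with h | h
    · have hs := I.sum_r
      rw [h, sum_range_zero] at hs
      have h1 := Inst.Φ_le hy0
      have := sq_nonneg ε
      rw [← hs] at h1
      linarith
    · obtain ⟨e, he, -⟩ := I.row_ne 0 h
      omega
  constructor
  · have := iteration_bound hn (Inst.s_nonneg hy0) hε hp (hlt.trans_le hΦ)
    refine Nat.lt_of_succ_le (Nat.le_floor ?_)
    push_cast
    exact this
  have hX : 1 ≤ I.X := by simp [Inst.X]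
  refine RunsJ.mono (N := 1 + ((4 * I.sortCost + 280 * I.X) + 1))
    (Q := LoopInv I ε (σ.nat 40 0 + v + 1)) ?_ (by omega) fun _ _ h => h
  have hc : Runs (block [.rmul ⟨51, .lit 0⟩ ⟨43, .lit 0⟩ ⟨19, .lit 0⟩]) σ 1 fun τ =>
      τ.real 51 0 = 2 ^ σ.nat 40 0 * ε ^ 2 := by
    refine Runs.block ?_
    simp [wp, Instr.Defined, Instr.step, Cell.eval, hR, hE.eps2]
  refine RunsJ.seq ((hc.good rfl hG).mono le_rfl fun σ₁ F₁ h₁ _ => ?_)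
  have E₁ := hE.frame F₁ rfl
  have y₁ : σ₁.real 5 = σ.real 5 := F₁.2 5 rfl
  have p₁ : σ₁.nat 40 0 = σ.nat 40 0 := by rw [F₁.1 40 rfl]
  have G₁ : I.Good ε σ₁ := by rw [Inst.Good, y₁]; exact hG
  have V₁ : Evald I ε (σ₁.real 5) σ₁ := by
    rw [y₁]
    exact ⟨by rw [F₁.2 4 rfl]; exact hV.x, by rw [F₁.2 14 rfl]; exact hV.B,
      by rw [F₁.2 16 rfl]; exact hV.d, by rw [F₁.1 18 rfl]; exact hV.flag⟩
  refine RunsJ.ite G₁ (fun hc => ?_) fun hc => ?_ <;>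
    simp only [Test.Holds, Cell.eval, Ix.eval_lit, h₁, E₁.target] at hc
  -- The successful comparison is exactly what the invariant records for the new exponent: its
  -- predecessor was insufficient.
  · have : Runs (block [.nadd 40 (.reg 40) (.lit 1), .rmul ⟨43, .lit 0⟩ ⟨43, .lit 0⟩ ⟨11, .lit 0⟩])
        σ₁ 2 fun τ => τ.nat 40 0 = σ.nat 40 0 + 1 ∧ τ.real 43 0 = 2 ^ (σ.nat 40 0 + 1) := by
      refine Runs.block ?_
      simp [wp, Instr.Defined, Instr.step, Cell.eval, p₁, F₁.2 43 rfl, hR, E₁.two, pow_succ]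
    refine (this.good rfl G₁).mono (by omega) fun τ F h => ?_
    have y₂ : τ.real 5 = σ₁.real 5 := F.2 5 rfl
    refine ⟨E₁.frame F rfl, ?_, ?_, ?_, Or.inr ?_, v, ?_, Or.inr ⟨?_, ?_, ?_⟩⟩
    · rw [Inst.Good, y₂]; exact G₁
    · rw [y₂, y₁]; exact hy
    · rw [h.1, h.2]
    · rw [h.1]; exact hc
    · rw [h.1]; omega
    · rw [F.1 5 rfl, F₁.1 5 rfl, hf]
    · rw [y₂]
      exact ⟨by rw [F.2 4 rfl]; exact V₁.x, by rw [F.2 14 rfl]; exact V₁.B,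
        by rw [F.2 16 rfl]; exact V₁.d, by rw [F.1 18 rfl]; exact V₁.flag⟩
    · rw [y₂, y₁]; exact hΦ
  · refine (runs_stepP E₁ V₁ hn hE0 (by rwa [y₁]) (by rwa [y₁]) (by rw [p₁, F₁.2 43 rfl, hR]) G₁
      (by rwa [p₁]) (by rw [p₁]; exact not_lt.1 hc)).mono le_rfl fun τ F h => ?_
    have p₂ : τ.nat 40 0 = σ.nat 40 0 := by rw [F.1 40 rfl, p₁]
    have R₂ : τ.real 43 0 = 2 ^ τ.nat 40 0 := by rw [p₂, F.2 43 rfl, F₁.2 43 rfl, hR]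
    refine ⟨E₁.frame F rfl, h.2, h.1.1, R₂, by rwa [p₂], v + 1, by rw [p₂, add_assoc], ?_⟩
    rcases h.1.2 with h | ⟨h1, h2, h3⟩
    · exact Or.inl h
    · refine Or.inr ⟨by rw [h1, F₁.1 5 rfl, hf], h2, ?_⟩
      rw [y₁] at h3
      rw [pow_succ _ v, ← mul_assoc]
      refine h3.trans (mul_le_mul_of_nonneg_right hΦ (sub_nonneg.2 ?_))
      have : (1 : ℝ) ≤ I.n ^ 3 := one_le_pow₀ (by exact_mod_cast (by omega : 1 ≤ I.n))
      rw [div_le_one (by positivity)]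
      linarith

theorem runs_constP (hI : Inp I ε σ) : Runs constP σ (50 * I.X) fun τ =>
    Env I ε τ ∧ τ.real 43 0 = 1 ∧ τ.nat 40 0 = 0 := by
  refine Runs.le (N := 11 + ((I.n * (2 + 2) + 2) + 9)) ?_ (by simp only [Inst.X]; omega)
  refine Runs.seq' (Mid := fun τ => τ.real 10 0 = 1 ∧ τ.real 11 0 = 2 ∧ τ.real 23 0 = 4 ∧
    τ.real 49 0 = 128 ∧ τ.real 43 0 = 1 ∧ τ.real 54 0 = 0 ∧ τ.nat 40 0 = 0 ∧
    τ.nat 41 0 = I.n - 1 ∧ τ.nat 19 0 = I.m + 1 ∧ τ.real 47 0 = 0 ∧ τ.real 48 0 = 0)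
    (Runs.block ?_) fun σ₁ F₁ h₁ => ?_
  · simp [wp, Instr.Defined, Instr.step, hI.n0, hI.n1]
  obtain ⟨h10, h11, h23, h49, h43, h54, h40, h41, h19, h47, h48⟩ := h₁
  have I₁ := hI.frame F₁ rfl
  refine Runs.seq' (Runs.forLoop (c := 2) (fun k τ => τ.real 47 0 = ∑ j ∈ range k, I.c j ∧
    τ.real 48 0 = k) I₁.n1 rfl rfl (by decide) ?_ ?_) fun σ₂ F₂ h₂ => ?_
  · rintro k hk τ hF h10' hN ⟨h1, h2⟩
    have J := I₁.frame hF rfl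
    refine Runs.block ?_
    simp [wp, Instr.Defined, Instr.step, Cell.eval, h10', h1, h2, J.r2, hF.2 10 rfl, h10,
      sum_range_succ]
  · simp [h47, h48]
  rw [I.sum_c] at h₂
  have I₂ := I₁.frame F₂ rfl
  refine (Runs.block (Q := fun τ => τ.real 50 0 = 128 * I.s ^ 2 * I.n ^ 5 ∧ τ.real 19 0 = ε ^ 2)
    ?_).mono le_rfl fun τ F h => ?_
  · simp [wp, Instr.Defined, Instr.step, Cell.eval, h₂.1, h₂.2, F₂.2 49 rfl, h49, I₂.r3]
    constructor <;> ring
  · have I₃ := I₂.frame F rfl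
    refine ⟨⟨I₃, ?_, ?_, ?_, ?_, ?_, ?_, h.1, h.2⟩, ?_, ?_⟩
    · rw [F.2 10 rfl, F₂.2 10 rfl, h10]
    · rw [F.2 11 rfl, F₂.2 11 rfl, h11]
    · rw [F.2 23 rfl, F₂.2 23 rfl, h23]
    · rw [F.2 54 rfl, F₂.2 54 rfl, h54]
    · rw [F.1 41 rfl, F₂.1 41 rfl, h41]
    · rw [F.1 19 rfl, F₂.1 19 rfl, h19]
    · rw [F.2 43 rfl, F₂.2 43 rfl, h43]
    · rw [F.1 40 rfl, F₂.1 40 rfl, h40]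

theorem runsJ_startP (hI : Inp I ε σ) (h5 : σ.nat 5 0 = 0) (hy : ∀ k, σ.real 5 k = 0) :
    RunsJ (I.Good ε) startP σ (100 * I.X) (LoopInv I ε 0) := by
  have hX : 1 ≤ I.X := by simp [Inst.X]
  refine RunsJ.mono (N := 50 * I.X + ((I.n * (1 + 2) + 2) + 40 * I.X)) (Q := LoopInv I ε 0) ?_
    (by simp only [Inst.X]; omega) fun _ _ h => h
  have v0 : I.Value ε 0 := by simpa using Inst.value_natCast (k := 0) (by simp)
  have v1 : I.Value ε 1 := by simpa using Inst.value_natCast (k := 1) le_rfl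
  have hG : I.Good ε σ := fun k => by rw [hy]; exact v0
  refine RunsJ.seq (((runs_constP hI).good rfl hG).mono le_rfl fun σ₁ F₁ h₁ _ => ?_)
  obtain ⟨E₁, h43, h40⟩ := h₁
  have G₁ : I.Good ε σ₁ := by rw [Inst.Good, F₁.2 5 rfl]; exact hG
  refine RunsJ.seq ((RunsJ.forLoop (c := 1) (fun k τ => I.Good ε τ ∧ ∀ j < k, τ.real 5 j = 1) E₁.n1
    rfl rfl (by decide) (fun k τ h => h.1) ?_ ⟨G₁, by simp⟩).mono le_rfl fun σ₂ F₂ h₂ _ => ?_)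
  · rintro k hk τ hF h10 hN ⟨h1, h2⟩
    have e : ∀ j, (Instr.step τ (.rconst ⟨5, .reg 10⟩ 1)).real 5 j =
        if j = k then 1 else τ.real 5 j := by
      intro j
      simp [Instr.step, h10]
    have hg : I.Good ε (Instr.step τ (.rconst ⟨5, .reg 10⟩ 1)) := by
      intro j
      rw [e]
      split_ifs
      exacts [v1, h1 j]
    refine RunsJ.instr trivial hg ⟨hg, fun j hj => ?_⟩
    rw [State.setNat_real, e]
    split_ifs with hjk
    · rfl
    · exact h2 j (by omega)
  have E₂ := E₁.frame F₂ rfl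
  refine ((runs_evalP E₂.toInp E₂.eps2 fun j hj => by rw [h₂.2 j hj]; exact one_pos).good rfl
    h₂.1).mono le_rfl fun τ F h => ?_
  have y₃ : τ.real 5 = σ₂.real 5 := F.2 5 rfl
  have p₃ : τ.nat 40 0 = 0 := by rw [F.1 40 rfl, F₂.1 40 rfl, h40]
  refine ⟨E₂.frame F rfl, ?_, ?_, ?_, Or.inl p₃, 0, by rw [p₃], Or.inr ⟨?_, ?_, ?_⟩⟩
  · rw [Inst.Good, y₃]; exact h₂.1
  · intro j hj
    rw [y₃, h₂.2 j hj]
  · rw [p₃, F.2 43 rfl, F₂.2 43 rfl, h43, pow_zero]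
  · rw [F.1 5 rfl, F₂.1 5 rfl, F₁.1 5 rfl, h5]
  · rwa [y₃]
  · rw [pow_zero, mul_one, y₃]
    exact Inst.Φ_le fun j hj => by rw [h₂.2 j hj]; exact one_pos

/-! ### Detection of empty rows and columns -/

/-- The marks of the keys below `N` that do not occur among the first `E`. -/
def Marked (key : ℕ → ℕ) (N E : ℕ) (fl : ℕ) : Prop :=
  (fl = 0 ∧ ∀ i < N, ∃ e < E, key e = i) ∨ (fl = 1 ∧ ∃ i < N, ∀ e < E, key e ≠ i)

theorem runs_markP {m n E : ℕ} {row col : ℕ → ℕ} (h0 : σ.nat 0 0 = m) (h1 : σ.nat 1 0 = n)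
    (h2 : σ.nat 2 0 = E) (h3 : σ.nat 3 = row) (h4 : σ.nat 4 = col) (h14 : ∀ j, σ.nat 14 j = 0)
    (h15 : ∀ i, σ.nat 15 i = 0) (h6 : ∀ j, σ.nat 6 j = 0) (h16 : σ.nat 16 0 = 0)
    (h17 : σ.nat 17 0 = 0) :
    Runs markP σ (20 * (m + n + E + 1)) fun τ => Marked col n E (τ.nat 16 0) ∧
      Marked row m E (τ.nat 17 0) ∧
      ∀ j < n, (τ.nat 6 j = 1 ∧ ∀ e < E, col e ≠ j) ∨ (τ.nat 6 j = 0 ∧ ∃ e < E, col e = j) := by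
  refine Runs.le (N := (E * (4 + 2) + 2) + ((n * (4 + 2) + 2) + (m * (3 + 2) + 2))) ?_ (by omega)
  have mem : ∀ (k : ℕ) (key : ℕ → ℕ) (i : ℕ),
      (∃ e ≤ k, key e = i) ↔ i = key k ∨ ∃ e < k, key e = i := by
    intro k key i
    constructor
    · rintro ⟨e, he, rfl⟩
      rcases Nat.lt_or_ge e k with h | h
      · exact Or.inr ⟨e, h, rfl⟩
      · exact Or.inl (by rw [show e = k by omega])
    · rintro (rfl | ⟨e, he, rfl⟩)
      exacts [⟨k, by omega, rfl⟩, ⟨e, by omega, rfl⟩]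
  classical
  refine Runs.seq' (Runs.forLoop (c := 4) (fun k τ =>
    (∀ i, τ.nat 15 i = if ∃ e < k, row e = i then 1 else 0) ∧
    ∀ j, τ.nat 14 j = if ∃ e < k, col e = j then 1 else 0) h2 rfl rfl (by decide) ?_ ?_)
    fun σ₁ F₁ h₁ => ?_
  · rintro k hk τ hF h10 hN ⟨ha, hb⟩
    refine Runs.block ?_
    simp [wp, Instr.Defined, Instr.step, h10, hF.1 3 rfl, hF.1 4 rfl, h3, h4, mem, ha, hb,
      ite_or]
  · simp [h14, h15]
  have nc : ∀ j, (∀ e < E, col e ≠ j) ↔ ¬ ∃ e < E, col e = j := by simp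
  refine Runs.seq' (Runs.forLoop (c := 4) (fun k τ => Marked col k E (τ.nat 16 0) ∧
    ∀ j, (k ≤ j → τ.nat 6 j = 0) ∧ (j < k → ((τ.nat 6 j = 1 ∧ ∀ e < E, col e ≠ j) ∨
      (τ.nat 6 j = 0 ∧ ∃ e < E, col e = j)))) (by rw [F₁.1 1 rfl, h1]) rfl rfl (by decide) ?_ ?_)
    fun σ₂ F₂ h₂ => ?_
  · rintro k hk τ hF h10 hN ⟨ha, hb⟩
    have e14 : τ.nat 14 k = if ∃ e < E, col e = k then 1 else 0 := by rw [hF.1 14 rfl, h₁.2]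
    refine Runs.seq' (N := 1) (M := 3) (Mid := fun τ' => τ'.nat 11 0 = τ.nat 14 k)
      (Runs.block ?_) fun τ' F' h' =>
      Runs.ite' (N := 2) (M := 0) (fun hc => Runs.block ?_) fun hc => Runs.skip ?_
    · simp [wp, Instr.Defined, Instr.step, h10]
    · simp only [Test.Holds, Ix.eval_reg, Ix.eval_lit, h', e14] at hc
      have hne : ∀ e < E, col e ≠ k := by
        rw [nc]
        intro h
        simp [h] at hc
      have e10 : τ'.nat 10 0 = k := by rw [F'.1 10 rfl, h10]
      simp only [wp, Instr.Defined, Instr.step, true_and]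
      refine ⟨Or.inr ⟨by simp, k, by omega, hne⟩, fun j => ?_⟩
      rcases eq_or_ne j k with rfl | hjk
      · simpa [e10, F'.1 6 rfl] using hne
      · have := hb j
        simp only [State.setNat_nat, e10, F'.1 6 rfl, if_false, if_true, Nat.reduceEqDiff,
          Ix.eval_reg, Ix.eval_lit, Function.update_of_ne hjk]
        exact ⟨fun h => this.1 (by omega), fun h => this.2 (by omega)⟩
    · simp only [Test.Holds, Ix.eval_reg, Ix.eval_lit, h', e14] at hc
      have hne : ∃ e < E, col e = k := by
        by_contra h
        simp [h] at hc
      refine ⟨?_, fun j => ?_⟩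
      · simp [F'.1 16 rfl]
        rcases ha with ⟨h, h'⟩ | ⟨h, i, hi, h'⟩
        · refine Or.inl ⟨h, fun i hi => ?_⟩
          rcases Nat.lt_or_ge i k with hik | hik
          · exact h' i hik
          · rwa [show i = k by omega]
        · exact Or.inr ⟨h, i, by omega, h'⟩
      · simp [F'.1 6 rfl]
        refine ⟨fun h => (hb j).1 (by omega), fun h => ?_⟩
        rcases Nat.lt_or_ge j k with hik | hik
        · exact (hb j).2 hik
        · obtain rfl : j = k := by omega
          exact Or.inr ⟨(hb j).1 le_rfl, hne⟩
  · simp [F₁.1 16 rfl, F₁.1 6 rfl, h6, h16, Marked]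
  refine (Runs.forLoop (c := 3) (fun k τ => Marked row k E (τ.nat 17 0))
    (by rw [F₂.1 0 rfl, F₁.1 0 rfl, h0]) rfl rfl (by decide) ?_ ?_).mono le_rfl fun τ F h => ?_
  · rintro k hk τ hF h10 hN ha
    have e15 : τ.nat 15 k = if ∃ e < E, row e = k then 1 else 0 := by
      rw [hF.1 15 rfl, F₂.1 15 rfl, h₁.1]
    refine Runs.seq' (N := 1) (M := 2) (Mid := fun τ' => τ'.nat 11 0 = τ.nat 15 k)
      (Runs.block ?_) fun τ' F' h' =>
      Runs.ite' (N := 1) (M := 0) (fun hc => Runs.block ?_) fun hc => Runs.skip ?_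
    · simp [wp, Instr.Defined, Instr.step, h10]
    · simp only [Test.Holds, Ix.eval_reg, Ix.eval_lit, h', e15] at hc
      have hne : ∀ e < E, row e ≠ k := by
        intro e he h
        rw [if_pos ⟨e, he, h⟩] at hc
        omega
      simp only [wp, Instr.Defined, Instr.step, true_and]
      exact Or.inr ⟨by simp, k, by omega, hne⟩
    · simp only [Test.Holds, Ix.eval_reg, Ix.eval_lit, h', e15] at hc
      have hne : ∃ e < E, row e = k := by
        by_contra h
        simp [h] at hc
      simp [F'.1 17 rfl]
      rcases ha with ⟨h, h'⟩ | ⟨h, i, hi, h'⟩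
      · refine Or.inl ⟨h, fun i hi => ?_⟩
        rcases Nat.lt_or_ge i k with hik | hik
        · exact h' i hik
        · rwa [show i = k by omega]
      · exact Or.inr ⟨h, i, by omega, h'⟩
  · simp [F₂.1 17 rfl, F₁.1 17 rfl, h17, Marked]
  · refine ⟨by rw [F.1 16 rfl]; exact h₂.1, h, fun j hj => ?_⟩
    rw [F.1 6 rfl]
    exact (h₂.2 j).2 hj

end

/-! ### Runs of the whole program -/

/-- The cells that the program expects to be zero at the start. -/
structure Blank (σ : State) : Prop where
  n5 : σ.nat 5 0 = 0
  n6 : ∀ j, σ.nat 6 j = 0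
  n14 : ∀ j, σ.nat 14 j = 0
  n15 : ∀ j, σ.nat 15 j = 0
  n16 : σ.nat 16 0 = 0
  n17 : σ.nat 17 0 = 0
  r5 : ∀ k, σ.real 5 k = 0

/-- An upper bound for the number of iterations. -/
noncomputable def Inst.maxIter (I : Inst) (ε : ℝ) : ℕ :=
  ⌊72 * (I.n ^ 3 * Real.posLog (I.s * I.n / ε))⌋₊

/-- The properties of a run of the program on a problem without empty rows and columns. -/
structure MainRun (I : Inst) (ε : ℝ) (σ : State) (tr : List Event) (σ' : State) : Prop where
  exec : Exec scalingProgram σ tr σ'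
  final : ∃ k, LoopInv I ε k σ'
  stopped : σ'.nat 18 0 = 0
  good : ∀ v ∈ tr, I.Good ε v.state
  marks : ∀ v ∈ tr, v.isMark = true → ∃ k, LoopInv I ε k v.state
  iter : iterationCount tr ≤ I.maxIter ε
  phases : ∃ a L, phaseCosts tr = a :: L ∧ a ≤ 130 * I.X ∧
    ∀ x ∈ L, x ≤ 4 * I.sortCost + 283 * I.X
  length : tr.length ≤ 130 * I.X + I.maxIter ε * (4 * I.sortCost + 284 * I.X)

section

variable {I : Inst} {ε : ℝ} {σ σ' : State}

theorem exists_mainRun (hε : 0 < ε) (hI : Inp I ε σ) (h0 : Blank σ)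
    (hc : ∀ j < I.n, ∃ e < I.E, I.col e = j) : ∃ tr σ', MainRun I ε σ tr σ' := by
  have hX : 1 ≤ I.X := by simp [Inst.X]
  have v0 : I.Value ε 0 := by simpa using Inst.value_natCast (k := 0) (by simp)
  have hG : I.Good ε σ := fun k => by rw [h0.r5]; exact v0
  obtain ⟨t₁, σ₁, e₁, g₁, l₁, hcol, hrow, -⟩ := (runs_markP hI.n0 hI.n1 hI.n2 hI.n3 hI.n4 h0.n14
    h0.n15 h0.n6 h0.n16 h0.n17).good (I := I) (ε := ε) rfl hG
  have F₁ := e₁.frame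
  have c16 : σ₁.nat 16 0 = 0 := by
    rcases hcol with h | ⟨-, j, hj, h⟩
    · exact h.1
    · obtain ⟨e, he, hej⟩ := hc j hj
      exact absurd hej (h e he)
  have c17 : σ₁.nat 17 0 = 0 := by
    rcases hrow with h | ⟨-, j, hj, h⟩
    · exact h.1
    · obtain ⟨e, he, hej⟩ := I.row_ne j hj
      exact absurd hej (h e he)
  have G₁ : I.Good ε σ₁ := by rw [Inst.Good, F₁.2 5 rfl]; exact hG
  obtain ⟨t₂, σ₂, e₂, g₂, l₂, h₂⟩ := runsJ_startP (hI.frame F₁ rfl) (by rw [F₁.1 5 rfl, h0.n5])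
    (by rw [F₁.2 5 rfl]; exact h0.r5)
  obtain ⟨t₃, σ₃, k, e₃, hk, inv, hb, g₃, m₃, c₃, l₃, p₃⟩ := exec_iterations (J := I.Good ε)
    (b := .nlt (.lit 0) (.reg 18)) (P := iterP) (T := I.maxIter ε)
    (c := 4 * I.sortCost + 282 * I.X) rfl (LoopInv I ε)
    (fun k σ h => h.2.1) (fun k σ h hb => runsJ_iterP hε h hb) h₂
  have hb16 : ¬ (Test.nlt (.lit 0) (.reg 16)).Holds σ₁ := by simp [Test.Holds, c16]
  have hb17 : ¬ (Test.nlt (.lit 0) (.reg 17)).Holds σ₁ := by simp [Test.Holds, c17]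
  have f₁ := e₁.markFree rfl
  have f₂ := e₂.markFree rfl
  set t := t₁ ++ ⟨false, σ₁⟩ :: ⟨false, σ₁⟩ :: t₂ with ht
  have ft : ∀ v ∈ t, v.isMark = false := by
    intro v hv
    simp only [ht, List.mem_append, List.mem_cons] at hv
    rcases hv with hv | rfl | rfl | hv
    exacts [f₁ v hv, rfl, rfl, f₂ v hv]
  have lt : t.length + 1 ≤ 130 * I.X := by
    have : 20 * (I.m + I.n + I.E + 1) = 20 * I.X := rfl
    simp only [ht, List.length_append, List.length_cons]
    omega
  refine ⟨t ++ t₃, σ₃, ?_, ⟨k, inv⟩, ?_, ?_, ?_, ?_, ?_, ?_⟩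
  · have := Exec.seq e₁ (Exec.ite_false (P := block [.nset 5 (.lit 1)]) hb16
      (Exec.ite_false (P := .seq (forLoop 10 1 (block [.nstore 6 (.reg 10) (.lit 1)]))
        (block [.nset 5 (.lit 1)])) hb17 (Exec.seq e₂ e₃)))
    rw [ht, List.append_assoc, List.cons_append, List.cons_append]
    exact this
  · simpa [Test.Holds] using hb
  · intro v hv
    simp only [ht, List.mem_append, List.mem_cons] at hv
    rcases hv with (hv | rfl | rfl | hv) | hv
    exacts [g₁ v hv, G₁, G₁, g₂ v hv, g₃ v hv]
  · intro v hv hm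
    rcases List.mem_append.1 hv with hv | hv
    · simp [ft v hv] at hm
    · exact m₃ v hv hm
  · have : iterationCount (t ++ t₃) = iterationCount t + iterationCount t₃ := by
      simp [iterationCount, List.countP_append]
    rw [this, iterationCount_of_markFree t ft, c₃, zero_add]
    exact hk
  · obtain ⟨L, hL, hL'⟩ := p₃ t ft
    exact ⟨_, L, hL, lt, fun x hx => (hL' x hx).trans (by omega)⟩
  · rw [List.length_append]
    have : k * (4 * I.sortCost + 282 * I.X + 2) ≤
        I.maxIter ε * (4 * I.sortCost + 284 * I.X) := Nat.mul_le_mul hk (by omega)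
    omega

/-- The properties of a run of the program on a problem with an empty row or column. -/
structure EmptyRun (m n E : ℕ) (row col : ℕ → ℕ) (σ : State) (tr : List Event) (σ' : State) :
    Prop where
  exec : Exec scalingProgram σ tr σ'
  markFree : ∀ v ∈ tr, v.isMark = false
  zero : ∀ v ∈ tr, ∀ k, v.state.real 5 k = 0
  length : tr.length ≤ 30 * (m + n + E + 1)
  flag : σ'.nat 5 0 = 1
  cert : (∃ j < n, ∀ e < E, col e ≠ j) ∧ (∀ j < n, σ'.nat 6 j = 1 ↔ ∀ e < E, col e ≠ j) ∨
    (∃ i < m, ∀ e < E, row e ≠ i) ∧ ∀ j < n, σ'.nat 6 j = 1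

theorem exists_emptyRun {m n E : ℕ} {row col : ℕ → ℕ} (hm : σ.nat 0 0 = m) (hn : σ.nat 1 0 = n)
    (hE : σ.nat 2 0 = E) (h3 : σ.nat 3 = row) (h4 : σ.nat 4 = col) (h0 : Blank σ)
    (h : (∃ j < n, ∀ e < E, col e ≠ j) ∨ ∃ i < m, ∀ e < E, row e ≠ i) :
    ∃ tr σ', EmptyRun m n E row col σ tr σ' := by
  have key : ∀ {P : Program} {τ : State} {N : ℕ} {Q : State → Prop}, Runs P τ N Q →
      P.realFree 5 = true → (∀ k, τ.real 5 k = 0) →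
      RunsJ (fun τ => ∀ k, τ.real 5 k = 0) P τ N Q := fun h hf h0 =>
    h.toRunsJ hf (fun w => ∀ k, w k = 0) h0
  obtain ⟨t₁, σ₁, e₁, g₁, l₁, hcol, hrow, h6⟩ := key (runs_markP hm hn hE h3 h4 h0.n14
    h0.n15 h0.n6 h0.n16 h0.n17) rfl h0.r5
  have F₁ := e₁.frame
  have y₁ : ∀ k, σ₁.real 5 k = 0 := by rw [F₁.2 5 rfl]; exact h0.r5
  have f₁ := e₁.markFree rfl
  rcases hcol with ⟨c16, hcol⟩ | ⟨c16, hcol⟩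
  · have hrow' : σ₁.nat 17 0 = 1 ∧ ∃ i < m, ∀ e < E, row e ≠ i := by
      rcases hrow with ⟨-, hr⟩ | hr
      · rcases h with ⟨j, hj, hj'⟩ | ⟨i, hi, hi'⟩
        · obtain ⟨e, he, hej⟩ := hcol j hj
          exact absurd hej (hj' e he)
        · obtain ⟨e, he, hei⟩ := hr i hi
          exact absurd hei (hi' e he)
      · exact hr
    have hs : Runs (.seq (forLoop 10 1 (block [.nstore 6 (.reg 10) (.lit 1)]))
        (block [.nset 5 (.lit 1)])) σ₁ ((n * (1 + 2) + 2) + 1) fun τ =>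
        τ.nat 5 0 = 1 ∧ ∀ j < n, τ.nat 6 j = 1 := by
      refine Runs.seq' (Runs.forLoop (c := 1) (fun k τ => ∀ j < k, τ.nat 6 j = 1)
        (by rw [F₁.1 1 rfl, hn]) rfl rfl (by decide) ?_ (by simp)) fun τ F h => Runs.block ?_
      · intro k hk τ hF h10 hN h
        refine Runs.block ?_
        simp [wp, Instr.Defined, Instr.step, h10]
        intro j hj
        rcases eq_or_ne j k with rfl | hjk
        · simp
        · simpa [hjk] using h j (by omega)
      · simpa [wp, Instr.Defined, Instr.step] using h
    obtain ⟨t₂, σ₂, e₂, g₂, l₂, h₂⟩ := key hs rfl y₁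
    have f₂ := e₂.markFree rfl
    have hb16 : ¬ (Test.nlt (.lit 0) (.reg 16)).Holds σ₁ := by simp [Test.Holds, c16]
    have hb17 : (Test.nlt (.lit 0) (.reg 17)).Holds σ₁ := by simp [Test.Holds, hrow'.1]
    refine ⟨_, σ₂, Exec.seq e₁ (Exec.ite_false hb16 (Exec.ite_true hb17 e₂)), ?_, ?_, ?_, h₂.1,
      Or.inr ⟨hrow'.2, h₂.2⟩⟩
    · intro v hv
      simp only [List.mem_append, List.mem_cons] at hv
      rcases hv with hv | rfl | rfl | hv
      exacts [f₁ v hv, rfl, rfl, f₂ v hv]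
    · intro v hv
      simp only [List.mem_append, List.mem_cons] at hv
      rcases hv with hv | rfl | rfl | hv
      exacts [g₁ v hv, y₁, y₁, g₂ v hv]
    · simp only [List.length_append, List.length_cons]
      omega
  · have hs : Runs (block [.nset 5 (.lit 1)]) σ₁ 1 fun τ => τ.nat 5 0 = 1 := by
      refine Runs.block ?_
      simp [wp, Instr.Defined, Instr.step]
    obtain ⟨t₂, σ₂, e₂, g₂, l₂, h₂⟩ := key hs rfl y₁
    have f₂ := e₂.markFree rfl
    have hb16 : (Test.nlt (.lit 0) (.reg 16)).Holds σ₁ := by simp [Test.Holds, c16]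
    refine ⟨_, σ₂, Exec.seq e₁ (Exec.ite_true hb16 e₂), ?_, ?_, ?_, h₂, Or.inl ⟨hcol, ?_⟩⟩
    · intro v hv
      simp only [List.mem_append, List.mem_cons] at hv
      rcases hv with hv | rfl | hv
      exacts [f₁ v hv, rfl, f₂ v hv]
    · intro v hv
      simp only [List.mem_append, List.mem_cons] at hv
      rcases hv with hv | rfl | hv
      exacts [g₁ v hv, y₁, g₂ v hv]
    · simp only [List.length_append, List.length_cons]
      omega
    · intro j hj
      rw [e₂.frame.1 6 rfl]
      rcases h6 j hj with h | ⟨h, e, he, hej⟩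
      · simp only [h.1, true_iff]
        exact h.2
      · simp only [h, zero_ne_one, false_iff]
        exact fun h' => h' e he hej

end

/-! ### From matrices to lists of entries and back -/

section

variable {m n : ℕ} {A : Matrix (Fin m) (Fin n) ℝ} {r : Fin m → ℝ} {c : Fin n → ℝ} {s ε : ℝ}
  {e : Fin (nnz A) ≃ Support A}

theorem inputState_row (k : Fin (nnz A)) : (inputState A r c ε e).nat 3 k = (e k).1.1 := by
  simp [inputState]

theorem inputState_col (k : Fin (nnz A)) : (inputState A r c ε e).nat 4 k = (e k).1.2 := by
  simp [inputState]

theorem inputState_entry (k : Fin (nnz A)) :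
    (inputState A r c ε e).real 0 k = A (e k).1.1 (e k).1.2 := by
  simp [inputState]

theorem inputState_rowTarget (i : Fin m) : (inputState A r c ε e).real 1 i = r i := by
  simp [inputState]

theorem inputState_colTarget (j : Fin n) : (inputState A r c ε e).real 2 j = c j := by
  simp [inputState]

theorem inputState_blank : Blank (inputState A r c ε e) :=
  ⟨rfl, fun _ => rfl, fun _ => rfl, fun _ => rfl, rfl, rfl, fun _ => rfl⟩

/-- Sums over the list of entries. -/
theorem sum_entries (e : Fin (nnz A) ≃ Support A) (G : Fin m → Fin n → ℝ)
    (hG : ∀ i j, A i j = 0 → G i j = 0) (g : ℕ → ℝ)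
    (hg : ∀ k : Fin (nnz A), g k = G (e k).1.1 (e k).1.2) :
    ∑ k ∈ range (nnz A), g k = ∑ i, ∑ j, G i j := by
  classical
  rw [sum_range, sum_congr rfl fun k _ => hg k,
    Equiv.sum_comp e fun p : Support A => G p.1.1 p.1.2, ← Fintype.sum_prod_type',
    ← sum_subtype (univ.filter fun p : Fin m × Fin n => A p.1 p.2 ≠ 0) (by simp)
      fun p => G p.1 p.2, sum_filter]
  refine sum_congr rfl fun p _ => ?_
  split_ifs with h
  · rfl
  · rw [hG _ _ (not_not.1 h)]

theorem scat_row_entries (G : Fin m → Fin n → ℝ) (hG : ∀ i j, A i j = 0 → G i j = 0) (g : ℕ → ℝ)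
    (hg : ∀ k : Fin (nnz A), g k = G (e k).1.1 (e k).1.2) (i : Fin m) :
    scat ((inputState A r c ε e).nat 3) g (nnz A) i = ∑ j, G i j := by
  rw [scat, sum_entries e (fun i' j => if i' = i then G i' j else 0)]
  · rw [sum_eq_single i]
    · simp
    · intro b _ hb
      simp [hb]
    · simp
  · intro i' j h
    simp [hG i' j h]
  · intro k
    simp only [inputState_row, hg k, Fin.ext_iff]

theorem scat_col_entries (G : Fin m → Fin n → ℝ) (hG : ∀ i j, A i j = 0 → G i j = 0) (g : ℕ → ℝ)
    (hg : ∀ k : Fin (nnz A), g k = G (e k).1.1 (e k).1.2) (j : Fin n) :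
    scat ((inputState A r c ε e).nat 4) g (nnz A) j = ∑ i, G i j := by
  rw [scat, sum_entries e (fun i j' => if j' = j then G i j' else 0)]
  · exact sum_congr rfl fun i _ => by simp
  · intro i j' h
    simp [hG i j' h]
  · intro k
    simp only [inputState_col, hg k, Fin.ext_iff]

theorem exists_row_entry (i : Fin m) {p : ℕ → Prop} :
    (∃ k < nnz A, (inputState A r c ε e).nat 3 k = i ∧ p ((inputState A r c ε e).nat 4 k)) ↔
      ∃ j : Fin n, A i j ≠ 0 ∧ p j := by
  constructor
  · rintro ⟨k, hk, h1, h2⟩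
    rw [inputState_row ⟨k, hk⟩] at h1
    rw [inputState_col ⟨k, hk⟩] at h2
    have := (e ⟨k, hk⟩).2
    rw [Fin.ext h1] at this
    exact ⟨_, this, h2⟩
  · rintro ⟨j, hA, hp⟩
    refine ⟨e.symm ⟨(i, j), hA⟩, (e.symm ⟨(i, j), hA⟩).2, ?_, ?_⟩
    · rw [inputState_row]
      simp
    · rw [inputState_col]
      simpa using hp

theorem exists_col_entry (j : Fin n) :
    (∃ k < nnz A, (inputState A r c ε e).nat 4 k = j) ↔ ∃ i : Fin m, A i j ≠ 0 := by
  constructor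
  · rintro ⟨k, hk, h2⟩
    rw [inputState_col ⟨k, hk⟩] at h2
    have := (e ⟨k, hk⟩).2
    rw [Fin.ext h2] at this
    exact ⟨_, this⟩
  · rintro ⟨i, hA⟩
    refine ⟨e.symm ⟨(i, j), hA⟩, (e.symm ⟨(i, j), hA⟩).2, ?_⟩
    rw [inputState_col]
    simp

variable (hA : ∀ i j, 0 ≤ A i j) (hr : ∀ i, 0 < r i) (hc : ∀ j, 0 < c j) (hrs : ∑ i, r i = s)
  (hcs : ∑ j, c j = s)

/-- The list form of a problem without empty rows. -/
noncomputable def inputInst (r : Fin m → ℝ) (c : Fin n → ℝ) (s ε : ℝ)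
    (e : Fin (nnz A) ≃ Support A) (hA : ∀ i j, 0 ≤ A i j) (hr : ∀ i, 0 < r i) (hc : ∀ j, 0 < c j)
    (hrs : ∑ i, r i = s) (hcs : ∑ j, c j = s) (hrow : ∀ i, ∃ j, A i j ≠ 0) : Inst where
  m := m
  n := n
  E := nnz A
  row := (inputState A r c ε e).nat 3
  col := (inputState A r c ε e).nat 4
  a := (inputState A r c ε e).real 0
  r := (inputState A r c ε e).real 1
  c := (inputState A r c ε e).real 2
  s := s
  row_lt k hk := by rw [inputState_row ⟨k, hk⟩]; exact Fin.is_lt _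
  col_lt k hk := by rw [inputState_col ⟨k, hk⟩]; exact Fin.is_lt _
  a_pos k hk := by
    rw [inputState_entry ⟨k, hk⟩]
    exact lt_of_le_of_ne (hA _ _) (e ⟨k, hk⟩).2.symm
  r_pos i hi := by rw [inputState_rowTarget ⟨i, hi⟩]; exact hr _
  c_pos j hj := by rw [inputState_colTarget ⟨j, hj⟩]; exact hc _
  inj k hk k' hk' h1 h2 := by
    rw [inputState_row ⟨k, hk⟩, inputState_row ⟨k', hk'⟩] at h1
    rw [inputState_col ⟨k, hk⟩, inputState_col ⟨k', hk'⟩] at h2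
    have := e.injective (Subtype.ext (Prod.ext (Fin.ext h1) (Fin.ext h2)))
    exact congrArg Fin.val this
  row_ne i hi := by
    obtain ⟨j, hj⟩ := hrow ⟨i, hi⟩
    obtain ⟨k, hk, h, -⟩ := (exists_row_entry (r := r) (c := c) (ε := ε) (e := e) ⟨i, hi⟩
      (p := fun _ => True)).2 ⟨j, hj, trivial⟩
    exact ⟨k, hk, h⟩
  sum_r := by
    rw [sum_range, ← hrs]
    exact sum_congr rfl fun i _ => inputState_rowTarget i
  sum_c := by
    rw [sum_range, ← hcs]
    exact sum_congr rfl fun j _ => inputState_colTarget j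

variable {hA hr hc hrs hcs} {hrow : ∀ i, ∃ j, A i j ≠ 0} {σ : State}

local notation "II" => inputInst r c s ε e hA hr hc hrs hcs hrow

theorem inputState_inp : Inp II ε (inputState A r c ε e) :=
  ⟨rfl, rfl, rfl, rfl, rfl, rfl, rfl, rfl, rfl⟩

/-- The row sums are exact by the choice of the row scaling, so the squared error consists of the
column part, which is the potential. -/
theorem isApproxScaling_of_evald {y : ℕ → ℝ} (hV : Evald II ε y σ) (hy : ∀ j < n, 0 < y j)
    (h : Inst.Φ II y ≤ ε ^ 2) :
    IsApproxScaling A r c ε (σ.rowScaling m) (fun j => y j) := by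
  have hy' : ∀ j < (II).n, 0 < y j := hy
  have hx : ∀ i : Fin m, σ.rowScaling m i = Inst.x II y i := fun i => hV.x i i.2
  have hB : ∀ i j, (Matrix.diagonal (σ.rowScaling m) * A * Matrix.diagonal fun j : Fin n => y j)
      i j = A i j * y j * Inst.x II y i := by
    intro i j
    rw [Matrix.mul_diagonal, Matrix.diagonal_mul, hx]
    ring
  have hk : ∀ k : Fin (nnz A), Inst.B II y k = A (e k).1.1 (e k).1.2 * y (e k).1.2 *
      Inst.x II y (e k).1.1 := by
    intro k
    rw [Inst.B]
    simp only [inputInst, inputState_entry, inputState_row, inputState_col]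
  have h0 : ∀ (i : Fin m) (j : Fin n), A i j = 0 → A i j * y j * Inst.x II y i = 0 := by
    intro i j h
    rw [h, zero_mul, zero_mul]
  refine ⟨fun i => ?_, fun j => hy j j.2, ?_⟩
  · rw [hx]
    exact Inst.x_pos hy' i.2
  · rw [IsApproxScaled]
    simp only [hB]
    have e1 : ∀ i : Fin m, ∑ j : Fin n, A i j * y j * Inst.x II y i - r i = 0 := by
      intro i
      have h1 := Inst.row_sum hy' (i := i) i.2
      have h2 := scat_row_entries (r := r) (c := c) (ε := ε) (e := e) _ h0 _ hk i
      have h3 : (II).r i = r i := inputState_rowTarget (c := c) (ε := ε) (e := e) i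
      rw [sub_eq_zero, ← h2, ← h3]
      exact h1
    have e2 : ∀ j : Fin n, ∑ i : Fin m, A i j * y j * Inst.x II y i - c j = Inst.d II y j := by
      intro j
      have h2 := scat_col_entries (r := r) (c := c) (ε := ε) (e := e) _ h0 _ hk j
      have h3 : (II).c j = c j := inputState_colTarget (r := r) (ε := ε) (e := e) j
      rw [Inst.d, Inst.q, h3, ← h2]
      rfl
    simp only [e1, e2]
    refine le_trans (le_of_eq ?_) h
    have e3 : Inst.Φ II y = ∑ j : Fin n, Inst.d II y j * Inst.d II y j := sum_range _
    rw [e3]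
    simp [sq]

theorem isInfeasibilityCertificate_of_cert (h : Inst.Cert II fun j => σ.nat 6 j = 1) :
    IsInfeasibilityCertificate A r c (σ.columnSet n) := by
  classical
  rw [IsInfeasibilityCertificate]
  rw [Inst.Cert] at h
  have h1 : ∑ i ∈ neighborhood A (σ.columnSet n), r i =
      ∑ i ∈ range m, (if ∃ k < nnz A, (inputState A r c ε e).nat 3 k = i ∧
        σ.nat 6 ((inputState A r c ε e).nat 4 k) = 1 then (inputState A r c ε e).real 1 i else 0) := by
    rw [sum_range, neighborhood, sum_filter]
    refine sum_congr rfl fun i _ => ?_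
    rw [inputState_rowTarget]
    refine if_congr ?_ rfl rfl
    rw [exists_row_entry i (p := fun j => σ.nat 6 j = 1)]
    refine exists_congr fun j => ?_
    rw [State.columnSet, mem_filter]
    constructor
    · rintro ⟨⟨-, h⟩, hA⟩
      exact ⟨hA.ne', h⟩
    · rintro ⟨h, h'⟩
      exact ⟨⟨mem_univ _, h'⟩, lt_of_le_of_ne (hA i j) h.symm⟩
  have h2 : ∑ j ∈ σ.columnSet n, c j =
      ∑ j ∈ range n, (if σ.nat 6 j = 1 then (inputState A r c ε e).real 2 j else 0) := by
    rw [sum_range, State.columnSet, sum_filter]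
    exact sum_congr rfl fun j _ => by rw [inputState_colTarget]
  rw [h1, h2]
  convert h <;> rfl

end

/-! ### Bounds for precision, sizes and running time -/

theorem Sz.abs_le {x : ℝ} {w : ℕ} (h : Sz x w) : |x| ≤ 2 ^ w := by
  obtain ⟨p, d, h1, rfl, h3, -⟩ := h
  have hd : (1 : ℝ) ≤ d := by exact_mod_cast h1
  have hp : |(p : ℝ)| ≤ 2 ^ w := by
    rw [← Int.cast_abs, Int.abs_eq_natAbs]
    exact_mod_cast h3
  rw [abs_div, Nat.abs_cast]
  exact (div_le_self (abs_nonneg _) hd).trans hp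

section

variable {I : Inst} {ε x : ℝ}

/-- Entries of size b have ratios of at most 2^(2b), which serves as M in the definition of
admissible values. The numerator then has at most p more bits than the value. -/
theorem Inst.Value.sz {P b : ℕ} (h : I.Value ε x)
    (hP : ∀ p : ℕ, (p = 0 ∨ 2 ^ (p - 1) * ε ^ 2 < 128 * I.s ^ 2 * I.n ^ 5) → p ≤ P)
    (ha : ∀ e < I.E, Sz (I.a e) b) : Sz x (P + 1 + I.n * (P + 2 * b)) := by
  obtain ⟨p, k, hp, rfl, hM⟩ := h
  have hpP := hP p hp
  have h1 := hM (2 ^ (2 * b)) (one_le_pow₀ one_le_two) fun e he e' he' => by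
    rw [div_eq_mul_inv, two_mul, pow_add]
    exact mul_le_mul ((le_abs_self _).trans (ha e he).abs_le)
      ((le_abs_self _).trans (ha e' he').inv.abs_le) (inv_nonneg.2 (I.a_pos e' he').le)
      (by positivity)
  refine ⟨k, 2 ^ p, by positivity, by push_cast; rfl, ?_, ?_⟩
  · rw [Int.natAbs_natCast]
    rw [div_le_iff₀ (by positivity), ← pow_add, ← pow_mul] at h1
    have h2 : k ≤ 2 ^ (p + 1 + I.n * (p + 2 * b)) := by
      have : (2 : ℝ) ^ (p + 1 + I.n * (p + 2 * b)) = 2 * 2 ^ ((p + 2 * b) * I.n) * 2 ^ p := by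
        rw [pow_add, pow_succ, mul_comm I.n]
        ring
      rw [← this] at h1
      exact_mod_cast h1
    refine h2.trans (Nat.pow_le_pow_right (by norm_num) ?_)
    gcongr
  · exact Nat.pow_le_pow_right (by norm_num) (by omega)

/-- The bound `t` on s / ε is left free: it is 2 + s / ε for real data and a power of 2 for rational
data. -/
theorem two_pow_precision_lt {p n : ℕ} {s t : ℝ} (hε : 0 < ε) (hs : 0 ≤ s) (ht : s / ε ≤ t)
    (h : 2 ^ p * ε ^ 2 < 128 * s ^ 2 * n ^ 5) : (2 : ℝ) ^ p < 2 ^ (7 + 5 * n) * t ^ 2 := by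
  have h1 : (2 : ℝ) ^ p < 128 * n ^ 5 * (s / ε) ^ 2 := by
    rw [div_pow, ← mul_div_assoc, lt_div_iff₀ (by positivity)]
    linarith
  have h2 : ((n : ℝ)) ^ 5 ≤ 2 ^ (5 * n) := by
    rw [mul_comm, pow_mul]
    gcongr
    exact_mod_cast Nat.lt_two_pow_self.le
  calc (2 : ℝ) ^ p < 128 * n ^ 5 * (s / ε) ^ 2 := h1
    _ ≤ 128 * 2 ^ (5 * n) * t ^ 2 := by
      have : 0 ≤ s / ε := by positivity
      gcongr
    _ = _ := by rw [pow_add]; norm_num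

/-- The coefficient 3 dominates 2 / log 2. The argument 2 + s / ε keeps the logarithm positive even
for small s / ε. -/
theorem precision_le_log {p n : ℕ} {s : ℝ} (hε : 0 < ε) (hs : 0 ≤ s)
    (h : p = 0 ∨ 2 ^ (p - 1) * ε ^ 2 < 128 * s ^ 2 * n ^ 5) :
    (p : ℝ) ≤ 8 + 5 * n + 3 * Real.log (2 + s / ε) := by
  have h0 : 0 ≤ s / ε := by positivity
  have hL : 0 ≤ Real.log (2 + s / ε) := Real.log_nonneg (by linarith)
  rcases h with rfl | h
  · push_cast
    positivity
  rcases Nat.eq_zero_or_pos p with rfl | hp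
  · push_cast
    positivity
  have h1 := two_pow_precision_lt hε hs (t := 2 + s / ε) (by linarith) h
  have h2 := Real.log_lt_log (by positivity) h1
  rw [Real.log_mul (by positivity) (by positivity), Real.log_pow, Real.log_pow, Real.log_pow] at h2
  have h3 := Real.log_two_gt_d9
  push_cast [Nat.cast_sub hp] at h2
  nlinarith

theorem precision_le_of_bits {p n b : ℕ} {s : ℝ} (hε : 0 < ε) (hs : 0 ≤ s)
    (ht : s / ε ≤ 2 ^ (n + 2 * b))
    (h : p = 0 ∨ 2 ^ (p - 1) * ε ^ 2 < 128 * s ^ 2 * n ^ 5) : p ≤ 7 + 7 * n + 4 * b := by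
  rcases h with rfl | h
  · omega
  have h1 := two_pow_precision_lt hε hs ht h
  rw [← pow_mul, ← pow_add] at h1
  have := (pow_lt_pow_iff_right₀ (one_lt_two : (1 : ℝ) < 2)).1 h1
  omega

theorem Inst.m_le_E : I.m ≤ I.E := by
  have : range I.m ⊆ (range I.E).image I.row := fun i hi => by
    obtain ⟨e, he, h⟩ := I.row_ne i (mem_range.1 hi)
    exact mem_image.2 ⟨e, mem_range.2 he, h⟩
  simpa using (card_le_card this).trans card_image_le

theorem Inst.n_le_E (h : ∀ j < I.n, ∃ e < I.E, I.col e = j) : I.n ≤ I.E := by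
  have : range I.n ⊆ (range I.E).image I.col := fun i hi => by
    obtain ⟨e, he, h⟩ := h i (mem_range.1 hi)
    exact mem_image.2 ⟨e, mem_range.2 he, h⟩
  simpa using (card_le_card this).trans card_image_le

theorem Inst.E_le : I.E ≤ I.m * I.n := by
  have : ((range I.E).image fun e => (I.row e, I.col e)) ⊆ range I.m ×ˢ range I.n := by
    intro p hp
    obtain ⟨e, he, rfl⟩ := mem_image.1 hp
    simp only [mem_product, mem_range] at he ⊢
    exact ⟨I.row_lt e he, I.col_lt e he⟩
  have h := card_le_card this
  rw [card_image_of_injOn, card_product] at h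
  · simpa using h
  · intro e he e' he' h
    rw [Prod.mk.injEq] at h
    exact I.inj e (by simpa using he) e' (by simpa using he') h.1 h.2

/-- Without empty rows and columns, m and n are at most the number E ≥ 1 of entries, so the size X
is at most 4 E and its logarithm grows by at most 2. -/
theorem Inst.iteration_cost_le (hE : 0 < I.E) (hn : I.n ≤ I.E) :
    4 * I.sortCost + 283 * I.X ≤ 6000 * I.E * (Nat.log 2 I.E + 1) := by
  have hX : I.X ≤ I.E * 2 ^ 2 := by
    have := I.m_le_E
    simp only [X]
    omega
  have hlog : Nat.log 2 I.X ≤ Nat.log 2 I.E + 2 := by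
    calc Nat.log 2 I.X ≤ Nat.log 2 (I.E * 2 ^ 2) := Nat.log_mono_right hX
      _ = _ := by
        rw [pow_two, ← mul_assoc, Nat.log_mul_base (by norm_num) (by positivity),
          Nat.log_mul_base (by norm_num) hE.ne']
  calc 4 * I.sortCost + 283 * I.X = (200 * (Nat.log 2 I.X + 1) + 283) * I.X := by
        rw [sortCost]; ring
    _ ≤ (200 * (Nat.log 2 I.E + 2 + 1) + 283) * (I.E * 2 ^ 2) := by gcongr
    _ = I.E * (800 * Nat.log 2 I.E + 3532) := by ring
    _ ≤ I.E * (6000 * (Nat.log 2 I.E + 1)) := by gcongr; omega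
    _ = _ := by ring

theorem Inst.maxIter_le {b : ℕ} (hs : 0 ≤ I.s) (hε : 0 < ε)
    (ht : I.s / ε ≤ 2 ^ (I.n + 2 * b)) : I.maxIter ε ≤ 144 * (I.n ^ 3 * (I.n + b)) := by
  have h1 : I.s * I.n / ε ≤ 2 ^ (2 * (I.n + b)) := by
    have h2 : (I.n : ℝ) ≤ 2 ^ I.n := by exact_mod_cast Nat.lt_two_pow_self.le
    calc I.s * I.n / ε = I.s / ε * I.n := by ring
      _ ≤ 2 ^ (I.n + 2 * b) * 2 ^ I.n := by gcongr
      _ = _ := by rw [← pow_add]; congr 1; ring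
  have h2 : Real.posLog (I.s * I.n / ε) ≤ 2 * (I.n + b) := by
    rw [Real.posLog_def]
    refine max_le (by positivity) ?_
    change Real.log _ ≤ _
    -- The argument may be 0, where the logarithm takes the value 0.
    rcases (by positivity : 0 ≤ I.s * I.n / ε).eq_or_lt with h | h
    · rw [← h, Real.log_zero]
      positivity
    · have := Real.log_le_log h h1
      rw [Real.log_pow] at this
      push_cast at this
      have h3 := Real.log_two_lt_d9
      have h4 : (0 : ℝ) ≤ I.n + b := by positivity
      nlinarith
  rw [maxIter]
  refine Nat.floor_le_of_le ?_
  push_cast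
  calc 72 * ((I.n : ℝ) ^ 3 * Real.posLog (I.s * I.n / ε))
      ≤ 72 * ((I.n : ℝ) ^ 3 * (2 * (I.n + b))) := by gcongr
    _ = _ := by ring

end

/-- The length of a run is polynomial in the size of rational input. -/
theorem MainRun.length_le {I : Inst} {ε : ℝ} {σ σ' : State} {tr : List Event} {b N : ℕ}
    (h : MainRun I ε σ tr σ') (hs : 0 ≤ I.s) (hε : 0 < ε) (ht : I.s / ε ≤ 2 ^ (I.n + 2 * b))
    (hN : I.n + I.m + b + 1 = N) : tr.length + 1 ≤ 300000 * N ^ 8 := by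
  have hN1 : 1 ≤ N := by omega
  have hX : I.X ≤ 2 * N ^ 2 := by
    have h1 := I.E_le
    have h2 : I.m * I.n ≤ N * N := Nat.mul_le_mul (by omega) (by omega)
    have h3 : N ≤ N * N := Nat.le_mul_self N
    rw [pow_two]
    simp only [Inst.X]
    omega
  have hS : I.sortCost ≤ 50 * I.X ^ 2 := by
    have : Nat.log 2 I.X < I.X := Nat.log_lt_self 2 (by simp [Inst.X])
    calc I.sortCost ≤ I.X * (I.X * 50) := Nat.mul_le_mul_right _ this
      _ = _ := by ring
  have hX1 : I.X ≤ I.X ^ 2 := by rw [pow_two]; exact Nat.le_mul_self _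
  have hT : I.maxIter ε ≤ 144 * N ^ 4 := by
    refine (Inst.maxIter_le hs hε ht).trans ?_
    calc 144 * (I.n ^ 3 * (I.n + b)) ≤ 144 * (N ^ 3 * N) := by gcongr <;> omega
      _ = _ := by ring
  have h8 : ∀ k ≤ 8, N ^ k ≤ N ^ 8 := fun k hk => Nat.pow_le_pow_right hN1 hk
  calc tr.length + 1 ≤ 130 * I.X + I.maxIter ε * (4 * I.sortCost + 284 * I.X) + 1 :=
        Nat.succ_le_succ h.length
    _ ≤ 130 * I.X + I.maxIter ε * (484 * I.X ^ 2) + 1 := by gcongr; omega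
    _ ≤ 130 * (2 * N ^ 2) + 144 * N ^ 4 * (484 * (2 * N ^ 2) ^ 2) + 1 := by gcongr
    _ = 260 * N ^ 2 + 278784 * N ^ 8 + N ^ 0 := by ring
    _ ≤ 260 * N ^ 8 + 278784 * N ^ 8 + N ^ 8 := by gcongr <;> first | exact hN1 | norm_num
    _ ≤ 300000 * N ^ 8 := by omega

/-- Size O(N²) at level 0, run length O(N⁸) and 16 levels give the exponent 2 + 8 · 16 = 130, and 38
= 2 · 18 + 2 comes from counting the bits of numerator and denominator. The same K serves as
coefficient and as exponent. -/
theorem hasBitComplexity_of_sz {x : ℝ} {w l N K : ℕ} (hN : 1 ≤ N) (hw : w ≤ 17 * N ^ 2)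
    (hl : l + 1 ≤ 300000 * N ^ 8) (hK : 6000 + 38 * 3300000 ^ 16 ≤ K)
    (h : Sz x ((w + 1) * (11 * (l + 1)) ^ 16)) : HasBitComplexity x (K * N ^ K : ℕ) := by
  refine h.hasBitComplexity ?_
  rw [Nat.cast_le]
  have h1 : 1 ≤ N ^ 2 := Nat.one_le_pow _ _ hN
  have h2 : 1 ≤ 3300000 ^ 16 * N ^ 130 := Nat.mul_pos (by norm_num) (Nat.pow_pos hN)
  have h3 : (w + 1) * (11 * (l + 1)) ^ 16 ≤ 18 * (3300000 ^ 16 * N ^ 130) :=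
    calc (w + 1) * (11 * (l + 1)) ^ 16 ≤ (18 * N ^ 2) * (11 * (300000 * N ^ 8)) ^ 16 := by
          gcongr; omega
      _ = _ := by rw [← mul_assoc 11, mul_pow, ← pow_mul]; ring
  have h130 : 130 ≤ K := le_trans (by norm_num) hK
  calc 2 * ((w + 1) * (11 * (l + 1)) ^ 16) + 2 ≤ 38 * (3300000 ^ 16 * N ^ 130) := by
        generalize 3300000 ^ 16 * N ^ 130 = Z at *
        omega
    _ = 38 * 3300000 ^ 16 * N ^ 130 := by ring
    _ ≤ K * N ^ K := by
      refine Nat.mul_le_mul (le_trans (Nat.le_add_left _ _) hK) (Nat.pow_le_pow_right hN h130)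

section

variable {m n : ℕ} {A : Matrix (Fin m) (Fin n) ℝ} {r : Fin m → ℝ} {c : Fin n → ℝ} {s ε : ℝ}
  {e : Fin (nnz A) ≃ Support A}

theorem inputState_sz {b : ℕ} (hA : ∀ i j, HasBitComplexity (A i j) b)
    (hr : ∀ i, HasBitComplexity (r i) b) (hc : ∀ j, HasBitComplexity (c j) b)
    (hε : HasBitComplexity ε b) (a k : ℕ) : Sz ((inputState A r c ε e).real a k) b := by
  simp only [inputState]
  split
  · split_ifs
    exacts [(hA _ _).sz, Sz.zero _]
  · split_ifs
    exacts [(hr _).sz, Sz.zero _]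
  · split_ifs
    exacts [(hc _).sz, Sz.zero _]
  · split_ifs
    exacts [hε.sz, Sz.zero _]
  · exact Sz.zero _

/-- Level 0 consists of the input arrays `0` to `3`, which are never written, and of the column
scaling, whose bound is assumed. -/
theorem memory_sz {b w : ℕ} {tr : List Event} {σ' : State}
    (h : Exec scalingProgram (inputState A r c ε e) tr σ')
    (hσ : ∀ a k, Sz ((inputState A r c ε e).real a k) b) (hw : b ≤ w)
    (h5 : ∀ v ∈ tr, ∀ k, Sz (v.state.real 5 k) w) :
    ∀ v ∈ tr, ∀ a k, Sz (v.state.real a k) ((w + 1) * (11 * (tr.length + 1)) ^ 16) := by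
  have h0 : ∀ v ∈ tr, LevelBound level v.state 0 w := by
    intro v hv a k ha
    have hfree : scalingProgram.realFree a = true → Sz (v.state.real a k) w := fun hf => by
      rw [(h.realFree_trace a hf).2 v hv]
      exact (hσ a k).mono hw
    have : a = 0 ∨ a = 1 ∨ a = 2 ∨ a = 3 ∨ a = 5 := by
      revert ha
      unfold level
      split <;> simp
    rcases this with rfl | rfl | rfl | rfl | rfl
    exacts [hfree rfl, hfree rfl, hfree rfl, hfree rfl, h5 v hv k]
  exact fun v hv a k => Exec.levelBound rfl h scalingProgram_leveled
    (fun a k => (hσ a k).mono hw) h0 16 v hv a k (level_le a)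

theorem sum_div_le {b : ℕ} (hε : 0 < ε) (hcs : ∑ j, c j = s)
    (hc : ∀ j, Sz (c j) b) (hε' : Sz ε b) : s / ε ≤ 2 ^ (n + 2 * b) := by
  have h1 : s ≤ 2 ^ n * 2 ^ b := by
    rw [← hcs]
    calc ∑ j, c j ≤ ∑ _j : Fin n, (2 : ℝ) ^ b :=
          sum_le_sum fun j _ => (le_abs_self _).trans (hc j).abs_le
      _ = n * 2 ^ b := by simp
      _ ≤ 2 ^ n * 2 ^ b := by
        gcongr
        exact_mod_cast Nat.lt_two_pow_self.le
  have h2 : ε⁻¹ ≤ 2 ^ b := (le_abs_self _).trans hε'.inv.abs_le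
  calc s / ε = s * ε⁻¹ := div_eq_mul_inv _ _
    _ ≤ 2 ^ n * 2 ^ b * 2 ^ b := mul_le_mul h1 h2 (by positivity) (by positivity)
    _ = _ := by rw [pow_add, two_mul, pow_add]; ring

end

/-- A bound for the bit complexity of column scalings. -/
theorem column_bits_le {n m b N K P : ℕ} {L : ℝ} (hN : n + m + b + 1 = N) (hL : 1 ≤ 2 * L)
    (hP : (P : ℝ) ≤ 8 + 5 * n + 3 * L) (hK : 200 ≤ K) :
    ((2 * (P + 1 + n * (P + 2 * b)) + 2 : ℕ) : ℝ) ≤ K * (N : ℝ) ^ K * L := by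
  have hN1 : (1 : ℝ) ≤ N := by exact_mod_cast (by omega : 1 ≤ N)
  have hn : (n : ℝ) + 1 ≤ N := by exact_mod_cast (by omega : n + 1 ≤ N)
  have hb : (b : ℝ) ≤ N := by exact_mod_cast (by omega : b ≤ N)
  have hn0 : (0 : ℝ) ≤ n := by positivity
  have hL0 : 0 ≤ L := by linarith
  have h1 : (P : ℝ) ≤ 29 * N * L := by
    have h2 : (8 + 5 * n : ℝ) ≤ 13 * N := by linarith
    -- Terms without a logarithm are absorbed using 1 ≤ 2 L, which holds in the application since
    -- log 2 > 1/2.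
    have h3 : (13 * N : ℝ) ≤ 13 * N * (2 * L) := le_mul_of_one_le_right (by positivity) hL
    have h4 : 3 * L ≤ 3 * N * L := by nlinarith
    linarith
  have h2 : (P : ℝ) + 2 * b ≤ 33 * N * L := by
    have : (2 * N : ℝ) ≤ 2 * N * (2 * L) := le_mul_of_one_le_right (by positivity) hL
    linarith
  have h3 : ((n : ℝ) + 1) * (P + 2 * b) ≤ N * (33 * N * L) := by gcongr
  have h4 : (1 : ℝ) ≤ N ^ 2 := one_le_pow₀ hN1
  have h5 : (4 : ℝ) ≤ N ^ 2 * (8 * L) := by nlinarith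
  have h6 : (N : ℝ) ^ 2 ≤ N ^ K := pow_le_pow_right₀ hN1 (by omega)
  have hK' : (200 : ℝ) ≤ K := by exact_mod_cast hK
  push_cast
  calc (2 * ((P : ℝ) + 1 + n * (P + 2 * b)) + 2 : ℝ)
      ≤ 2 * (((n : ℝ) + 1) * (P + 2 * b)) + 4 := by
        have : (0 : ℝ) ≤ b := by positivity
        linarith
    _ ≤ 2 * (N * (33 * N * L)) + N ^ 2 * (8 * L) := by gcongr
    _ = 74 * N ^ 2 * L := by ring
    _ ≤ K * (N : ℝ) ^ K * L := by gcongr; linarith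

/-! ### The conclusion for problems with and without empty rows or columns -/

section

variable {m n : ℕ} {A : Matrix (Fin m) (Fin n) ℝ} {r : Fin m → ℝ} {c : Fin n → ℝ} {s ε : ℝ}
  {e : Fin (nnz A) ≃ Support A}

/-- The conclusion of the main theorem for one problem. -/
def Conclusion (K : ℕ) (A : Matrix (Fin m) (Fin n) ℝ) (r : Fin m → ℝ) (c : Fin n → ℝ) (s ε : ℝ)
    (e : Fin (nnz A) ≃ Support A) : Prop :=
  ∃ (tr : List Event) (σ : State), Exec scalingProgram (inputState A r c ε e) tr σ ∧
    ((σ.flag = 0 ∧ IsApproxScaling A r c ε (σ.rowScaling m) (σ.columnScaling n)) ∨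
      (σ.flag = 1 ∧ IsInfeasibilityCertificate A r c (σ.columnSet n))) ∧
    (iterationCount tr : ℝ) ≤ K * (n : ℝ) ^ 3 * Real.posLog (s * n / ε) ∧
    (∀ t ∈ (phaseCosts tr).head?,
      t ≤ K * (nnz A + m + n + 1) * (Nat.log 2 (nnz A + m + n + 1) + 1) ^ K) ∧
    (∀ t ∈ (phaseCosts tr).tail, t ≤ K * nnz A * (Nat.log 2 (nnz A) + 1) ^ K) ∧
    (∀ v ∈ tr, v.isMark = true → ∀ j, 0 < v.state.columnScaling n j) ∧
    (∀ b : ℕ, (∀ i j, HasBitComplexity (A i j) b) →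
      (∀ v ∈ tr, v.isMark = true → ∀ j, HasBitComplexity (v.state.columnScaling n j)
        (K * (n + m + b + 1) ^ K * Real.log (2 + s / ε))) ∧
      (σ.flag = 0 → ∀ j, HasBitComplexity (σ.columnScaling n j)
        (K * (n + m + b + 1) ^ K * Real.log (2 + s / ε)))) ∧
    (∀ b : ℕ, (∀ i j, HasBitComplexity (A i j) b) → (∀ i, HasBitComplexity (r i) b) →
      (∀ j, HasBitComplexity (c j) b) → HasBitComplexity ε b →
      ∀ v ∈ tr, ∀ a k, HasBitComplexity (v.state.real a k) (K * (n + m + b + 1) ^ K))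

theorem hasBitComplexity_cast {x : ℝ} {b K : ℕ}
    (h : HasBitComplexity x (K * (n + m + b + 1) ^ K : ℕ)) :
    HasBitComplexity x (K * (n + m + b + 1) ^ K) := by
  push_cast at h
  exact h

theorem initialization_cost_le {K M t : ℕ} (hK : 130 ≤ K) (h : t ≤ 130 * M) :
    t ≤ K * M * (Nat.log 2 M + 1) ^ K :=
  h.trans ((Nat.mul_le_mul_right _ hK).trans
    (Nat.le_mul_of_pos_right _ (Nat.pow_pos (Nat.succ_pos _))))

/-- The empty columns have no neighbours, while their targets are positive. If only a row is empty,
the set of all columns is a certificate: its targets sum to s, and its neighbourhood misses a row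
with positive target. -/
theorem conclusion_of_empty {K : ℕ} (hK : 6000 + 38 * 3300000 ^ 16 ≤ K)
    (hr : ∀ i, 0 < r i) (hc : ∀ j, 0 < c j) (hrs : ∑ i, r i = s) (hcs : ∑ j, c j = s)
    (h : (∃ j, ∀ i, A i j = 0) ∨ ∃ i, ∀ j, A i j = 0) : Conclusion K A r c s ε e := by
  classical
  have hcol : ∀ j : Fin n, (∀ k < nnz A, (inputState A r c ε e).nat 4 k ≠ j) ↔ ∀ i, A i j = 0 := by
    intro j
    have := not_congr (exists_col_entry (r := r) (c := c) (ε := ε) (e := e) j)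
    push Not at this
    exact this
  have hrow : ∀ i : Fin m, (∀ k < nnz A, (inputState A r c ε e).nat 3 k ≠ i) ↔ ∀ j, A i j = 0 := by
    intro i
    have := not_congr (exists_row_entry (r := r) (c := c) (ε := ε) (e := e) i (p := fun _ => True))
    push Not at this
    simpa using this
  obtain ⟨tr, σ, hrun⟩ := exists_emptyRun (m := m) (n := n) (E := nnz A) rfl rfl rfl rfl rfl
    (inputState_blank (r := r) (c := c) (ε := ε) (e := e))
    (h.imp (fun ⟨j, hj⟩ => ⟨j, j.2, (hcol j).2 hj⟩) fun ⟨i, hi⟩ => ⟨i, i.2, (hrow i).2 hi⟩)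
  have hph := phaseCosts_of_markFree tr hrun.markFree
  have hno : ∀ v ∈ tr, v.isMark = true → False := fun v hv h => by
    simp [hrun.markFree v hv] at h
  have hflag : σ.flag = 1 := hrun.flag
  refine ⟨tr, σ, hrun.exec, Or.inr ⟨hflag, ?_⟩, ?_, ?_, ?_, fun v hv h => (hno v hv h).elim,
    fun b _ => ⟨fun v hv h => (hno v hv h).elim, fun h => by omega⟩, ?_⟩
  · rw [IsInfeasibilityCertificate]
    rcases hrun.cert with ⟨⟨j, hj, hj'⟩, h6⟩ | ⟨⟨i, hi, hi'⟩, h6⟩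
    · have hmem : ∀ j : Fin n, j ∈ σ.columnSet n ↔ ∀ i, A i j = 0 := by
        intro j
        simp only [State.columnSet, mem_filter, mem_univ, true_and]
        rw [h6 j j.2, hcol]
      have h1 : neighborhood A (σ.columnSet n) = ∅ := by
        refine filter_eq_empty_iff.2 fun i _ => ?_
        rintro ⟨j, hj, hA⟩
        exact hA.ne' ((hmem j).1 hj i)
      rw [h1, sum_empty]
      exact sum_pos (fun j _ => hc j) ⟨⟨j, hj⟩, (hmem _).2 ((hcol ⟨j, hj⟩).1 hj')⟩
    · have h1 : σ.columnSet n = univ := by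
        refine eq_univ_iff_forall.2 fun j => ?_
        simp [State.columnSet, h6 j j.2]
      rw [h1, hcs, ← hrs]
      refine sum_lt_sum_of_subset (subset_univ _) (mem_univ ⟨i, hi⟩) ?_ (hr _)
        fun i _ _ => (hr i).le
      rintro h
      obtain ⟨j, -, hA⟩ := (mem_filter.1 h).2
      exact hA.ne' ((hrow ⟨i, hi⟩).1 hi' j)
  · rw [iterationCount_of_markFree tr hrun.markFree, Nat.cast_zero]
    exact mul_nonneg (by positivity) Real.posLog_nonneg
  · rw [hph]
    intro t ht
    simp only [List.head?_cons, Option.mem_def, Option.some.injEq] at ht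
    have := hrun.length
    exact initialization_cost_le (le_trans (by norm_num) hK) (by omega)
  · simp [hph]
  · intro b hAb hrb hcb hεb v hv a k
    have hN1 : 1 ≤ n + m + b + 1 := by omega
    refine hasBitComplexity_cast (hasBitComplexity_of_sz hN1 (w := b) (l := tr.length) ?_ ?_ hK ?_)
    · have := Nat.le_mul_self (n + m + b + 1)
      rw [pow_two]
      omega
    · have hE : nnz A ≤ m * n := by
        rw [nnz]
        refine (Finite.card_subtype_le _).trans ?_
        simp
      have h2 : m * n ≤ (n + m + b + 1) * (n + m + b + 1) := Nat.mul_le_mul (by omega) (by omega)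
      have h3 := Nat.le_mul_self (n + m + b + 1)
      have h4 : (n + m + b + 1) * (n + m + b + 1) ≤ (n + m + b + 1) ^ 8 := by
        rw [← pow_two]
        exact Nat.pow_le_pow_right hN1 (by norm_num)
      have := hrun.length
      omega
    · exact memory_sz hrun.exec (inputState_sz hAb hrb hcb hεb) le_rfl
        (fun v hv k => by rw [hrun.zero v hv k]; exact Sz.zero _) v hv a k

theorem conclusion_of_full {K : ℕ} (hK : 6000 + 38 * 3300000 ^ 16 ≤ K) (hA : ∀ i j, 0 ≤ A i j)
    (hr : ∀ i, 0 < r i) (hc : ∀ j, 0 < c j) (hrs : ∑ i, r i = s) (hcs : ∑ j, c j = s) (hε : 0 < ε)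
    (hrow : ∀ i, ∃ j, A i j ≠ 0) (hcol : ∀ j, ∃ i, A i j ≠ 0) : Conclusion K A r c s ε e := by
  have hcol' : ∀ j < (inputInst r c s ε e hA hr hc hrs hcs hrow).n,
      ∃ k < (inputInst r c s ε e hA hr hc hrs hcs hrow).E,
        (inputInst r c s ε e hA hr hc hrs hcs hrow).col k = j :=
    fun j hj => (exists_col_entry (r := r) (c := c) (ε := ε) (e := e) ⟨j, hj⟩).2 (hcol ⟨j, hj⟩)
  obtain ⟨tr, σ, hrun⟩ := exists_mainRun hε
    (inputState_inp (hA := hA) (hr := hr) (hc := hc) (hrs := hrs) (hcs := hcs) (hrow := hrow))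
    inputState_blank hcol'
  have hs0 : 0 ≤ s := by
    rw [← hrs]
    exact sum_nonneg fun i _ => (hr i).le
  have hXe : (inputInst r c s ε e hA hr hc hrs hcs hrow).X = nnz A + m + n + 1 := by
    simp only [Inst.X, inputInst]
    omega
  have hK0 : 6000 ≤ K := le_trans (Nat.le_add_right _ _) hK
  have hit : (iterationCount tr : ℝ) ≤ 72 * ((n : ℝ) ^ 3 * Real.posLog (s * n / ε)) := by
    have hpos : 0 ≤ 72 * ((n : ℝ) ^ 3 * Real.posLog (s * n / ε)) :=
      mul_nonneg (by norm_num) (mul_nonneg (by positivity) Real.posLog_nonneg)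
    exact (Nat.cast_le.2 hrun.iter).trans (Nat.floor_le hpos)
  have haz : ∀ b : ℕ, (∀ i j, HasBitComplexity (A i j) b) →
      ∀ k < nnz A, Sz ((inputState A r c ε e).real 0 k) b := by
    intro b hb k hk
    rw [inputState_entry ⟨k, hk⟩]
    exact (hb _ _).sz
  have hcs' : ∀ b : ℕ, (∀ i j, HasBitComplexity (A i j) b) → ∀ x : ℝ,
      Inst.Value (inputInst r c s ε e hA hr hc hrs hcs hrow) ε x →
      HasBitComplexity x (K * (n + m + b + 1) ^ K * Real.log (2 + s / ε)) := by
    intro b hb x hx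
    have h0 : 0 ≤ s / ε := by positivity
    have hL : Real.log 2 ≤ Real.log (2 + s / ε) := Real.log_le_log (by norm_num) (by linarith)
    have hlog := Real.log_two_gt_d9
    have hL0 : 0 ≤ Real.log (2 + s / ε) := by linarith
    have h1 := hx.sz (P := ⌊8 + 5 * (n : ℝ) + 3 * Real.log (2 + s / ε)⌋₊) (b := b)
      (fun p hp => Nat.le_floor (precision_le_log hε hs0 hp)) (haz b hb)
    refine h1.hasBitComplexity ?_
    have h2 := column_bits_le (n := n) (m := m) (b := b) (K := K) (L := Real.log (2 + s / ε)) rfl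
      (by linarith) (Nat.floor_le (by positivity)) (by omega)
    push_cast at h2 ⊢
    exact h2
  obtain ⟨k, hE, hG, hy, -, -, v, -, hcase⟩ := hrun.final
  obtain ⟨a, L, hph, ha, hL⟩ := hrun.phases
  refine ⟨tr, σ, hrun.exec, ?_, ?_, ?_, ?_, ?_, ?_, ?_⟩
  · rcases hcase with ⟨h1, -, h3⟩ | ⟨h1, h2, -⟩
    · exact Or.inr ⟨h1, isInfeasibilityCertificate_of_cert h3⟩
    · refine Or.inl ⟨h1, isApproxScaling_of_evald h2 (fun j hj => one_pos.trans_le (hy j hj)) ?_⟩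
      rcases h2.flag with h | h
      · have := hrun.stopped
        omega
      · exact h.2
  · refine hit.trans ?_
    have hK72 : (72 : ℝ) ≤ K := by exact_mod_cast (by omega : 72 ≤ K)
    rw [← mul_assoc]
    exact mul_le_mul_of_nonneg_right (mul_le_mul_of_nonneg_right hK72 (by positivity))
      Real.posLog_nonneg
  · rw [hph]
    intro t ht
    simp only [List.head?_cons, Option.mem_def, Option.some.injEq] at ht
    exact initialization_cost_le (by omega) (by rw [← hXe]; omega)
  · rw [hph, List.tail_cons]
    intro t ht
    -- For nnz(A) = 0 the claimed cost of an iteration is 0, so there must be no iteration. In that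
    -- case n = 0, and the bound on the number of iterations is 0.
    have hEpos : 0 < nnz A := by
      rcases Nat.eq_zero_or_pos (nnz A) with h | h
      · have hn : n = 0 := by
          have : n ≤ nnz A := Inst.n_le_E hcol'
          omega
        have h0 : iterationCount tr = 0 := by
          subst hn
          have h1 : (iterationCount tr : ℝ) ≤ 0 := by simpa using hit
          exact_mod_cast le_antisymm h1 (by positivity)
        have hfree : ∀ v ∈ tr, v.isMark = false := by
          simpa [iterationCount, List.countP_eq_zero] using h0
        rw [phaseCosts_of_markFree tr hfree, List.cons.injEq] at hph
        rw [← hph.2] at ht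
        simp at ht
      · exact h
    have h1 := (hL t ht).trans (Inst.iteration_cost_le hEpos (Inst.n_le_E hcol'))
    refine h1.trans (Nat.mul_le_mul (Nat.mul_le_mul_right _ hK0) ?_)
    exact Nat.le_self_pow (by omega) _
  · intro v hv hm j
    obtain ⟨k, -, -, h, -⟩ := hrun.marks v hv hm
    exact one_pos.trans_le (h j j.2)
  · exact fun b hb => ⟨fun v hv _ j => hcs' b hb _ (hrun.good v hv j),
      fun _ j => hcs' b hb _ (hG j)⟩
  · intro b hAb hrb hcb hεb v hv a k
    have hN1 : 1 ≤ n + m + b + 1 := by omega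
    have ht := sum_div_le hε hcs (fun j => (hcb j).sz) hεb.sz
    have hw : 7 + 7 * n + 4 * b + 1 + n * (7 + 7 * n + 4 * b + 2 * b) ≤
        17 * (n + m + b + 1) ^ 2 := by
      have h1 : n * (7 + 7 * n + 4 * b + 2 * b) ≤
          (n + m + b + 1) * (7 * (n + m + b + 1)) := Nat.mul_le_mul (by omega) (by omega)
      have h2 := Nat.le_mul_self (n + m + b + 1)
      have h3 : (n + m + b + 1) * (7 * (n + m + b + 1)) = 7 * ((n + m + b + 1) * (n + m + b + 1)) := by
        ring
      rw [pow_two]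
      omega
    refine hasBitComplexity_cast (hasBitComplexity_of_sz hN1 hw
      (hrun.length_le hs0 hε ht rfl) hK ?_)
    exact memory_sz hrun.exec (inputState_sz hAb hrb hcb hεb) (by omega)
      (fun v hv k => (hrun.good v hv k).sz
        (fun p hp => precision_le_of_bits hε hs0 ht hp) (haz b hAb)) v hv a k

end

end MatrixScaling

theorem mainTheorem2 :
    ∃ (P : MatrixScaling.Program) (K : ℕ),
      ∀ (m n : ℕ) (A : Matrix (Fin m) (Fin n) ℝ) (r : Fin m → ℝ) (c : Fin n → ℝ) (s ε : ℝ),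
        (∀ i j, 0 ≤ A i j) → (∀ i, 0 < r i) → (∀ j, 0 < c j) →
        ∑ i, r i = s → ∑ j, c j = s → 0 < ε →
        ∀ e : Fin (nnz A) ≃ Support A,
          ∃ (tr : List Event) (σ : State), Exec P (inputState A r c ε e) tr σ ∧
            -- the output is correct
            ((σ.flag = 0 ∧ IsApproxScaling A r c ε (σ.rowScaling m) (σ.columnScaling n)) ∨
              (σ.flag = 1 ∧ IsInfeasibilityCertificate A r c (σ.columnSet n))) ∧
            -- the number of iterations
            (iterationCount tr : ℝ) ≤ K * (n : ℝ) ^ 3 * Real.posLog (s * n / ε) ∧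
            -- the number of operations before the first iteration, and in each iteration
            (∀ t ∈ (phaseCosts tr).head?,
              t ≤ K * (nnz A + m + n + 1) * (Nat.log 2 (nnz A + m + n + 1) + 1) ^ K) ∧
            (∀ t ∈ (phaseCosts tr).tail, t ≤ K * nnz A * (Nat.log 2 (nnz A) + 1) ^ K) ∧
            -- the current column scaling at the start of each iteration is positive
            (∀ v ∈ tr, v.isMark = true → ∀ j, 0 < v.state.columnScaling n j) ∧
            -- bit complexity of the intermediate and final column scalings
            (∀ b : ℕ, (∀ i j, HasBitComplexity (A i j) b) →
              (∀ v ∈ tr, v.isMark = true → ∀ j, HasBitComplexity (v.state.columnScaling n j)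
                (K * (n + m + b + 1) ^ K * Real.log (2 + s / ε))) ∧
              (σ.flag = 0 → ∀ j, HasBitComplexity (σ.columnScaling n j)
                (K * (n + m + b + 1) ^ K * Real.log (2 + s / ε)))) ∧
            -- bit complexity of all intermediate quantities, for input of bounded bit complexity
            (∀ b : ℕ, (∀ i j, HasBitComplexity (A i j) b) → (∀ i, HasBitComplexity (r i) b) →
              (∀ j, HasBitComplexity (c j) b) → HasBitComplexity ε b →
              ∀ v ∈ tr, ∀ a k, HasBitComplexity (v.state.real a k)
                (K * (n + m + b + 1) ^ K)) := by
  -- The first summand covers the cost of an iteration, the second the sizes of all reals in memory.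
  refine ⟨scalingProgram, 6000 + 38 * 3300000 ^ 16, fun m n A r c s ε hA hr hc hrs hcs hε e => ?_⟩
  by_cases h : (∃ j, ∀ i, A i j = 0) ∨ ∃ i, ∀ j, A i j = 0
  · exact conclusion_of_empty le_rfl hr hc hrs hcs h
  · push Not at h
    exact conclusion_of_full le_rfl hA hr hc hrs hcs hε h.2 h.1
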